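/- Let $\mu>0$ and let $v:[0,\infty)\to[0,\infty]$ be measurable with $v(r)=0$ for $r>R_0$, where $0\le R_0<\infty$. Let $a\ge 0$ be the two-dimensional scattering length of $v$: for $R>R_0$, the minimizer $\phi_0$ of $$\mathcal E_R[\phi]=\int_{\{x\in\mathbb R^2:\,|x|<R\}}\Big(\mu|\nabla\phi(x)|^2+\tfrac12 v(|x|)|\phi(x)|^2\Big)\,dx$$ among $\phi\in H^1(\{|x|<R\})$ with $\phi=1$ on $|x|=R$ has the form $\phi_0(x)=\ln(|x|/a)/\ln(R/a)$ for $R_0<|x|<R$ (with $a=0$ meaning that $\phi_0=1$ there); $a$ does not depend on $R$. Let $U:[0,\infty)\to[0,\infty]$ be any measurable function with $$\int_0^\infty U(r)\ln(r/a)\,r\,dr\le 1\qquad\text{and}\qquad U(r)=0\ \text{ for } r<R_0,$$ where $\ln(r/a)=+\infty$ if $a=0$, and $0\cdot\infty=0$. Let $N\ge 2$ and let $\Lambda\subset\mathbb R^2$ be open and convex (for instance an open rectangle, or $\mathbb R^2$ itself). On totally symmetric functions in $L^2(\Lambda^N)$ consider, with Neumann boundary conditions, $$T^{(N)}=-\mu\sum_{i=1}^N\Delta_i,\qquad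 H^{(N)}=T^{(N)}+\sum_{1\le i<j\le N}v(|x_i-x_j|),\qquad W(x_1,\dots,x_N)=\sum_{i=1}^N U\Big(\min_{j\ne i}|x_i-x_j|\Big).$$ Then, for every $0<\varepsilon<1$, $$H^{(N)}\ \ge\ \varepsilon\,T^{(N)}+(1-\varepsilon)\,\mu\,W$$ in the sense of quadratic forms: for every totally symmetric $\Psi\in L^2(\Lambda^N)$, $$\mu\int_{\Lambda^N}\sum_{i=1}^N|\nabla_i\Psi|^2+\int_{\Lambda^N}\sum_{i<j}v(|x_i-x_j|)|\Psi|^2\ \ge\ \varepsilon\mu\int_{\Lambda^N}\sum_{i=1}^N|\nabla_i\Psi|^2+(1-\varepsilon)\mu\int_{\Lambda^N}W|\Psi|^2,$$ as an inequality in $[0,\infty]$, where the kinetic term is $+\infty$ if $\Psi\notin H^1(\Lambda^N)$. -/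

import Mathlib

open MeasureTheory Set
open scoped ENNReal ContDiff

namespace BoseGas

noncomputable section

/-! ### Weak derivatives and Dirichlet energy on open sets -/

/-- `g` is the weak (distributional) derivative of `f` on the open set `Ω` in the direction `e`.
It is only used for `f` and `g` that are square integrable on `Ω`. -/
def HasWeakDeriv {E : Type*} [NormedAddCommGroup E] [NormedSpace ℝ E] [MeasureSpace E]
    (Ω : Set E) (e : E) (f g : E → ℂ) : Prop :=
  ∀ η : E → ℝ, ContDiff ℝ ∞ η → HasCompactSupport η → tsupport η ⊆ Ω →
    ∫ x in Ω, f x * ((fderiv ℝ η x e : ℝ) : ℂ) = -∫ x in Ω, g x * ((η x : ℝ) : ℂ)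

/-- `G` is the weak gradient of `f` on `Ω`, with square integrable components, with respect to
the coordinate directions `b`. -/
def IsWeakGradient {E ι : Type*} [NormedAddCommGroup E] [NormedSpace ℝ E] [MeasureSpace E]
    (b : ι → E) (Ω : Set E) (f : E → ℂ) (G : ι → E → ℂ) : Prop :=
  ∀ k, MemLp (G k) 2 (volume.restrict Ω) ∧ HasWeakDeriv Ω (b k) f (G k)

/-- `∫_Ω |∇f|²`, with the value `∞` if `f` has no square integrable weak gradient on `Ω`.
(The weak gradient is unique almost everywhere, so the infimum runs over at most one value.) -/
def dirichletEnergy {E ι : Type*} [Fintype ι] [NormedAddCommGroup E] [NormedSpace ℝ E]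
    [MeasureSpace E] (b : ι → E) (Ω : Set E) (f : E → ℂ) : ℝ≥0∞ :=
  ⨅ (G : ι → E → ℂ) (_ : IsWeakGradient b Ω f G), ∫⁻ x in Ω, ∑ k, ‖G k x‖ₑ ^ 2

/-- The Sobolev space `H¹(Ω)`. -/
def MemH1 {E ι : Type*} [NormedAddCommGroup E] [NormedSpace ℝ E] [MeasureSpace E]
    (b : ι → E) (Ω : Set E) (f : E → ℂ) : Prop :=
  MemLp f 2 (volume.restrict Ω) ∧ ∃ G, IsWeakGradient b Ω f G

/-! ### The scattering length in two dimensions -/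

/-- The Euclidean plane. -/
abbrev Plane : Type := EuclideanSpace ℝ (Fin 2)

/-- The two coordinate directions of the plane. -/
def planeDir (k : Fin 2) : Plane := EuclideanSpace.single k 1

/-- `𝓔_R[φ] = ∫_{|x|<R} μ |∇φ|² + ½ v(|x|) |φ|²`. -/
def scatteringEnergy (μ : ℝ) (v : ℝ → ℝ≥0∞) (R : ℝ) (φ : Plane → ℂ) : ℝ≥0∞ :=
  ENNReal.ofReal μ * dirichletEnergy planeDir (Metric.ball 0 R) φ +
    ∫⁻ x in Metric.ball (0 : Plane) R, 2⁻¹ * v ‖x‖ * ‖φ x‖ₑ ^ 2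

/-- `φ ∈ H¹(B_R)` with boundary value `1` on the circle `|x| = R`. The boundary condition is
expressed by saying that the extension of `φ - 1` by zero outside `B_R` lies in `H¹(ℝ²)`. -/
def IsTrial (R : ℝ) (φ : Plane → ℂ) : Prop :=
  MemH1 planeDir univ (fun x => φ x - 1) ∧ ∀ᵐ x : Plane, R ≤ ‖x‖ → φ x = 1

/-- `φ` minimizes `𝓔_R` under the boundary condition `φ = 1` on `|x| = R`. -/
def IsScatteringMinimizer (μ : ℝ) (v : ℝ → ℝ≥0∞) (R : ℝ) (φ : Plane → ℂ) : Prop :=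
  IsTrial R φ ∧ ∀ ψ, IsTrial R ψ → scatteringEnergy μ v R φ ≤ scatteringEnergy μ v R ψ

/-- The profile `ln(r/a) / ln(R/a)`; for `a = 0` it is the constant `1`. -/
def asympProfile (a R r : ℝ) : ℝ :=
  if a = 0 then 1 else Real.log (r / a) / Real.log (R / a)

/-- `a` is the scattering length of the potential `v` of range `R₀`: outside the range of `v`,
the minimizer of `𝓔_R` (`R > R₀`) equals `ln(r/a) / ln(R/a)`. The number `a` does not depend on
the choice of `R > R₀`. -/
def IsScatteringLength (μ : ℝ) (v : ℝ → ℝ≥0∞) (R₀ a : ℝ) : Prop :=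
  0 ≤ a ∧ ∃ R, R₀ < R ∧ ∃ φ₀ : Plane → ℂ, IsScatteringMinimizer μ v R φ₀ ∧
    ∀ᵐ x : Plane, R₀ < ‖x‖ → ‖x‖ < R → φ₀ x = ((asympProfile a R ‖x‖ : ℝ) : ℂ)

/-- `ln(r/a)` as an extended nonnegative number, equal to `∞` for `a = 0`. It is only used for
`r ≥ R₀ ≥ a`, where the logarithm is nonnegative. -/
def logRatio (r a : ℝ) : ℝ≥0∞ :=
  if a = 0 then ∞ else ENNReal.ofReal (Real.log (r / a))

/-! ### The many-body system -/

/-- Configurations `(x₁, …, x_N)` of `N` particles in the plane, with Lebesgue measure. -/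
abbrev Config (N : ℕ) : Type := Fin N → Plane

/-- The coordinate directions of the configuration space. -/
def configDir {N : ℕ} (p : Fin N × Fin 2) : Config N := Pi.single p.1 (planeDir p.2)

/-- The configurations with all particles in `Λ`. -/
def configIn (N : ℕ) (Λ : Set Plane) : Set (Config N) := {x | ∀ i, x i ∈ Λ}

/-- Totally symmetric, square integrable wave functions of `N` particles in `Λ`. -/
def IsBosonic (N : ℕ) (Λ : Set Plane) (Ψ : Config N → ℂ) : Prop :=
  MemLp Ψ 2 (volume.restrict (configIn N Λ)) ∧
    ∀ σ : Equiv.Perm (Fin N), ∀ᵐ x ∂volume.restrict (configIn N Λ), Ψ (fun i => x (σ i)) = Ψ x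

/-- The pair interaction `∑_{i<j} v(|x_i - x_j|)`. -/
def pairPotential {N : ℕ} (v : ℝ → ℝ≥0∞) (x : Config N) : ℝ≥0∞ :=
  ∑ i, ∑ j ∈ Finset.Ioi i, v (dist (x i) (x j))

/-- The distance `min_{j ≠ i} |x_i - x_j|` of particle `i` to its nearest neighbour. -/
def nearestDist {N : ℕ} (x : Config N) (i : Fin N) : ℝ :=
  ⨅ j : {j : Fin N // j ≠ i}, dist (x i) (x j)

/-- `W(x₁, …, x_N) = ∑_i U(min_{j ≠ i} |x_i - x_j|)`. -/
def nearestNeighbour {N : ℕ} (U : ℝ → ℝ≥0∞) (x : Config N) : ℝ≥0∞ :=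
  ∑ i, U (nearestDist x i)

/-! The operators are given by their quadratic forms `Ψ ↦ ⟨Ψ, A Ψ⟩`, with values in `[0, ∞]` and
equal to `∞` outside the form domain. For nonnegative operators, `A ≥ B` means that
`⟨Ψ, A Ψ⟩ ≥ ⟨Ψ, B Ψ⟩` for all wave functions `Ψ`, in this sense. -/

/-- `⟨Ψ, T Ψ⟩` for `T = -μ ∑_i Δ_i` with Neumann boundary conditions on `Λ`;
the form domain is `H¹(Λ^N)`. -/
def kineticForm (N : ℕ) (μ : ℝ) (Λ : Set Plane) (Ψ : Config N → ℂ) : ℝ≥0∞ :=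
  ENNReal.ofReal μ * dirichletEnergy configDir (configIn N Λ) Ψ

/-- `⟨Ψ, F Ψ⟩` for the multiplication operator by a nonnegative function `F`. -/
def potentialForm (N : ℕ) (Λ : Set Plane) (F : Config N → ℝ≥0∞) (Ψ : Config N → ℂ) : ℝ≥0∞ :=
  ∫⁻ x in configIn N Λ, F x * ‖Ψ x‖ₑ ^ 2

/-- `⟨Ψ, H Ψ⟩` for the Hamiltonian `H = -μ ∑_i Δ_i + ∑_{i<j} v(|x_i - x_j|)`. -/
def hamiltonianForm (N : ℕ) (μ : ℝ) (v : ℝ → ℝ≥0∞) (Λ : Set Plane) (Ψ : Config N → ℂ) : ℝ≥0∞ :=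
  kineticForm N μ Λ Ψ + potentialForm N Λ (pairPotential v) Ψ

end

end BoseGas

/-! It suffices to prove `μ W ≤ H`: since `T ≤ H` as well, the convex combination `ε T + (1 - ε) μ
W` is then at most `H`. The bound `μ W ≤ H` is a Dyson-type lemma: part of the energy of a hard
short-range potential is traded for a soft potential acting between nearest neighbours.

Fix a particle `i` and cut `Λ^N` into cells according to the nearest neighbour `j` of `i`. Each cell
is star-shaped in `x_i` about `x_j`: `Λ` is convex, and moving `i` straight towards `j` keeps `j`
nearest (`dilate_mem_nearestCell`). On a cell, particle `i` carries the density `μ |∇_i Ψ|² + ½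
v(|x_i - x_j|) |Ψ|²`. Half of `v` suffices, because every pair is seen from both of its particles.

On a single ray from `x_j` only the radial derivative is kept, and the values of `Ψ` along the ray
are treated as a radial function in the plane. The variational meaning of the scattering length then
gives, for `ρ = |x_i - x_j| > R₀`, `μ |Ψ(ρ)|² ≤ ln(ρ/a) ∫_0^ρ (μ |Ψ'|² + ½ v |Ψ|²) r dr`.
Multiplying by `U(ρ) ρ`, integrating over `ρ` and enlarging the inner integral to the whole ray
gives `μ ∫ U |Ψ|² ≤` energy of the cell, by `∫ U ln(ρ/a) ρ dρ ≤ 1` (`pair_bound`). Summation over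
`j` and `i` finishes the argument. If `a = 0`, the integral condition forces `U = 0` almost
everywhere on the positive half-line.

Two ingredients need work. The first is the radial inequality
(`IsScatteringLength.le_radialEnergy`). Varying the minimizer towards a radial function that
vanishes on the range of `v` shows that the minimal energy is `2πμ / ln(R/a)`
(`IsScatteringMinimizer.energy_eq`); the cross term is a flux through an annulus where the minimizer
is known. Comparison with a logarithm vanishing at `b` in `(R₀, a)` rules out `a > R₀` (`le_range`),
so the logarithms are positive. The inequality at the given radius is carried to every radius by
extending or cutting off the slope.

The second is that a function with a square integrable weak gradient is, along almost every ray, the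
integral of its radial derivative (`ae_sub_dilate_eq`). Rays are parametrised by the dilations
`dilate i j s`, `0 < s ≤ 1`, of `x_i` about `x_j`, which replaces polar coordinates centred at a
moving particle. -/

namespace BoseGas

/-! ### Polar coordinates and the divergence theorem on discs. -/

noncomputable section

/-- The point of the plane with polar coordinates `(r, θ)`. -/
def polarPoint (r θ : ℝ) : Plane := !₂[r * Real.cos θ, r * Real.sin θ]

lemma polarPoint_eq (r θ : ℝ) :
    polarPoint r θ = (r * Real.cos θ) • planeDir 0 + (r * Real.sin θ) • planeDir 1 := by
  ext k; fin_cases k <;> simp [polarPoint, planeDir]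

lemma norm_polarPoint {r : ℝ} (hr : 0 ≤ r) (θ : ℝ) : ‖polarPoint r θ‖ = r := by
  rw [EuclideanSpace.norm_eq]
  simp only [polarPoint, Fin.sum_univ_two, Real.norm_eq_abs, sq_abs]
  simp only [Matrix.cons_val_zero, Matrix.cons_val_one]
  rw [show (r * Real.cos θ) ^ 2 + (r * Real.sin θ) ^ 2 = r ^ 2 * (Real.sin θ ^ 2 + Real.cos θ ^ 2)
    by ring, Real.sin_sq_add_cos_sq, mul_one, Real.sqrt_sq hr]

lemma polarPoint_apply (r θ : ℝ) (k : Fin 2) : polarPoint r θ k = r * polarPoint 1 θ k := by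
  fin_cases k <;> simp [polarPoint]

lemma continuous_polarPoint : Continuous fun z : ℝ × ℝ => polarPoint z.1 z.2 := by
  simp only [polarPoint_eq]; fun_prop

lemma contDiff_polarPoint : ContDiff ℝ ∞ fun z : ℝ × ℝ => polarPoint z.1 z.2 := by
  simp only [polarPoint_eq]; fun_prop

/-- The plane as a product of two lines. -/
def planeEquiv : ℝ × ℝ ≃ᵐ Plane :=
  MeasurableEquiv.finTwoArrow.symm.trans (MeasurableEquiv.toLp 2 (Fin 2 → ℝ))

lemma measurePreserving_planeEquiv : MeasurePreserving planeEquiv := 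
  (PiLp.volume_preserving_toLp (Fin 2)).comp (volume_preserving_finTwoArrow ℝ).symm

lemma lintegral_plane_polar (f : Plane → ℝ≥0∞) :
    ∫⁻ x, f x = ∫⁻ z in Ioi (0 : ℝ) ×ˢ Ioo (-Real.pi) Real.pi,
      ENNReal.ofReal z.1 * f (polarPoint z.1 z.2) := by
  rw [← measurePreserving_planeEquiv.lintegral_comp_emb planeEquiv.measurableEmbedding,
    ← lintegral_comp_polarCoord_symm]
  rfl

lemma integral_plane_polar {F : Type*} [NormedAddCommGroup F] [NormedSpace ℝ F] (f : Plane → F) :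
    ∫ x, f x = ∫ z in Ioi (0 : ℝ) ×ˢ Ioo (-Real.pi) Real.pi, z.1 • f (polarPoint z.1 z.2) := by
  rw [← measurePreserving_planeEquiv.integral_comp planeEquiv.measurableEmbedding,
    ← integral_comp_polarCoord_symm]
  rfl

lemma lintegral_plane_radial {f : ℝ → ℝ≥0∞} (hf : Measurable f) :
    ∫⁻ x : Plane, f ‖x‖ = ENNReal.ofReal (2 * Real.pi) *
      ∫⁻ r in Ioi (0 : ℝ), f r * ENNReal.ofReal r := by
  rw [lintegral_plane_polar, Measure.volume_eq_prod, ← Measure.prod_restrict,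
    lintegral_prod _ (by
      apply Measurable.aemeasurable
      have := continuous_polarPoint.measurable
      fun_prop)]
  rw [← lintegral_const_mul _ (by fun_prop)]
  refine setLIntegral_congr_fun measurableSet_Ioi fun r (hr : 0 < r) => ?_
  simp only [norm_polarPoint hr.le, lintegral_const, Measure.restrict_apply MeasurableSet.univ,
    univ_inter, Real.volume_Ioo]
  rw [show Real.pi - -Real.pi = 2 * Real.pi by ring]
  ring

lemma integral_plane_radial (f : ℝ → ℝ) :
    ∫ x : Plane, f ‖x‖ = 2 * Real.pi * ∫ r in Ioi (0 : ℝ), r * f r := by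
  rw [integral_fun_norm_addHaar volume f]
  simp [Measure.real, mul_assoc, Real.pi_pos.le]

lemma hasDerivAt_comp_polarPoint_radius {η : Plane → ℝ} (hη : ContDiff ℝ ∞ η) (r θ : ℝ) :
    HasDerivAt (fun s => η (polarPoint s θ)) (Real.cos θ * fderiv ℝ η (polarPoint r θ) (planeDir 0)
      + Real.sin θ * fderiv ℝ η (polarPoint r θ) (planeDir 1)) r := by
  have h1 : HasDerivAt (fun s => polarPoint s θ)
      (Real.cos θ • planeDir 0 + Real.sin θ • planeDir 1) r := by
    simp only [polarPoint_eq]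
    exact ((hasDerivAt_mul_const _).smul_const _).add ((hasDerivAt_mul_const _).smul_const _)
  have h2 := ((hη.differentiable (by simp)) (polarPoint r θ)).hasFDerivAt.comp_hasDerivAt r h1
  convert! h2 using 1
  simp

lemma hasDerivAt_comp_polarPoint_angle {η : Plane → ℝ} (hη : ContDiff ℝ ∞ η) (r θ : ℝ) :
    HasDerivAt (fun s => η (polarPoint r s))
      (r * (-Real.sin θ * fderiv ℝ η (polarPoint r θ) (planeDir 0)
      + Real.cos θ * fderiv ℝ η (polarPoint r θ) (planeDir 1))) θ := by
  have h1 : HasDerivAt (fun s => polarPoint r s)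
      ((r * -Real.sin θ) • planeDir 0 + (r * Real.cos θ) • planeDir 1) θ := by
    simp only [polarPoint_eq]
    exact (((Real.hasDerivAt_cos θ).const_mul r).smul_const _).add
      (((Real.hasDerivAt_sin θ).const_mul r).smul_const _)
  have h2 := ((hη.differentiable (by simp)) (polarPoint r θ)).hasFDerivAt.comp_hasDerivAt θ h1
  convert! h2 using 1
  simp; ring

/-- The divergence theorem on a disc. -/
lemma integral_ball_fderiv {η : Plane → ℝ} (hη : ContDiff ℝ ∞ η) (k : Fin 2) {s : ℝ} (hs : 0 < s) :
    ∫ x in Metric.ball (0 : Plane) s, fderiv ℝ η x (planeDir k) =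
      ∫ θ in Ioo (-Real.pi) Real.pi, s * (polarPoint 1 θ k * η (polarPoint s θ)) := by
  -- `w` is the `k`-th component of the unit normal as a function of the angle and `w'` is its
  -- derivative, so `w'' = -w`. The last two identities decompose the direction `k` into radial and
  -- angular parts.
  obtain ⟨w, w', hw, hw', hw0, hwk⟩ : ∃ w w' : ℝ → ℝ, ContDiff ℝ ∞ w ∧ (∀ θ, HasDerivAt w' (-w θ) θ) ∧
      ContDiff ℝ ∞ w' ∧ ((∀ θ, polarPoint 1 θ k = w θ) ∧ w' Real.pi = w' (-Real.pi) ∧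
      ∀ θ, w θ * Real.cos θ - w' θ * Real.sin θ = planeDir k 0 ∧
        w θ * Real.sin θ + w' θ * Real.cos θ = planeDir k 1) := by
    fin_cases k
    · refine ⟨Real.cos, fun θ => - Real.sin θ, Real.contDiff_cos, fun θ => (Real.hasDerivAt_sin θ).neg,
        Real.contDiff_sin.neg, fun θ => by simp [polarPoint], by simp, fun θ => ⟨?_, ?_⟩⟩
      · simp [planeDir]; nlinarith [Real.sin_sq_add_cos_sq θ]
      · simp [planeDir]; ring
    · refine ⟨Real.sin, fun θ => Real.cos θ, Real.contDiff_sin, fun θ => (Real.hasDerivAt_cos θ),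
        Real.contDiff_cos, fun θ => by simp [polarPoint], by simp, fun θ => ⟨?_, ?_⟩⟩
      · simp [planeDir]; ring
      · simp [planeDir]; nlinarith [Real.sin_sq_add_cos_sq θ]
  obtain ⟨hwp, hper, hfr⟩ := hwk
  have hdir : planeDir k = (planeDir k 0) • planeDir 0 + (planeDir k 1) • planeDir 1 := by
    ext l; fin_cases k <;> fin_cases l <;> simp [planeDir]
  -- These fields satisfy `∂_r A + ∂_θ B = r ∂_k η`: the terms `w η` cancel because `w'' = -w`. The
  -- disc integral thus becomes a divergence over a rectangle in `(r, θ)`.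
  let A : ℝ × ℝ → ℝ := fun z => z.1 * (w z.2 * η (polarPoint z.1 z.2))
  let B : ℝ × ℝ → ℝ := fun z => w' z.2 * η (polarPoint z.1 z.2)
  have hηp : ContDiff ℝ ∞ fun z : ℝ × ℝ => η (polarPoint z.1 z.2) := hη.comp contDiff_polarPoint
  have hA : ContDiff ℝ ∞ A := contDiff_fst.mul ((hw.comp contDiff_snd).mul hηp)
  have hB : ContDiff ℝ ∞ B := (hw0.comp contDiff_snd).mul hηp
  have hAd : ∀ z, HasFDerivAt A (fderiv ℝ A z) z := fun z =>
    (hA.differentiable (by simp) z).hasFDerivAt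
  have hBd : ∀ z, HasFDerivAt B (fderiv ℝ B z) z := fun z =>
    (hB.differentiable (by simp) z).hasFDerivAt
  have hdiv : ∀ z : ℝ × ℝ, fderiv ℝ A z (1, 0) + fderiv ℝ B z (0, 1) =
      z.1 * fderiv ℝ η (polarPoint z.1 z.2) (planeDir k) := by
    rintro ⟨r, θ⟩
    have h1 : HasDerivAt (fun t => A (t, θ)) (fderiv ℝ A (r, θ) (1, 0)) r :=
      (hAd (r, θ)).comp_hasDerivAt (f := fun t => (t, θ)) r ((hasDerivAt_id r).prodMk (hasDerivAt_const r θ))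
    have h2 : HasDerivAt (fun t => B (r, t)) (fderiv ℝ B (r, θ) (0, 1)) θ :=
      (hBd (r, θ)).comp_hasDerivAt (f := fun t => (r, t)) θ ((hasDerivAt_const θ r).prodMk (hasDerivAt_id θ))
    have h1' := h1.unique ((hasDerivAt_id r).mul
      ((hasDerivAt_comp_polarPoint_radius hη r θ).const_mul (w θ)))
    have h2' := h2.unique ((hw' θ).mul (hasDerivAt_comp_polarPoint_angle hη r θ))
    rw [h1', h2', hdir]
    simp only [map_add, map_smul, smul_eq_mul, ← (hfr θ).1, ← (hfr θ).2, id]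
    ring
  have hcont : Continuous fun z : ℝ × ℝ => fderiv ℝ A z (1, 0) + fderiv ℝ B z (0, 1) := by
    have h1 := hA.continuous_fderiv (by simp)
    have h2 := hB.continuous_fderiv (by simp)
    exact (h1.clm_apply continuous_const).add (h2.clm_apply continuous_const)
  have hpi : -Real.pi ≤ Real.pi := by linarith [Real.pi_pos]
  have key := integral_divergence_prod_Icc_of_hasFDerivAt_of_le A B (fderiv ℝ A) (fderiv ℝ B)
    (0, -Real.pi) (s, Real.pi) ⟨hs.le, hpi⟩ hA.continuous.continuousOn hB.continuous.continuousOn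
    (fun x _ => hAd x) (fun x _ => hBd x)
    (hcont.continuousOn.integrableOn_compact isCompact_Icc)
  -- The edges `θ = ±π` cancel by periodicity and the edge `r = 0` carries the factor `r`, so only
  -- the edge `r = s` remains.
  have hper' : ∀ r, B (r, Real.pi) = B (r, -Real.pi) := by
    intro r; simp [B, hper, polarPoint]
  simp only [hper', sub_self, zero_add] at key
  have hA0 : ∀ θ, A (0, θ) = 0 := fun θ => by simp [A]
  simp only [hA0, intervalIntegral.integral_zero, sub_zero] at key
  rw [intervalIntegral.integral_of_le hpi, integral_Ioc_eq_integral_Ioo] at key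
  simp only [hwp]
  rw [show (∫ θ in Ioo (-Real.pi) Real.pi, s * (w θ * η (polarPoint s θ))) =
    ∫ θ in Ioo (-Real.pi) Real.pi, A (s, θ) from rfl, ← key,
    ← integral_indicator Metric.isOpen_ball.measurableSet, integral_plane_polar,
    ← integral_indicator (measurableSet_Ioi.prod measurableSet_Ioo),
    ← integral_indicator measurableSet_Icc]
  refine integral_congr_ae ?_
  -- The closed rectangle and the polar image of the open disc differ only on these four lines.
  have hnull : ∀ᵐ z : ℝ × ℝ, z.1 ≠ 0 ∧ z.1 ≠ s ∧ z.2 ≠ -Real.pi ∧ z.2 ≠ Real.pi := by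
    have h1 : ∀ c : ℝ, ∀ᵐ z : ℝ × ℝ, z.1 ≠ c := fun c =>
      Measure.quasiMeasurePreserving_fst.ae (Measure.ae_ne volume c)
    have h2 : ∀ c : ℝ, ∀ᵐ z : ℝ × ℝ, z.2 ≠ c := fun c =>
      Measure.quasiMeasurePreserving_snd.ae (Measure.ae_ne volume c)
    filter_upwards [h1 0, h1 s, h2 (-Real.pi), h2 Real.pi] with z a b c d using ⟨a, b, c, d⟩
  filter_upwards [hnull] with z ⟨h1, h2, h3, h4⟩
  by_cases hz : z ∈ Icc ((0 : ℝ), -Real.pi) (s, Real.pi)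
  · have hz1 : 0 < z.1 := lt_of_le_of_ne hz.1.1 (Ne.symm h1)
    have hz2 : z.1 < s := lt_of_le_of_ne hz.2.1 h2
    have hz3 : -Real.pi < z.2 := lt_of_le_of_ne hz.1.2 (Ne.symm h3)
    have hz4 : z.2 < Real.pi := lt_of_le_of_ne hz.2.2 h4
    rw [indicator_of_mem hz, indicator_of_mem (show z ∈ Ioi (0:ℝ) ×ˢ Ioo (-Real.pi) Real.pi from
      ⟨hz1, hz3, hz4⟩), indicator_of_mem (by simpa [norm_polarPoint hz1.le] using hz2), hdiv]
    simp
  · rw [indicator_of_notMem hz]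
    by_cases hz' : z ∈ Ioi (0:ℝ) ×ˢ Ioo (-Real.pi) Real.pi
    · rw [indicator_of_mem hz', indicator_of_notMem, smul_zero]
      intro hb
      rw [mem_ball_zero_iff, norm_polarPoint (le_of_lt hz'.1)] at hb
      exact hz ⟨⟨(le_of_lt hz'.1), hz'.2.1.le⟩, ⟨hb.le, hz'.2.2.le⟩⟩
    · rw [indicator_of_notMem hz']

end

noncomputable section

/-! ### Weak derivatives: elementary facts -/

lemma lintegral_mul_sq_le {α : Type*} [MeasurableSpace α] (ν : Measure α) {f g : α → ℝ≥0∞}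
    (hf : AEMeasurable f ν) (hg : AEMeasurable g ν) :
    (∫⁻ x, f x * g x ∂ν) ^ 2 ≤ (∫⁻ x, f x ^ 2 ∂ν) * ∫⁻ x, g x ^ 2 ∂ν := by
  have h := ENNReal.lintegral_mul_le_Lp_mul_Lq ν Real.HolderConjugate.two_two hf hg
  simp only [Pi.mul_apply, ENNReal.rpow_ofNat] at h
  calc (∫⁻ x, f x * g x ∂ν) ^ 2 ≤ ((∫⁻ x, f x ^ 2 ∂ν) ^ (1 / 2 : ℝ) *
        (∫⁻ x, g x ^ 2 ∂ν) ^ (1 / 2 : ℝ)) ^ 2 := by gcongr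
    _ = _ := by
      rw [mul_pow, ← ENNReal.rpow_natCast, ← ENNReal.rpow_natCast, ← ENNReal.rpow_mul,
        ← ENNReal.rpow_mul]
      norm_num

lemma memLp_two_iff {α : Type*} [MeasurableSpace α] {ν : Measure α} {f : α → ℂ} :
    MemLp f 2 ν ↔ AEStronglyMeasurable f ν ∧ ∫⁻ x, ‖f x‖ₑ ^ 2 ∂ν < ⊤ := by
  unfold MemLp
  rw [eLpNorm_lt_top_iff_lintegral_rpow_enorm_lt_top (by simp) (by simp)]
  simp

/-- The product of a function that is square integrable on `Ω` with a continuous function of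
compact support in `Ω` is integrable. -/
lemma integrableOn_mul_of_hasCompactSupport {E : Type*} [NormedAddCommGroup E]
    [MeasureSpace E] [BorelSpace E] [IsLocallyFiniteMeasure (volume : Measure E)] {Ω : Set E} {f : E → ℂ} (hf : MemLp f 2 (volume.restrict Ω)) {η : E → ℝ} (hη : Continuous η)
    (hc : HasCompactSupport η) : IntegrableOn (fun x => f x * ((η x : ℝ) : ℂ)) Ω := by
  have h : MemLp (fun x => ((η x : ℝ) : ℂ)) 2 (volume.restrict Ω) := by
    refine MemLp.restrict _ (Continuous.memLp_of_hasCompactSupport (by fun_prop) ?_)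
    exact hc.comp_left (g := fun t : ℝ => (t : ℂ)) (by simp)
  exact hf.integrable_mul h

section Weak

variable {E : Type*} [NormedAddCommGroup E] [NormedSpace ℝ E]

lemma continuous_fderiv_apply {η : E → ℝ} (hη : ContDiff ℝ ∞ η) (e : E) :
    Continuous fun x => fderiv ℝ η x e :=
  (hη.continuous_fderiv (by simp)).clm_apply continuous_const

lemma hasCompactSupport_fderiv_apply {η : E → ℝ} (hη : HasCompactSupport η) (e : E) :
    HasCompactSupport fun x => fderiv ℝ η x e :=
  (hη.fderiv ℝ).comp_left (g := fun L : E →L[ℝ] ℝ => L e) (by simp)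

lemma fderiv_apply_eq_zero_of_notMem {η : E → ℝ} {Ω : Set E} (hη : tsupport η ⊆ Ω) (e : E) {x : E}
    (hx : x ∉ Ω) : fderiv ℝ η x e = 0 := by
  have : x ∉ Function.support (fderiv ℝ η) := fun h => hx (hη (support_fderiv_subset ℝ h))
  rw [Function.notMem_support] at this
  simp [this]

variable [MeasureSpace E] [BorelSpace E]

lemma integral_fderiv_apply_eq_zero [FiniteDimensional ℝ E]
    [(volume : Measure E).IsAddHaarMeasure] {η : E → ℝ}
    (hη : ContDiff ℝ ∞ η) (hc : HasCompactSupport η) (e : E) : ∫ x, fderiv ℝ η x e = 0 := by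
  have h := integral_mul_fderiv_eq_neg_fderiv_mul_of_integrable (μ := (volume : Measure E))
    (f := fun _ : E => (1 : ℝ)) (g := η) (v := e)
    (by simp) (by
      simpa using (continuous_fderiv_apply hη e).integrable_of_hasCompactSupport
        (hasCompactSupport_fderiv_apply hc e))
    (by simpa using hη.continuous.integrable_of_hasCompactSupport hc)
    (by fun_prop) (fun x _ => hη.differentiable (by simp) x)
  simpa using h

/-- Adding the constant `1` and restricting to a subset does not change the weak derivative. -/
lemma HasWeakDeriv.add_one_restrict [FiniteDimensional ℝ E]
    [(volume : Measure E).IsAddHaarMeasure] {φ g : E → ℂ} {e : E}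
    (h : HasWeakDeriv univ e (fun x => φ x - 1) g) (hφ : MemLp (fun x => φ x - 1) 2 volume)
    (Ω : Set E) : HasWeakDeriv Ω e φ g := by
  intro η hη hc hs
  have h0 := h η hη hc (subset_univ _)
  rw [Measure.restrict_univ] at h0
  have hsupp : ∀ x, x ∉ Ω → η x = 0 := fun x hx => image_eq_zero_of_notMem_tsupport fun h => hx (hs h)
  rw [setIntegral_eq_integral_of_forall_compl_eq_zero (fun x hx => by
      rw [fderiv_apply_eq_zero_of_notMem hs e hx]; simp),
    setIntegral_eq_integral_of_forall_compl_eq_zero (fun x hx => by rw [hsupp x hx]; simp), ← h0]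
  have hi : Integrable fun x => (φ x - 1) * ((fderiv ℝ η x e : ℝ) : ℂ) := by
    have := integrableOn_mul_of_hasCompactSupport (Ω := univ) (f := fun x => φ x - 1)
      (by rwa [Measure.restrict_univ])
      (continuous_fderiv_apply hη e) (hasCompactSupport_fderiv_apply hc e)
    rwa [integrableOn_univ] at this
  have hi2 : Integrable fun x => ((fderiv ℝ η x e : ℝ) : ℂ) :=
    ((continuous_fderiv_apply hη e).integrable_of_hasCompactSupport
        (hasCompactSupport_fderiv_apply hc e)).ofReal
  have hz : ∫ x, ((fderiv ℝ η x e : ℝ) : ℂ) = 0 := by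
    rw [integral_complex_ofReal, integral_fderiv_apply_eq_zero hη hc]; simp
  calc ∫ x, φ x * ((fderiv ℝ η x e : ℝ) : ℂ)
      = ∫ x, ((φ x - 1) * ((fderiv ℝ η x e : ℝ) : ℂ) + ((fderiv ℝ η x e : ℝ) : ℂ)) := by
        congr 1; ext x; ring
    _ = _ := by rw [integral_add hi hi2, hz, add_zero]

end Weak

/-! ### Radial trial functions -/

/-- `p` is a radial derivative supported in `(0, R)` with finite planar energy. -/
structure IsRadialSlope (R : ℝ) (p : ℝ → ℂ) : Prop where
  meas : Measurable p
  supp : ∀ s, s ∉ Ioo 0 R → p s = 0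
  energy : ∫⁻ s in Ioi (0 : ℝ), ‖p s‖ₑ ^ 2 * ENNReal.ofReal s < ⊤

/-- The radial function with derivative `p` that equals `1` far away. -/
def radialTrial (p : ℝ → ℂ) (x : Plane) : ℂ := 1 - ∫ s in Ioi ‖x‖, p s

variable {R : ℝ} {p : ℝ → ℂ}

lemma setLIntegral_Ioi_eq_Ioo {f : ℝ → ℝ≥0∞} (hf : ∀ s, s ∉ Ioo 0 R → f s = 0) :
    ∫⁻ s in Ioi 0, f s = ∫⁻ s in Ioo 0 R, f s := by
  rw [← lintegral_indicator measurableSet_Ioi, ← lintegral_indicator measurableSet_Ioo]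
  congr 1; ext s
  by_cases hs : s ∈ Ioo 0 R
  · rw [indicator_of_mem hs, indicator_of_mem (show s ∈ Ioi 0 from hs.1)]
  · rw [indicator_of_notMem hs]
    by_cases h : s ∈ Ioi (0 : ℝ) <;> simp [h, hf s hs]

/-- Follows from `t ≤ t² + 1`, since the slope lives on a bounded interval. It supplies the
integrability for Fubini in `IsRadialSlope.hasWeakDeriv`. -/
lemma IsRadialSlope.lintegral_mul_lt_top (hp : IsRadialSlope R p) :
    ∫⁻ s in Ioi (0 : ℝ), ‖p s‖ₑ * ENNReal.ofReal s < ⊤ := by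
  rw [setLIntegral_Ioi_eq_Ioo (R := R) (fun s hs => by simp [hp.supp s hs])]
  have h1 : ∀ s ∈ Ioo (0 : ℝ) R, ‖p s‖ₑ * ENNReal.ofReal s ≤
      ‖p s‖ₑ ^ 2 * ENNReal.ofReal s + ENNReal.ofReal R := by
    intro s hs
    rcases le_total ‖p s‖ₑ 1 with h | h
    · calc ‖p s‖ₑ * ENNReal.ofReal s ≤ 1 * ENNReal.ofReal R := by
            gcongr; exact hs.2.le
        _ ≤ _ := by rw [one_mul]; exact le_add_self
    · refine le_trans ?_ le_self_add
      gcongr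
      rw [sq]; exact le_mul_of_one_le_left (by simp) h
  refine (setLIntegral_mono' measurableSet_Ioo h1).trans_lt ?_
  have hm := hp.meas
  rw [lintegral_add_left (by fun_prop)]
  refine ENNReal.add_lt_top.2 ⟨?_, ?_⟩
  · exact (lintegral_mono_set (fun s hs => hs.1)).trans_lt hp.energy
  · simp [ENNReal.mul_lt_top_iff]

/-- Cauchy–Schwarz with `|p| = (|p| √s) · s^(-1/2)`. The crude bound `1/s ≤ 1/r` replaces the sharp
`ln(R/r)`: its singularity at the origin is cancelled by the polar weight `r` in
`memLp_radialTrial`. -/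
lemma IsRadialSlope.sq_lintegral_Ioi_le (hp : IsRadialSlope R p) {r : ℝ} (hr : 0 < r) :
    (∫⁻ s in Ioi r, ‖p s‖ₑ) ^ 2 ≤ (∫⁻ s in Ioi (0 : ℝ), ‖p s‖ₑ ^ 2 * ENNReal.ofReal s) *
      (ENNReal.ofReal R * ENNReal.ofReal r⁻¹) := by
  have hm := hp.meas
  have h0 : ∫⁻ s in Ioi r, ‖p s‖ₑ = ∫⁻ s in Ioo r R, ‖p s‖ₑ := by
    rw [← lintegral_indicator measurableSet_Ioi, ← lintegral_indicator measurableSet_Ioo]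
    congr 1; ext s
    by_cases hs : s ∈ Ioi r
    · by_cases h : s < R
      · rw [indicator_of_mem hs, indicator_of_mem (show s ∈ Ioo r R from ⟨hs, h⟩)]
      · rw [indicator_of_mem hs, indicator_of_notMem (fun h' => h h'.2), hp.supp s (fun h' => h h'.2)]
        simp
    · rw [indicator_of_notMem hs, indicator_of_notMem fun h => hs h.1]
  have h1 : ∫⁻ s in Ioo r R, ‖p s‖ₑ = ∫⁻ s in Ioo r R, (‖p s‖ₑ * ENNReal.ofReal (√s)) *
      ENNReal.ofReal (√s)⁻¹ := by
    refine setLIntegral_congr_fun measurableSet_Ioo fun s hs => ?_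
    have : 0 < √s := Real.sqrt_pos.2 (hr.trans hs.1)
    rw [mul_assoc, ← ENNReal.ofReal_mul this.le, mul_inv_cancel₀ this.ne']
    simp
  rw [h0, h1]
  refine (lintegral_mul_sq_le _ (by fun_prop) (by fun_prop)).trans ?_
  gcongr ?_ * ?_
  · refine (setLIntegral_mono' (g := fun s => ‖p s‖ₑ ^ 2 * ENNReal.ofReal s) measurableSet_Ioo
      fun s hs => ?_).trans (lintegral_mono_set (fun s hs => hr.trans hs.1))
    rw [mul_pow, ← ENNReal.ofReal_pow (Real.sqrt_nonneg _), Real.sq_sqrt (hr.trans hs.1).le]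
  · refine (setLIntegral_mono' (g := fun s => ENNReal.ofReal r⁻¹) measurableSet_Ioo
      fun s hs => ?_).trans ?_
    · rw [← ENNReal.ofReal_pow (by positivity), inv_pow, Real.sq_sqrt (hr.trans hs.1).le]
      gcongr
      exact hs.1.le
    · rw [setLIntegral_const, Real.volume_Ioo, mul_comm]
      gcongr; linarith

lemma measurable_setIntegral_Ioi (hp : Measurable p) : Measurable fun r : ℝ => ∫ s in Ioi r, p s := by
  have : (fun r : ℝ => ∫ s in Ioi r, p s) =
      fun r => ∫ s, {z : ℝ × ℝ | z.1 < z.2}.indicator (fun z => p z.2) (r, s) := by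
    ext r
    rw [← integral_indicator measurableSet_Ioi]
    rfl
  rw [this]
  refine StronglyMeasurable.measurable (StronglyMeasurable.integral_prod_right' (f := fun z : ℝ × ℝ =>
    {z : ℝ × ℝ | z.1 < z.2}.indicator (fun z => p z.2) z) ?_)
  exact ((hp.comp measurable_snd).indicator
    (measurableSet_lt measurable_fst measurable_snd)).stronglyMeasurable

lemma measurable_radialTrial (hp : Measurable p) : Measurable (radialTrial p) :=
  measurable_const.sub ((measurable_setIntegral_Ioi hp).comp measurable_norm)

lemma IsRadialSlope.radialTrial_eq_one (hp : IsRadialSlope R p) {x : Plane} (hx : R ≤ ‖x‖) :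
    radialTrial p x = 1 := by
  rw [radialTrial, setIntegral_eq_zero_of_forall_eq_zero, sub_zero]
  exact fun s hs => hp.supp s fun h => (hx.trans_lt hs).not_gt h.2

lemma IsRadialSlope.memLp_radialTrial (hp : IsRadialSlope R p) :
    MemLp (fun x => radialTrial p x - 1) 2 volume := by
  rw [memLp_two_iff]
  refine ⟨((measurable_radialTrial hp.meas).sub_const 1).aestronglyMeasurable, ?_⟩
  have hm := measurable_setIntegral_Ioi hp.meas
  have h1 : ∀ x : Plane, ‖radialTrial p x - 1‖ₑ ^ 2 = ‖∫ s in Ioi ‖x‖, p s‖ₑ ^ 2 := by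
    intro x
    rw [radialTrial, sub_sub_cancel_left, enorm_neg]
  simp only [h1]
  rw [lintegral_plane_radial (f := fun r => ‖∫ s in Ioi r, p s‖ₑ ^ 2) (by fun_prop)]
  refine ENNReal.mul_lt_top ENNReal.ofReal_lt_top ?_
  rw [setLIntegral_Ioi_eq_Ioo (R := R) (fun r hr => by
    by_cases h0 : 0 < r
    · rw [setIntegral_eq_zero_of_forall_eq_zero]
      · simp
      · exact fun s hs => hp.supp s fun h => hr ⟨h0, lt_trans hs h.2⟩
    · simp [ENNReal.ofReal_of_nonpos (not_lt.1 h0)])]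
  set M := ∫⁻ s in Ioi (0 : ℝ), ‖p s‖ₑ ^ 2 * ENNReal.ofReal s with hM
  refine (setLIntegral_mono' (g := fun _ => M * ENNReal.ofReal R) measurableSet_Ioo
    fun r hr => ?_).trans_lt ?_
  · calc ‖∫ s in Ioi r, p s‖ₑ ^ 2 * ENNReal.ofReal r
        ≤ (∫⁻ s in Ioi r, ‖p s‖ₑ) ^ 2 * ENNReal.ofReal r := by
          gcongr; exact enorm_integral_le_lintegral_enorm _
      _ ≤ (M * (ENNReal.ofReal R * ENNReal.ofReal r⁻¹)) * ENNReal.ofReal r := by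
          gcongr; exact hp.sq_lintegral_Ioi_le hr.1
      _ = M * ENNReal.ofReal R := by
          rw [mul_assoc, mul_assoc, ← ENNReal.ofReal_mul (by have := hr.1; positivity),
            inv_mul_cancel₀ hr.1.ne']
          simp
  · rw [setLIntegral_const]
    exact ENNReal.mul_lt_top (ENNReal.mul_lt_top hp.energy (by simp)) (by simp)

end

/-! ### Weak gradient and energy of radial trial functions. -/

noncomputable section

variable {R : ℝ} {p : ℝ → ℂ}

lemma enorm_complex_ofReal (t : ℝ) : ‖(t : ℂ)‖ₑ = ‖t‖ₑ := by
  rw [← ofReal_norm, ← ofReal_norm, Complex.norm_real]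

lemma IsRadialSlope.integrableOn_mul (hp : IsRadialSlope R p) :
    IntegrableOn (fun s : ℝ => (s : ℂ) * p s) (Ioi 0) := by
  have hm := hp.meas
  refine ⟨by fun_prop, ?_⟩
  rw [hasFiniteIntegral_iff_enorm]
  refine lt_of_eq_of_lt (setLIntegral_congr_fun measurableSet_Ioi fun s (hs : 0 < s) => ?_)
    hp.lintegral_mul_lt_top
  rw [enorm_mul, mul_comm, enorm_complex_ofReal, Real.enorm_of_nonneg hs.le]

/-- The components of the gradient of `radialTrial p`. -/
def radialGradient (p : ℝ → ℂ) (k : Fin 2) (x : Plane) : ℂ := p ‖x‖ * ((x k / ‖x‖ : ℝ) : ℂ)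

lemma measurable_radialGradient (hp : Measurable p) (k : Fin 2) :
    Measurable (radialGradient p k) := by
  unfold radialGradient
  have : Measurable fun x : Plane => x k := by fun_prop
  fun_prop

/-- Equality holds off the origin; at the origin the convention `t / 0 = 0` makes the left side
vanish. -/
lemma sum_enorm_radialGradient_le (p : ℝ → ℂ) (x : Plane) :
    ∑ k, ‖radialGradient p k x‖ₑ ^ 2 ≤ ‖p ‖x‖‖ₑ ^ 2 := by
  simp only [radialGradient, enorm_mul, mul_pow, ← Finset.mul_sum, enorm_complex_ofReal]
  refine mul_le_of_le_one_right (by simp) ?_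
  simp only [← ofReal_norm, ← ENNReal.ofReal_pow (norm_nonneg _)]
  rw [← ENNReal.ofReal_sum_of_nonneg (fun _ _ => by positivity), ENNReal.ofReal_le_one]
  simp only [Real.norm_eq_abs, sq_abs, div_pow, ← Finset.sum_div]
  refine div_le_one_of_le₀ ?_ (by positivity)
  rw [EuclideanSpace.norm_sq_eq]
  simp

lemma IsRadialSlope.lintegral_plane (hp : IsRadialSlope R p) :
    ∫⁻ x : Plane, ‖p ‖x‖‖ₑ ^ 2 = ENNReal.ofReal (2 * Real.pi) *
      ∫⁻ s in Ioi (0 : ℝ), ‖p s‖ₑ ^ 2 * ENNReal.ofReal s := by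
  have hm := hp.meas
  exact lintegral_plane_radial (f := fun s => ‖p s‖ₑ ^ 2) (by fun_prop)

lemma IsRadialSlope.memLp_radialGradient (hp : IsRadialSlope R p) (k : Fin 2) :
    MemLp (radialGradient p k) 2 volume := by
  rw [memLp_two_iff]
  refine ⟨(measurable_radialGradient hp.meas k).aestronglyMeasurable, ?_⟩
  refine (lintegral_mono fun x => ?_).trans_lt
    (hp.lintegral_plane.trans_lt (ENNReal.mul_lt_top ENNReal.ofReal_lt_top hp.energy))
  exact (Finset.single_le_sum (f := fun k => ‖radialGradient p k x‖ₑ ^ 2) (by simp)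
    (Finset.mem_univ k)).trans (sum_enorm_radialGradient_le p x)

/-- No regularity of `p` is needed: `radialTrial p - 1` is the superposition `-∫ p(s) 1_{|x| < s}
ds` of indicators of discs. Fubini reduces the claim to the divergence theorem on each disc, and
polar coordinates reassemble the boundary fluxes into `p(|x|) x_k / |x|`. -/
lemma IsRadialSlope.hasWeakDeriv (hp : IsRadialSlope R p) (k : Fin 2) :
    HasWeakDeriv univ (planeDir k) (fun x => radialTrial p x - 1) (radialGradient p k) := by
  intro η hη hc _
  have hm := hp.meas
  simp only [Measure.restrict_univ]
  have hd := continuous_fderiv_apply hη (planeDir k)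
  obtain ⟨C, hC⟩ := (hd.norm).bounded_above_of_compact_support
    ((hasCompactSupport_fderiv_apply hc (planeDir k)).norm)
  obtain ⟨C', hC'⟩ := (hη.continuous).bounded_above_of_compact_support hc
  have hC0 : 0 ≤ C := (norm_nonneg _).trans (hC 0)
  -- the integrand on the product of the plane and the half-line of radii
  let S : Set (Plane × ℝ) := {z | ‖z.1‖ < z.2}
  have hS : MeasurableSet S := measurableSet_lt (by fun_prop) (by fun_prop)
  let F : Plane × ℝ → ℂ := S.indicator fun z => p z.2 * ((fderiv ℝ η z.1 (planeDir k) : ℝ) : ℂ)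
  have hFm : Measurable F := Measurable.indicator (by
    have := hd.measurable
    fun_prop) hS
  have hFs : ∀ s, ∀ x, F (x, s) = (Metric.ball (0 : Plane) s).indicator
      (fun x => p s * ((fderiv ℝ η x (planeDir k) : ℝ) : ℂ)) x := by
    intro s x
    by_cases h : ‖x‖ < s
    · rw [indicator_of_mem (mem_ball_zero_iff.2 h)]; simp [F, S, h]
    · rw [indicator_of_notMem (fun h' => h (mem_ball_zero_iff.1 h'))]; simp [F, S, h]
  have hFx : ∀ x, ∀ s, F (x, s) = (Ioi ‖x‖).indicator
      (fun s => p s * ((fderiv ℝ η x (planeDir k) : ℝ) : ℂ)) s := by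
    intro x s
    simp [F, S, indicator_apply]
  have hFi : Integrable F (volume.prod volume) := by
    refine ⟨hFm.aestronglyMeasurable, ?_⟩
    rw [hasFiniteIntegral_iff_enorm, lintegral_prod_symm _ (by fun_prop)]
    -- For `s < R` the disc has area `π s² ≤ π R s`, so the double integral is controlled by `∫
    -- |p(s)| s ds`.
    have hb : ∀ s, ∫⁻ x, ‖F (x, s)‖ₑ ≤ (Ioi (0 : ℝ)).indicator
        (fun s => (ENNReal.ofReal C * ENNReal.ofReal (Real.pi * R)) *
          (‖p s‖ₑ * ENNReal.ofReal s)) s := by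
      intro s
      by_cases hs : s ∈ Ioo 0 R
      · rw [indicator_of_mem (show s ∈ Ioi 0 from hs.1)]
        simp only [hFs, enorm_indicator_eq_indicator_enorm]
        rw [lintegral_indicator Metric.isOpen_ball.measurableSet]
        calc ∫⁻ x in Metric.ball (0 : Plane) s, ‖p s * ((fderiv ℝ η x (planeDir k) : ℝ) : ℂ)‖ₑ
            ≤ ∫⁻ x in Metric.ball (0 : Plane) s, ‖p s‖ₑ * ENNReal.ofReal C := by
              refine lintegral_mono fun x => ?_
              rw [enorm_mul, enorm_complex_ofReal, ← ofReal_norm (fderiv ℝ η x (planeDir k))]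
              gcongr
              simpa using hC x
          _ = ‖p s‖ₑ * ENNReal.ofReal C * (ENNReal.ofReal s ^ 2 * ENNReal.ofReal Real.pi) := by
              rw [setLIntegral_const, EuclideanSpace.volume_ball_fin_two]
          _ ≤ ‖p s‖ₑ * ENNReal.ofReal C * ((ENNReal.ofReal s * ENNReal.ofReal R)
                * ENNReal.ofReal Real.pi) := by
              rw [sq]; gcongr; exact hs.2.le
          _ = _ := by
              rw [ENNReal.ofReal_mul Real.pi_pos.le]; ring
      · have : ∀ x, F (x, s) = 0 := fun x => by simp [F, hp.supp s hs]
        simp [this]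
    refine (lintegral_mono hb).trans_lt ?_
    rw [lintegral_indicator measurableSet_Ioi, lintegral_const_mul _ (by fun_prop)]
    exact ENNReal.mul_lt_top (ENNReal.mul_lt_top ENNReal.ofReal_lt_top ENNReal.ofReal_lt_top)
      hp.lintegral_mul_lt_top
  have hL : ∫ x, (radialTrial p x - 1) * ((fderiv ℝ η x (planeDir k) : ℝ) : ℂ) =
      - ∫ s, ∫ x, F (x, s) := by
    rw [← integral_integral_swap (f := fun x s => F (x, s)) hFi, ← integral_neg]
    congr 1; ext x
    simp only [hFx]
    rw [integral_indicator measurableSet_Ioi, integral_mul_const, radialTrial]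
    ring
  rw [hL, neg_inj]
  -- the inner integral by the divergence theorem, the right side by polar coordinates
  rw [integral_plane_polar, Measure.volume_eq_prod, ← Measure.prod_restrict, integral_prod]
  · rw [← integral_indicator measurableSet_Ioi]
    congr 1; ext s
    by_cases hs : s ∈ Ioi (0 : ℝ)
    · rw [indicator_of_mem hs]
      simp only [hFs]
      rw [integral_indicator Metric.isOpen_ball.measurableSet, integral_const_mul,
        integral_complex_ofReal, integral_ball_fderiv hη k hs, ← integral_complex_ofReal,
        ← integral_const_mul]
      refine integral_congr_ae (Filter.Eventually.of_forall fun θ => ?_)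
      have hs' : (s : ℂ) ≠ 0 := by exact_mod_cast (ne_of_gt hs)
      simp only [radialGradient, norm_polarPoint (le_of_lt hs), polarPoint_apply s θ k]
      rw [Complex.real_smul]
      push_cast
      field_simp
    · rw [indicator_of_notMem hs]
      have : ∀ x, F (x, s) = 0 := fun x => by simp [F, hp.supp s (fun h => hs h.1)]
      simp [this]
  · have h1 : Integrable (fun z : ℝ × ℝ => ((z.1 : ℂ) * p z.1) * (1 : ℂ))
        ((volume.restrict (Ioi 0)).prod (volume.restrict (Ioo (-Real.pi) Real.pi))) :=
      Integrable.mul_prod hp.integrableOn_mul (integrable_const _)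
    have hcp := continuous_polarPoint
    refine (h1.bdd_mul (c := C') (f := fun z : ℝ × ℝ => ((polarPoint z.1 z.2 k / ‖polarPoint z.1 z.2‖ *
      η (polarPoint z.1 z.2) : ℝ) : ℂ)) ?_ (Filter.Eventually.of_forall fun z => ?_)).congr
      ?_
    · have h2 := hcp.measurable
      have h3 := hη.continuous.measurable
      have h4 : Measurable fun z : ℝ × ℝ => polarPoint z.1 z.2 k :=
        (by fun_prop : Measurable fun x : Plane => x k).comp h2
      apply Measurable.aestronglyMeasurable
      fun_prop
    · rw [Complex.norm_real, norm_mul]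
      refine (mul_le_of_le_one_left (norm_nonneg _) ?_).trans (hC' _)
      rw [norm_div, norm_norm]
      exact div_le_one_of_le₀ (PiLp.norm_apply_le _ _) (norm_nonneg _)
    · rw [Measure.prod_restrict]
      filter_upwards [ae_restrict_mem (measurableSet_Ioi.prod measurableSet_Ioo)] with z hz
      simp only [radialGradient, norm_polarPoint (le_of_lt hz.1), Complex.real_smul]
      push_cast; ring

lemma IsRadialSlope.isWeakGradient (hp : IsRadialSlope R p) :
    IsWeakGradient planeDir univ (fun x => radialTrial p x - 1) (radialGradient p) :=
  fun k => ⟨by simpa using hp.memLp_radialGradient k, hp.hasWeakDeriv k⟩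

lemma IsRadialSlope.isTrial (hp : IsRadialSlope R p) : IsTrial R (radialTrial p) :=
  ⟨⟨by simpa using hp.memLp_radialTrial, _, hp.isWeakGradient⟩,
    Filter.Eventually.of_forall fun _ hx => hp.radialTrial_eq_one hx⟩

lemma IsTrial.isWeakGradient_ball {φ : Plane → ℂ} (h : IsTrial R φ) {G : Fin 2 → Plane → ℂ}
    (hG : IsWeakGradient planeDir univ (fun x => φ x - 1) G) (Ω : Set Plane) :
    IsWeakGradient planeDir Ω φ G := fun k =>
  ⟨(hG k).1.mono_measure (Measure.restrict_mono (subset_univ _) le_rfl),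
    (hG k).2.add_one_restrict (by simpa using h.1.1) Ω⟩

/-- The planar scattering energy of a radial trial function is bounded by its radial energy. -/
lemma IsRadialSlope.scatteringEnergy_le (hp : IsRadialSlope R p) {μ : ℝ} {v : ℝ → ℝ≥0∞}
    (hv : Measurable v) :
    scatteringEnergy μ v R (radialTrial p) ≤ ENNReal.ofReal (2 * Real.pi) *
      ∫⁻ r in Ioo 0 R, (ENNReal.ofReal μ * ‖p r‖ₑ ^ 2 +
        2⁻¹ * v r * ‖1 - ∫ s in Ioi r, p s‖ₑ ^ 2) * ENNReal.ofReal r := by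
  have hm := hp.meas
  have hm' := measurable_setIntegral_Ioi hp.meas
  have h1 : dirichletEnergy planeDir (Metric.ball 0 R) (radialTrial p) ≤
      ∫⁻ x : Plane in Metric.ball 0 R, ‖p ‖x‖‖ₑ ^ 2 :=
    (iInf₂_le _ (hp.isTrial.isWeakGradient_ball hp.isWeakGradient _)).trans
      (lintegral_mono fun x => sum_enorm_radialGradient_le p x)
  calc scatteringEnergy μ v R (radialTrial p)
      ≤ ENNReal.ofReal μ * (∫⁻ x : Plane in Metric.ball 0 R, ‖p ‖x‖‖ₑ ^ 2) +
          ∫⁻ x in Metric.ball (0 : Plane) R, 2⁻¹ * v ‖x‖ * ‖radialTrial p x‖ₑ ^ 2 := by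
        unfold scatteringEnergy; gcongr
    _ = ∫⁻ x : Plane in Metric.ball 0 R, (ENNReal.ofReal μ * ‖p ‖x‖‖ₑ ^ 2 +
          2⁻¹ * v ‖x‖ * ‖1 - ∫ s in Ioi ‖x‖, p s‖ₑ ^ 2) := by
        rw [← lintegral_const_mul _ (by fun_prop), ← lintegral_add_left (by fun_prop)]
        rfl
    _ = ∫⁻ x : Plane, (Iio R).indicator (fun r => ENNReal.ofReal μ * ‖p r‖ₑ ^ 2 +
          2⁻¹ * v r * ‖1 - ∫ s in Ioi r, p s‖ₑ ^ 2) ‖x‖ := by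
        rw [← lintegral_indicator Metric.isOpen_ball.measurableSet]
        congr 1; ext x
        by_cases hx : ‖x‖ < R
        · rw [indicator_of_mem (mem_ball_zero_iff.2 hx), indicator_of_mem (mem_Iio.2 hx)]
        · rw [indicator_of_notMem (fun h => hx (mem_ball_zero_iff.1 h)),
            indicator_of_notMem (fun h => hx (mem_Iio.1 h))]
    _ = _ := by
        rw [lintegral_plane_radial (Measurable.indicator (by fun_prop) measurableSet_Iio)]
        congr 1
        rw [setLIntegral_Ioi_eq_Ioo (R := R)]
        · refine setLIntegral_congr_fun measurableSet_Ioo fun r hr => ?_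
          simp only [indicator_of_mem (mem_Iio.2 hr.2)]
        · intro r hr
          by_cases h : r < R
          · rw [ENNReal.ofReal_of_nonpos (not_lt.1 fun h0 => hr ⟨h0, h⟩), mul_zero]
          · rw [indicator_of_notMem (fun h' => h (mem_Iio.1 h')), zero_mul]

end

noncomputable section

/-! ### Radial test fields -/

/-- `q` is a smooth function supported in `(r₁², r₂²)`. -/
structure IsRadialBump (r₁ r₂ : ℝ) (q : ℝ → ℝ) : Prop where
  pos : 0 < r₁
  lt : r₁ < r₂
  smooth : ContDiff ℝ ∞ q
  supp : ∀ s, s ∉ Ioo (r₁ ^ 2) (r₂ ^ 2) → q s = 0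

/-- The components of the radial vector field `q(|x|²) x`. -/
def radialField (q : ℝ → ℝ) (k : Fin 2) (x : Plane) : ℝ := q (‖x‖ ^ 2) * x k

/-- The divergence of `q(|x|²) x` at distance `r` from the origin. -/
def radialDiv (q : ℝ → ℝ) (r : ℝ) : ℝ := 2 * q (r ^ 2) + 2 * r ^ 2 * deriv q (r ^ 2)

variable {r₁ r₂ : ℝ} {q : ℝ → ℝ}

lemma IsRadialBump.apply_eq_zero (hq : IsRadialBump r₁ r₂ q) {r : ℝ} (hr : 0 ≤ r)
    (h : r ∉ Ioo r₁ r₂) : q (r ^ 2) = 0 := by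
  refine hq.supp _ fun h' => h ⟨?_, ?_⟩
  · exact lt_of_pow_lt_pow_left₀ 2 hr h'.1
  · exact lt_of_pow_lt_pow_left₀ 2 (hq.pos.trans hq.lt).le h'.2

lemma contDiff_radialField (hq : ContDiff ℝ ∞ q) (k : Fin 2) : ContDiff ℝ ∞ (radialField q k) := by
  unfold radialField
  refine (hq.comp (contDiff_norm_sq ℝ)).mul ?_
  fun_prop

lemma IsRadialBump.tsupport_subset (hq : IsRadialBump r₁ r₂ q) (k : Fin 2) :
    tsupport (radialField q k) ⊆ Metric.closedBall 0 r₂ := by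
  refine closure_minimal (fun x hx => ?_) Metric.isClosed_closedBall
  rw [mem_closedBall_zero_iff]
  by_contra h
  exact hx (by simp [radialField, hq.apply_eq_zero (norm_nonneg x) fun h' => h h'.2.le])

lemma IsRadialBump.hasCompactSupport (hq : IsRadialBump r₁ r₂ q) (k : Fin 2) :
    HasCompactSupport (radialField q k) :=
  (isCompact_closedBall (0 : Plane) r₂).of_isClosed_subset (isClosed_tsupport _)
    (hq.tsupport_subset k)

lemma sum_fderiv_radialField (hq : ContDiff ℝ ∞ q) (x : Plane) :
    ∑ k, fderiv ℝ (radialField q k) x (planeDir k) = radialDiv q ‖x‖ := by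
  have h1 : ∀ k, fderiv ℝ (radialField q k) x (planeDir k) =
      q (‖x‖ ^ 2) + (deriv q (‖x‖ ^ 2) * (2 * x k)) * x k := by
    intro k
    have hd : HasDerivAt q (deriv q (‖x‖ ^ 2)) (‖x‖ ^ 2) :=
      (hq.differentiable (by simp) _).hasDerivAt
    have hn : HasFDerivAt (fun x : Plane => ‖x‖ ^ 2) (2 • innerSL ℝ x) x :=
      (hasStrictFDerivAt_norm_sq x).hasFDerivAt
    have hk : HasFDerivAt (fun x : Plane => x k) (EuclideanSpace.proj k : Plane →L[ℝ] ℝ) x :=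
      (EuclideanSpace.proj k : Plane →L[ℝ] ℝ).hasFDerivAt
    have := (hd.comp_hasFDerivAt x hn).mul hk
    have h2 : HasFDerivAt (radialField q k) _ x := this
    rw [h2.fderiv]
    simp [planeDir, EuclideanSpace.inner_single_right]
    ring
  simp only [h1, Finset.sum_add_distrib, radialDiv]
  have h2 : ‖x‖ ^ 2 = x 0 ^ 2 + x 1 ^ 2 := by
    rw [EuclideanSpace.norm_sq_eq]; simp
  simp only [Fin.sum_univ_two]
  linear_combination (-2 * deriv q (‖x‖ ^ 2)) * h2

lemma IsRadialBump.deriv_eq_zero (hq : IsRadialBump r₁ r₂ q) {r : ℝ} (hr : 0 ≤ r)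
    (h : r ∉ Icc r₁ r₂) : deriv q (r ^ 2) = 0 := by
  have h0 : r ^ 2 ∉ tsupport q := by
    intro h'
    have : r ^ 2 ∈ Icc (r₁ ^ 2) (r₂ ^ 2) := closure_minimal (fun s hs => by
      by_contra hn
      exact hs (hq.supp s fun h'' => hn ⟨h''.1.le, h''.2.le⟩)) isClosed_Icc h'
    refine h ⟨?_, ?_⟩
    · exact (pow_le_pow_iff_left₀ hq.pos.le hr two_ne_zero).1 this.1
    · exact (pow_le_pow_iff_left₀ hr (hq.pos.trans hq.lt).le two_ne_zero).1 this.2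
  exact Function.notMem_support.1 fun h' => h0 (support_deriv_subset h')

lemma IsRadialBump.radialDiv_eq_zero (hq : IsRadialBump r₁ r₂ q) {r : ℝ} (hr : 0 ≤ r)
    (h : r ∉ Icc r₁ r₂) : radialDiv q r = 0 := by
  rw [radialDiv, hq.deriv_eq_zero hr h,
    hq.apply_eq_zero hr fun h' => h ⟨h'.1.le, h'.2.le⟩]
  simp

lemma continuous_radialDiv (hq : ContDiff ℝ ∞ q) : Continuous (radialDiv q) := by
  have h1 := hq.continuous
  have h2 : Continuous (deriv q) := hq.continuous_deriv (by simp)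
  unfold radialDiv
  fun_prop

/-- Up to the factor `2π`, `r² q(r²)` is the flux of the field through the circle of radius `r`.
Radial integrals of the divergence thereby reduce to one-dimensional integration by parts. -/
lemma hasDerivAt_sq_mul (hq : ContDiff ℝ ∞ q) (r : ℝ) :
    HasDerivAt (fun r => r ^ 2 * q (r ^ 2)) (r * radialDiv q r) r := by
  have hd : HasDerivAt q (deriv q (r ^ 2)) (r ^ 2) :=
    (hq.differentiable (by simp) _).hasDerivAt
  have h2 : HasDerivAt (fun r : ℝ => r ^ 2) (2 * r) r := by simpa using hasDerivAt_pow 2 r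
  convert! h2.mul (HasDerivAt.comp (h := fun r : ℝ => r ^ 2) r hd h2) using 1
  simp [radialDiv]
  ring

/-- Integration by parts of a weak gradient against the radial field `q(|x|²) x`. -/
lemma IsRadialBump.sum_integral_mul (hq : IsRadialBump r₁ r₂ q) {Ω : Set Plane} {f : Plane → ℂ}
    (hf : MemLp f 2 (volume.restrict Ω)) {G : Fin 2 → Plane → ℂ}
    (hG : IsWeakGradient planeDir Ω f G) (hΩ : Metric.closedBall 0 r₂ ⊆ Ω) :
    ∑ k, ∫ x in Ω, G k x * ((radialField q k x : ℝ) : ℂ) =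
      - ∫ x in Ω, f x * ((radialDiv q ‖x‖ : ℝ) : ℂ) := by
  have h1 : ∀ k, ∫ x in Ω, G k x * ((radialField q k x : ℝ) : ℂ) =
      - ∫ x in Ω, f x * ((fderiv ℝ (radialField q k) x (planeDir k) : ℝ) : ℂ) := by
    intro k
    rw [(hG k).2 _ (contDiff_radialField hq.smooth k) (hq.hasCompactSupport k)
      ((hq.tsupport_subset k).trans hΩ), neg_neg]
  simp only [h1, Finset.sum_neg_distrib]
  rw [← integral_finsetSum _ fun k _ => integrableOn_mul_of_hasCompactSupport hf
    (continuous_fderiv_apply (contDiff_radialField hq.smooth k) _)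
    (hasCompactSupport_fderiv_apply (hq.hasCompactSupport k) _)]
  simp only [← Finset.mul_sum, ← Complex.ofReal_sum, sum_fderiv_radialField hq.smooth]

/-- The radial integral of the logarithmic profile against the divergence of the test field. -/
lemma IsRadialBump.integral_log_mul_radialDiv (hq : IsRadialBump r₁ r₂ q) {a R : ℝ} (ha : 0 < a) :
    ∫ x : Plane, Real.log (‖x‖ / a) / Real.log (R / a) * radialDiv q ‖x‖ =
      - (2 * Real.pi / Real.log (R / a) * ∫ r in Ioi 0, r * q (r ^ 2)) := by
  rw [integral_plane_radial fun r => Real.log (r / a) / Real.log (R / a) * radialDiv q r]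
  have hIoi : ∀ f : ℝ → ℝ, (∀ r, 0 ≤ r → r ∉ Icc r₁ r₂ → f r = 0) →
      ∫ r in Ioi 0, f r = ∫ r in r₁..r₂, f r := by
    intro f hf
    rw [intervalIntegral.integral_of_le hq.lt.le, ← integral_Icc_eq_integral_Ioc,
      ← integral_indicator measurableSet_Icc, ← integral_indicator measurableSet_Ioi]
    congr 1; ext r
    by_cases h : r ∈ Icc r₁ r₂
    · rw [indicator_of_mem h, indicator_of_mem (show r ∈ Ioi 0 from hq.pos.trans_le h.1)]
    · rw [indicator_of_notMem h]
      by_cases h0 : r ∈ Ioi (0 : ℝ)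
      · rw [indicator_of_mem h0, hf r (le_of_lt h0) h]
      · rw [indicator_of_notMem h0]
  rw [hIoi _ fun r hr h => by rw [hq.radialDiv_eq_zero hr h]; ring,
    hIoi _ fun r hr h => by rw [hq.apply_eq_zero hr fun h' => h ⟨h'.1.le, h'.2.le⟩]; ring]
  have hpos : ∀ r ∈ uIcc r₁ r₂, 0 < r := by
    intro r hr
    rw [uIcc_of_le hq.lt.le] at hr
    exact hq.pos.trans_le hr.1
  have hlog : ∀ r ∈ uIcc r₁ r₂, HasDerivAt (fun r => Real.log (r / a) / Real.log (R / a))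
      (1 / r / Real.log (R / a)) r := by
    intro r hr
    have hr0 := hpos r hr
    have h1 : HasDerivAt (fun r : ℝ => r / a) (1 / a) r := (hasDerivAt_id r).div_const a
    convert! (h1.log (by positivity)).div_const (Real.log (R / a)) using 1
    field_simp
  -- The boundary terms vanish because `q(r²) = 0` at both ends, and the factor `1/r` from the
  -- logarithm turns `r² q(r²)` into `r q(r²)`.
  have hparts := intervalIntegral.integral_mul_deriv_eq_deriv_mul (a := r₁) (b := r₂) hlog
    (fun r _ => hasDerivAt_sq_mul hq.smooth r)
    (ContinuousOn.intervalIntegrable (by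
      refine ContinuousOn.div_const (ContinuousOn.div continuousOn_const continuousOn_id ?_) _
      exact fun r hr => (hpos r hr).ne'))
    (Continuous.intervalIntegrable (by
      have := continuous_radialDiv hq.smooth
      fun_prop) _ _)
  rw [hq.apply_eq_zero hq.pos.le (fun h => lt_irrefl _ h.1),
    hq.apply_eq_zero (hq.pos.trans hq.lt).le (fun h => lt_irrefl _ h.2)] at hparts
  have e1 : ∀ r, r * (Real.log (r / a) / Real.log (R / a) * radialDiv q r) =
    Real.log (r / a) / Real.log (R / a) * (r * radialDiv q r) := fun r => by ring
  simp only [e1]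
  rw [hparts]
  have e2 : ∫ r in r₁..r₂, 1 / r / Real.log (R / a) * (r ^ 2 * q (r ^ 2)) =
      ∫ r in r₁..r₂, (Real.log (R / a))⁻¹ * (r * q (r ^ 2)) := by
    refine intervalIntegral.integral_congr fun r hr => ?_
    have := (hpos r hr).ne'
    simp only [div_eq_mul_inv]
    field_simp
  rw [e2, intervalIntegral.integral_const_mul]
  ring

/-- The normalisation says that a radial function with slope `r q(r²)` rises by exactly `1` across
the annulus, hence equals `0` inside when it equals `1` outside. Using the variable `r²` keeps the
field `q(|x|²) x` smooth. -/
lemma exists_isRadialBump {r₁ r₂ : ℝ} (h₁ : 0 < r₁) (h₂ : r₁ < r₂) :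
    ∃ q, IsRadialBump r₁ r₂ q ∧ ∫ r in Ioi 0, r * q (r ^ 2) = 1 := by
  have hsq : r₁ ^ 2 < r₂ ^ 2 := by gcongr
  let f : ContDiffBump ((r₁ ^ 2 + r₂ ^ 2) / 2) :=
    ⟨(r₂ ^ 2 - r₁ ^ 2) / 4, (r₂ ^ 2 - r₁ ^ 2) / 2, by linarith, by linarith⟩
  have hf0 : ∀ s, s ∉ Ioo (r₁ ^ 2) (r₂ ^ 2) → f s = 0 := by
    intro s hs
    apply f.zero_of_le_dist
    rw [Real.dist_eq]
    by_contra h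
    rw [not_le, abs_lt] at h
    have e : f.rOut = (r₂ ^ 2 - r₁ ^ 2) / 2 := rfl
    rw [e] at h
    exact hs ⟨by linarith [h.1], by linarith [h.2]⟩
  have hb : IsRadialBump r₁ r₂ f := ⟨h₁, h₂, f.contDiff, hf0⟩
  have hpos : 0 < ∫ r in Ioi 0, r * f (r ^ 2) := by
    have e : ∫ r in Ioi 0, r * f (r ^ 2) = ∫ r, max r 0 * f (r ^ 2) := by
      rw [← integral_indicator measurableSet_Ioi]
      congr 1; ext r
      by_cases hr : 0 < r
      · rw [indicator_of_mem (mem_Ioi.2 hr), max_eq_left hr.le]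
      · rw [indicator_of_notMem (by simpa using hr), max_eq_right (not_lt.1 hr), zero_mul]
    rw [e]
    have hfc := f.continuous
    refine Continuous.integral_pos_of_hasCompactSupport_nonneg_nonzero (x := √((r₁ ^ 2 + r₂ ^ 2) / 2))
      (by fun_prop) ?_ ?_ ?_
    · refine HasCompactSupport.intro (isCompact_Icc (a := r₁) (b := r₂)) fun r hr => ?_
      by_cases h0 : 0 ≤ r
      · rw [hb.apply_eq_zero h0 fun h' => hr ⟨h'.1.le, h'.2.le⟩, mul_zero]
      · rw [max_eq_right (not_le.1 h0).le, zero_mul]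
    · exact fun r => mul_nonneg (le_max_right _ _) f.nonneg
    · rw [Real.sq_sqrt (by positivity), f.one_of_mem_closedBall (by
        simp [f.rIn_pos.le])]
      have : 0 < √((r₁ ^ 2 + r₂ ^ 2) / 2) := Real.sqrt_pos.2 (by positivity)
      rw [max_eq_left this.le]
      simpa using this.ne'
  refine ⟨fun s => (∫ r in Ioi 0, r * f (r ^ 2))⁻¹ * f s,
    ⟨h₁, h₂, contDiff_const.mul f.contDiff, fun s hs => by rw [hf0 s hs, mul_zero]⟩, ?_⟩
  have e : ∀ r : ℝ, r * ((∫ r in Ioi 0, r * f (r ^ 2))⁻¹ * f (r ^ 2)) =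
    (∫ r in Ioi 0, r * f (r ^ 2))⁻¹ * (r * f (r ^ 2)) := fun r => by ring
  simp only [e]
  rw [integral_const_mul, inv_mul_cancel₀ hpos.ne']

end

noncomputable section

/-! ### The energy of the scattering minimizer -/

lemma IsWeakGradient.add_smul {E ι : Type*} [NormedAddCommGroup E] [NormedSpace ℝ E]
    [MeasureSpace E] [BorelSpace E] [IsLocallyFiniteMeasure (volume : Measure E)]
    {b : ι → E} {Ω : Set E} {f₁ f₂ : E → ℂ} {G₁ G₂ : ι → E → ℂ}
    (hf₁ : MemLp f₁ 2 (volume.restrict Ω)) (hf₂ : MemLp f₂ 2 (volume.restrict Ω))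
    (h₁ : IsWeakGradient b Ω f₁ G₁) (h₂ : IsWeakGradient b Ω f₂ G₂) (c₁ c₂ : ℂ) :
    IsWeakGradient b Ω (fun x => c₁ * f₁ x + c₂ * f₂ x) (fun k x => c₁ * G₁ k x + c₂ * G₂ k x) := by
  intro k
  refine ⟨((h₁ k).1.const_mul c₁).add ((h₂ k).1.const_mul c₂), fun η hη hc hs => ?_⟩
  have d := continuous_fderiv_apply hη (b k)
  have dc := hasCompactSupport_fderiv_apply hc (b k)
  simp only [add_mul, mul_assoc]
  rw [integral_add ((integrableOn_mul_of_hasCompactSupport hf₁ d dc).const_mul c₁)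
      ((integrableOn_mul_of_hasCompactSupport hf₂ d dc).const_mul c₂),
    integral_add ((integrableOn_mul_of_hasCompactSupport (h₁ k).1 hη.continuous hc).const_mul c₁)
      ((integrableOn_mul_of_hasCompactSupport (h₂ k).1 hη.continuous hc).const_mul c₂),
    integral_const_mul, integral_const_mul, integral_const_mul, integral_const_mul,
    (h₁ k).2 η hη hc hs, (h₂ k).2 η hη hc hs]
  ring

lemma IsTrial.memLp_restrict {R : ℝ} {φ : Plane → ℂ} (h : IsTrial R φ) :
    MemLp φ 2 (volume.restrict (Metric.ball 0 R)) := by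
  have h1 : MemLp (fun x => φ x - 1) 2 (volume.restrict (Metric.ball (0 : Plane) R)) :=
    h.1.1.mono_measure (Measure.restrict_mono (subset_univ _) le_rfl)
  have : IsFiniteMeasure (volume.restrict (Metric.ball (0 : Plane) R)) :=
    ⟨by rw [Measure.restrict_apply_univ]; exact measure_ball_lt_top⟩
  exact (h1.add (memLp_const (1 : ℂ))).ae_eq (Filter.Eventually.of_forall fun x => by simp)

lemma IsTrial.affine {R : ℝ} {φ χ : Plane → ℂ} (hφ : IsTrial R φ) (hχ : IsTrial R χ) (t : ℂ) :
    IsTrial R fun x => (1 - t) * φ x + t * χ x := by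
  obtain ⟨G₁, h₁⟩ := hφ.1.2
  obtain ⟨G₂, h₂⟩ := hχ.1.2
  have e : (fun x => (1 - t) * φ x + t * χ x - 1) =
      fun x => (1 - t) * (φ x - 1) + t * (χ x - 1) := by ext x; ring
  refine ⟨⟨?_, ?_⟩, ?_⟩
  · rw [e]
    exact (hφ.1.1.const_mul _).add (hχ.1.1.const_mul _)
  · rw [e]
    exact ⟨_, IsWeakGradient.add_smul hφ.1.1 hχ.1.1 h₁ h₂ _ _⟩
  · filter_upwards [hφ.2, hχ.2] with x h1 h2 hx
    rw [h1 hx, h2 hx]; ring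

/-- The slope of the radial function with gradient field `q(|x|²) x`. -/
def bumpSlope (q : ℝ → ℝ) (s : ℝ) : ℂ := ((max s 0 * q (s ^ 2) : ℝ) : ℂ)

variable {r₁ r₂ R : ℝ} {q : ℝ → ℝ}

/-- With this slope the comparison function has a smooth, compactly supported gradient, which can
serve as a test field against the weak gradient of the minimizer. -/
lemma radialGradient_bumpSlope (q : ℝ → ℝ) (k : Fin 2) (x : Plane) :
    radialGradient (bumpSlope q) k x = ((radialField q k x : ℝ) : ℂ) := by
  simp only [radialGradient, bumpSlope, radialField, max_eq_left (norm_nonneg x)]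
  rcases eq_or_ne ‖x‖ 0 with h | h
  · have : x = 0 := by simpa using h
    simp [this]
  · rw [← Complex.ofReal_mul]
    congr 1
    field_simp

lemma IsRadialBump.bumpSlope_eq_zero (hq : IsRadialBump r₁ r₂ q) {s : ℝ} (hs : s ∉ Ioo r₁ r₂) :
    bumpSlope q s = 0 := by
  rw [bumpSlope]
  by_cases h : 0 ≤ s
  · simp [hq.apply_eq_zero h hs]
  · simp [max_eq_right (not_le.1 h).le]

lemma IsRadialBump.isRadialSlope (hq : IsRadialBump r₁ r₂ q) (hR : r₂ ≤ R) :
    IsRadialSlope R (bumpSlope q) := by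
  have hc : Continuous (bumpSlope q) := by
    have := hq.smooth.continuous
    unfold bumpSlope; fun_prop
  have hsupp : ∀ s, s ∉ Ioo 0 R → bumpSlope q s = 0 := fun s hs =>
    hq.bumpSlope_eq_zero fun h => hs ⟨hq.pos.trans h.1, h.2.trans_le hR⟩
  obtain ⟨C, hC⟩ := hc.bounded_above_of_compact_support
    (HasCompactSupport.intro (isCompact_Icc (a := 0) (b := R)) fun s hs =>
      hsupp s fun h => hs ⟨h.1.le, h.2.le⟩)
  refine ⟨hc.measurable, hsupp, ?_⟩
  rw [setLIntegral_Ioi_eq_Ioo (R := R) fun s hs => by simp [hsupp s hs]]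
  refine (setLIntegral_mono' (g := fun _ => ENNReal.ofReal C ^ 2 * ENNReal.ofReal R)
    measurableSet_Ioo fun s hs => ?_).trans_lt ?_
  · rw [← ofReal_norm]
    gcongr
    · exact hC s
    · exact hs.2.le
  · rw [setLIntegral_const]
    exact ENNReal.mul_lt_top (ENNReal.mul_lt_top (ENNReal.pow_lt_top ENNReal.ofReal_lt_top)
      ENNReal.ofReal_lt_top) (by simp)

lemma IsRadialBump.radialTrial_eq_zero (hq : IsRadialBump r₁ r₂ q)
    (h1 : ∫ r in Ioi 0, r * q (r ^ 2) = 1) {x : Plane} (hx : ‖x‖ ≤ r₁) :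
    radialTrial (bumpSlope q) x = 0 := by
  have e : ∫ s in Ioi ‖x‖, bumpSlope q s = ∫ s in Ioi 0, ((s * q (s ^ 2) : ℝ) : ℂ) := by
    rw [← integral_indicator measurableSet_Ioi, ← integral_indicator measurableSet_Ioi]
    congr 1; ext s
    by_cases h0 : 0 < s
    · rw [indicator_of_mem (mem_Ioi.2 h0)]
      by_cases h : ‖x‖ < s
      · rw [indicator_of_mem (mem_Ioi.2 h), bumpSlope, max_eq_left h0.le]
      · rw [indicator_of_notMem (by simpa using h),
          hq.apply_eq_zero h0.le fun h' => h (hx.trans_lt h'.1)]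
        simp
    · rw [indicator_of_notMem (show s ∉ Ioi 0 from h0), indicator_of_notMem]
      exact fun h => h0 ((norm_nonneg x).trans_lt h)
  rw [radialTrial, e, integral_complex_ofReal, h1]
  simp

lemma lintegral_enorm_sq_eq {α : Type*} [MeasurableSpace α] {ν : Measure α} {f : α → ℂ}
    (hf : MemLp f 2 ν) : ∫⁻ x, ‖f x‖ₑ ^ 2 ∂ν = ENNReal.ofReal (∫ x, ‖f x‖ ^ 2 ∂ν) := by
  rw [ofReal_integral_eq_lintegral_ofReal hf.norm.integrable_sq
    (Filter.Eventually.of_forall fun x => by positivity)]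
  congr 1; ext x
  rw [ENNReal.ofReal_pow (norm_nonneg _), ofReal_norm]

lemma integral_norm_sq_affine {α : Type*} [MeasurableSpace α] {ν : Measure α} {f : α → ℂ}
    {g : α → ℝ} (hf : MemLp f 2 ν) (hg : MemLp (fun x => (g x : ℂ)) 2 ν) (t : ℝ) :
    ∫ x, ‖(1 - (t : ℂ)) * f x + t * (g x : ℂ)‖ ^ 2 ∂ν =
      (1 - t) ^ 2 * (∫ x, ‖f x‖ ^ 2 ∂ν) + 2 * t * (1 - t) * (∫ x, f x * (g x : ℂ) ∂ν).re +
        t ^ 2 * ∫ x, ‖(g x : ℂ)‖ ^ 2 ∂ν := by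
  have hi : Integrable (fun x => f x * (g x : ℂ)) ν := hf.integrable_mul hg
  have e : ∀ x, ‖(1 - (t : ℂ)) * f x + t * (g x : ℂ)‖ ^ 2 =
      (1 - t) ^ 2 * ‖f x‖ ^ 2 + 2 * t * (1 - t) * (f x * (g x : ℂ)).re + t ^ 2 * ‖(g x : ℂ)‖ ^ 2 := by
    intro x
    simp only [← Complex.normSq_eq_norm_sq, Complex.normSq_apply]
    simp
    ring
  simp only [e]
  have h1 := (hf.norm.integrable_sq).const_mul ((1 - t) ^ 2)
  have h2 : Integrable (fun x => 2 * t * (1 - t) * (f x * (g x : ℂ)).re) ν :=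
    hi.re.const_mul (2 * t * (1 - t))
  have h3 := (hg.norm.integrable_sq).const_mul (t ^ 2)
  have h12 : Integrable (fun x => (1 - t) ^ 2 * ‖f x‖ ^ 2 + 2 * t * (1 - t) * (f x * (g x : ℂ)).re) ν :=
    h1.add h2
  rw [integral_add h12 h3, integral_add h1 h2, integral_const_mul, integral_const_mul,
    integral_const_mul]
  congr 3
  exact integral_re hi

/-- A quadratic polynomial without constant term that is nowhere negative has no linear term:
otherwise, at `t = -(c - e) / (|K| + 1)` the linear term outweighs the quadratic one. -/
lemma eq_of_forall_quadratic_le {e c K : ℝ} (h : ∀ t : ℝ, 0 ≤ 2 * t * (c - e) + t ^ 2 * K) :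
    e = c := by
  by_contra hne
  have hd : c - e ≠ 0 := sub_ne_zero.2 (Ne.symm hne)
  set d := c - e with hd'
  have hK : 0 < |K| + 1 := by positivity
  have h1 := h (-d / (|K| + 1))
  have h2 : (-d / (|K| + 1)) ^ 2 * K ≤ d ^ 2 / (|K| + 1) := by
    rw [div_pow, div_mul_eq_mul_div, div_le_div_iff₀ (by positivity) hK]
    have : K ≤ |K| + 1 := (le_abs_self K).trans (by linarith)
    have h3 : 0 ≤ d ^ 2 * (|K| + 1) := by positivity
    nlinarith [mul_le_mul_of_nonneg_left this h3]
  have h3 : 2 * (-d / (|K| + 1)) * d = - 2 * (d ^ 2 / (|K| + 1)) := by field_simp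
  have h4 : 0 < d ^ 2 / (|K| + 1) := by positivity
  linarith

/-- The flux of any weak gradient of the scattering solution through the test field. -/
lemma sum_integral_mul_radialField {a R₀ : ℝ} (ha : 0 < a) {φ : Plane → ℂ}
    (hφ : IsTrial R φ) (hprof : ∀ᵐ x : Plane, R₀ < ‖x‖ → ‖x‖ < R →
      φ x = ((asympProfile a R ‖x‖ : ℝ) : ℂ)) (hq : IsRadialBump r₁ r₂ q) (h₁ : R₀ < r₁) (h₂ : r₂ < R)
    (hn : ∫ r in Ioi 0, r * q (r ^ 2) = 1) {G : Fin 2 → Plane → ℂ}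
    (hG : IsWeakGradient planeDir (Metric.ball 0 R) φ G) :
    ∑ k, ∫ x in Metric.ball 0 R, G k x * ((radialField q k x : ℝ) : ℂ) =
      ((2 * Real.pi / Real.log (R / a) : ℝ) : ℂ) := by
  rw [hq.sum_integral_mul hφ.memLp_restrict hG (Metric.closedBall_subset_ball h₂),
    ← integral_indicator Metric.isOpen_ball.measurableSet]
  -- The divergence vanishes off the annulus `[r₁, r₂]`, which lies in `(R₀, R)`; the values of `φ`
  -- on the range of `v` never enter.
  have e : ∫ x, (Metric.ball (0 : Plane) R).indicator
      (fun x => φ x * ((radialDiv q ‖x‖ : ℝ) : ℂ)) x =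
      ∫ x : Plane, ((Real.log (‖x‖ / a) / Real.log (R / a) * radialDiv q ‖x‖ : ℝ) : ℂ) := by
    refine integral_congr_ae ?_
    filter_upwards [hprof] with x hx
    by_cases h : ‖x‖ ∈ Icc r₁ r₂
    · have hR : ‖x‖ < R := h.2.trans_lt h₂
      rw [indicator_of_mem (mem_ball_zero_iff.2 hR), hx (h₁.trans_le h.1) hR, asympProfile,
        if_neg ha.ne']
      push_cast; ring
    · have h0 := hq.radialDiv_eq_zero (norm_nonneg x) h
      simp [h0]
  rw [e, integral_complex_ofReal, hq.integral_log_mul_radialDiv ha, hn]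
  push_cast; ring

/-- The minimal energy is `2πμ / ln(R/a)`. -/
theorem IsScatteringMinimizer.energy_eq {μ a R₀ : ℝ} (hμ : 0 < μ) (hR₀ : 0 ≤ R₀) (hR : R₀ < R)
    {v : ℝ → ℝ≥0∞} (hv : ∀ r, R₀ < r → v r = 0) (ha : 0 < a)
    {φ : Plane → ℂ} (hφ : IsScatteringMinimizer μ v R φ)
    (hprof : ∀ᵐ x : Plane, R₀ < ‖x‖ → ‖x‖ < R → φ x = ((asympProfile a R ‖x‖ : ℝ) : ℂ)) :
    scatteringEnergy μ v R φ ≠ ⊤ ∧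
      (scatteringEnergy μ v R φ).toReal = μ * (2 * Real.pi / Real.log (R / a)) := by
  -- With `R₀ < r₁ < r₂ < R`, the comparison function vanishes wherever `v` acts, while its gradient
  -- lives where `φ` is explicit.
  obtain ⟨r₁, h₁, hr₁⟩ := exists_between hR
  obtain ⟨r₂, h₂, hr₂⟩ := exists_between hr₁
  obtain ⟨q, hq, hn⟩ := exists_isRadialBump (hR₀.trans_lt h₁) h₂
  set B := Metric.ball (0 : Plane) R with hB
  set χ := radialTrial (bumpSlope q) with hχdef
  have hp := hq.isRadialSlope hr₂.le
  have hχ : IsTrial R χ := hp.isTrial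
  have hχ0 : ∀ x : Plane, v ‖x‖ * ‖χ x‖ₑ = 0 := by
    intro x
    by_cases h : R₀ < ‖x‖
    · simp [hv _ h]
    · rw [hχdef, hq.radialTrial_eq_zero hn ((not_lt.1 h).trans h₁.le)]; simp
  have e : radialGradient (bumpSlope q) = fun k x => ((radialField q k x : ℝ) : ℂ) := by
    ext k x; exact radialGradient_bumpSlope q k x
  have hη : ∀ k, MemLp (fun x => ((radialField q k x : ℝ) : ℂ)) 2 (volume.restrict B) := by
    intro k
    have := (hp.memLp_radialGradient k).restrict B
    rwa [e] at this
  have hηG : IsWeakGradient planeDir B χ fun k x => ((radialField q k x : ℝ) : ℂ) := by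
    have := hχ.isWeakGradient_ball hp.isWeakGradient B
    rwa [e] at this
  set V := ∫⁻ x in B, 2⁻¹ * v ‖x‖ * ‖φ x‖ₑ ^ 2 with hV
  set D := dirichletEnergy planeDir B φ with hD
  have hE : scatteringEnergy μ v R φ = ENNReal.ofReal μ * D + V := rfl
  -- The energy of `(1 - t) φ + t χ`. The cross term is the flux `2π / ln(R/a)`, whichever weak
  -- gradient `G` is used, and the potential energy only acquires the factor `(1 - t)²` because `v χ
  -- = 0`.
  have hvar : ∀ (t : ℝ) (G : Fin 2 → Plane → ℂ), IsWeakGradient planeDir B φ G →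
      scatteringEnergy μ v R φ ≤ ENNReal.ofReal μ *
        ENNReal.ofReal ((1 - t) ^ 2 * (∑ k, ∫ x in B, ‖G k x‖ ^ 2) +
          2 * t * (1 - t) * (2 * Real.pi / Real.log (R / a)) +
          t ^ 2 * ∑ k, ∫ x in B, ‖((radialField q k x : ℝ) : ℂ)‖ ^ 2) +
        ENNReal.ofReal ((1 - t) ^ 2) * V := by
    intro t G hG
    refine (hφ.2 _ (hφ.1.affine hχ t)).trans (add_le_add ?_ (le_of_eq ?_))
    · gcongr
      refine (iInf₂_le _ (IsWeakGradient.add_smul hφ.1.memLp_restrict hχ.memLp_restrict hG hηG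
        (1 - t) t)).trans (le_of_eq ?_)
      rw [lintegral_finsetSum' _ fun k _ => ?_]
      · have h1 : ∀ k, ∫⁻ x in B, ‖(1 - (t : ℂ)) * G k x + t * ((radialField q k x : ℝ) : ℂ)‖ₑ ^ 2 =
            ENNReal.ofReal (∫ x in B, ‖(1 - (t : ℂ)) * G k x + t * ((radialField q k x : ℝ) : ℂ)‖ ^ 2) :=
          fun k => lintegral_enorm_sq_eq (((hG k).1.const_mul _).add ((hη k).const_mul _))
        rw [← hB]
        simp only [h1]
        rw [← ENNReal.ofReal_sum_of_nonneg fun k _ => integral_nonneg fun x => by positivity]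
        congr 1
        simp only [fun k => integral_norm_sq_affine (hG k).1 (hη k) t, Finset.sum_add_distrib,
          ← Finset.mul_sum]
        congr 3
        have := congrArg Complex.re
          (sum_integral_mul_radialField ha hφ.1 hprof hq h₁ hr₂ hn hG)
        rw [Complex.re_sum, Complex.ofReal_re] at this
        exact this
      · have := (((hG k).1.const_mul (1 - (t : ℂ))).add ((hη k).const_mul (t : ℂ))).1
        exact this.enorm.pow_const 2
    · rw [hV, ← lintegral_const_mul' _ _ ENNReal.ofReal_ne_top]
      congr 1; ext x
      by_cases hvx : v ‖x‖ = 0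
      · simp [hvx]
      · have hz : χ x = 0 := by
          have := hχ0 x
          rw [mul_eq_zero] at this
          simpa using this.resolve_left hvx
        simp only [hz, mul_zero, add_zero, enorm_mul, mul_pow]
        have : ‖(1 - (t : ℂ))‖ₑ ^ 2 = ENNReal.ofReal ((1 - t) ^ 2) := by
          rw [show (1 - (t : ℂ)) = ((1 - t : ℝ) : ℂ) by push_cast; ring, enorm_complex_ofReal,
            ← ofReal_norm, ← ENNReal.ofReal_pow (norm_nonneg _), Real.norm_eq_abs, sq_abs]
        rw [this]; ring
  have hfin : scatteringEnergy μ v R φ ≠ ⊤ := by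
    refine ((hφ.2 χ hχ).trans_lt ?_).ne
    have h1 : dirichletEnergy planeDir B χ < ⊤ := by
      refine (iInf₂_le _ hηG).trans_lt ?_
      rw [lintegral_finsetSum' _ fun k _ => (hη k).1.enorm.pow_const 2]
      refine ENNReal.sum_lt_top.2 fun k _ => (memLp_two_iff.1 (hη k)).2
    have h2 : ∫⁻ x in B, 2⁻¹ * v ‖x‖ * ‖χ x‖ₑ ^ 2 = 0 := by
      have : ∀ x : Plane, 2⁻¹ * v ‖x‖ * ‖χ x‖ₑ ^ 2 = 0 := fun x => by
        rw [sq, mul_assoc, ← mul_assoc (v _), hχ0 x]; simp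
      simp [this]
    unfold scatteringEnergy
    rw [← hB, h2, add_zero]
    exact ENNReal.mul_lt_top ENNReal.ofReal_lt_top h1
  refine ⟨hfin, ?_⟩
  have hVfin : V ≠ ⊤ := fun h => hfin (by rw [hE, h, add_top])
  have hDfin : D ≠ ⊤ := fun h => hfin (by
    rw [hE, h, ENNReal.mul_top (by simpa using hμ), top_add])
  have hEr : (scatteringEnergy μ v R φ).toReal = μ * D.toReal + V.toReal := by
    rw [hE, ENNReal.toReal_add (ENNReal.mul_ne_top ENNReal.ofReal_ne_top hDfin) hVfin,
      ENNReal.toReal_mul, ENNReal.toReal_ofReal hμ.le]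
  set c := 2 * Real.pi / Real.log (R / a) with hc
  set C := ∑ k, ∫ x in B, ‖((radialField q k x : ℝ) : ℂ)‖ ^ 2 with hC
  -- The Dirichlet energy is an infimum, so a weak gradient within `δ` of it is chosen. Uniqueness
  -- of weak gradients is not needed, since the cross term does not depend on the choice.
  have hreal : ∀ t : ℝ, ∀ δ : ℝ, 0 < δ → μ * D.toReal + V.toReal ≤
      μ * ((1 - t) ^ 2 * (D.toReal + δ) + 2 * t * (1 - t) * c + t ^ 2 * C) +
        (1 - t) ^ 2 * V.toReal := by
    intro t δ hδ
    have hlt : D < D + ENNReal.ofReal δ :=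
      ENNReal.lt_add_right hDfin (by simpa using hδ)
    rw [hD] at hlt
    nth_rewrite 1 [dirichletEnergy] at hlt
    simp only [iInf_lt_iff] at hlt
    obtain ⟨G, hG, hGlt⟩ := hlt
    rw [← hD] at hGlt
    have hA : ∑ k, ∫ x in B, ‖G k x‖ ^ 2 ≤ D.toReal + δ := by
      rw [lintegral_finsetSum' _ fun k _ => (hG k).1.1.enorm.pow_const 2] at hGlt
      simp only [fun k => lintegral_enorm_sq_eq (hG k).1] at hGlt
      rw [← ENNReal.ofReal_sum_of_nonneg fun k _ => integral_nonneg fun x => by positivity] at hGlt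
      have h := ENNReal.toReal_mono (by simp [hDfin]) hGlt.le
      rwa [ENNReal.toReal_ofReal (Finset.sum_nonneg fun k _ => integral_nonneg fun x => by positivity),
        ENNReal.toReal_add hDfin ENNReal.ofReal_ne_top, ENNReal.toReal_ofReal hδ.le] at h
    have h := hvar t G hG
    set A := ∑ k, ∫ x in B, ‖G k x‖ ^ 2 with hAdef
    have hn0 : 0 ≤ (1 - t) ^ 2 * A + 2 * t * (1 - t) * c + t ^ 2 * C := by
      have hh := Finset.sum_nonneg fun k (_ : k ∈ Finset.univ) => integral_nonneg
        (μ := volume.restrict B)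
        (f := fun x => ‖(1 - (t : ℂ)) * G k x + t * ((radialField q k x : ℝ) : ℂ)‖ ^ 2)
        fun x => by positivity
      simp only [fun k => integral_norm_sq_affine (hG k).1 (hη k) t, Finset.sum_add_distrib,
          ← Finset.mul_sum] at hh
      have := congrArg Complex.re
          (sum_integral_mul_radialField ha hφ.1 hprof hq h₁ hr₂ hn hG)
      rw [Complex.re_sum, Complex.ofReal_re] at this
      rw [this] at hh
      exact hh
    have h' := ENNReal.toReal_mono (by
      simp [ENNReal.mul_eq_top, hVfin]) h
    rw [hEr, ENNReal.toReal_add (by simp [ENNReal.mul_eq_top]) (by simp [ENNReal.mul_eq_top, hVfin]),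
      ENNReal.toReal_mul, ENNReal.toReal_mul, ENNReal.toReal_ofReal hμ.le,
      ENNReal.toReal_ofReal hn0, ENNReal.toReal_ofReal (by positivity)] at h'
    refine h'.trans ?_
    gcongr
  rw [hEr]
  -- With `E` the minimal energy, the trial energy minus `E` is `2t(μc - E) + t² K` for this `K`;
  -- minimality at `t = 0` forces `E = μc`.
  refine eq_of_forall_quadratic_le (K := μ * D.toReal + V.toReal - 2 * (μ * c) + μ * C) fun t => ?_
  have hlim : ∀ δ : ℝ, 0 < δ → μ * D.toReal + V.toReal ≤
      μ * ((1 - t) ^ 2 * D.toReal + 2 * t * (1 - t) * c + t ^ 2 * C) +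
        (1 - t) ^ 2 * V.toReal + δ := by
    intro δ hδ
    have hk : 0 < μ * ((1 - t) ^ 2 + 1) := by positivity
    have := hreal t (δ / (μ * ((1 - t) ^ 2 + 1))) (by positivity)
    have h2 : μ * ((1 - t) ^ 2 * (δ / (μ * ((1 - t) ^ 2 + 1)))) ≤ δ := by
      rw [← mul_assoc, mul_div_assoc', div_le_iff₀ hk]
      nlinarith
    linarith
  have := le_of_forall_pos_le_add hlim
  linarith

end

noncomputable section

/-! ### The scattering length does not exceed the range of the potential -/

/-- A function that vanishes inside and near the circle `|x| = R` and equals `1` outside is not in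
`H¹`. -/
lemma IsTrial.not_ae_eq_zero {R R₀ : ℝ} (hR₀ : 0 ≤ R₀) (hR : R₀ < R) {φ : Plane → ℂ}
    (hφ : IsTrial R φ) : ¬ ∀ᵐ x : Plane, R₀ < ‖x‖ → ‖x‖ < R → φ x = 0 := by
  intro h0
  obtain ⟨r₁, h₁, hr₁⟩ := exists_between hR
  have hr₁0 : 0 < r₁ := hR₀.trans_lt h₁
  have hR0 : 0 < R := hr₁0.trans hr₁
  obtain ⟨G, hG⟩ := hφ.1.2
  -- In the squared radius, `(r₁², r₂²)` becomes the symmetric interval `(R² - ρ, R² + ρ)`.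
  set ρ := R ^ 2 - r₁ ^ 2 with hρ
  have hρ0 : 0 < ρ := by
    have : r₁ ^ 2 < R ^ 2 := by gcongr
    linarith
  set r₂ := √(R ^ 2 + ρ) with hr₂
  have hr₂sq : r₂ ^ 2 = R ^ 2 + ρ := Real.sq_sqrt (by positivity)
  have hRr₂ : R < r₂ := Real.lt_sqrt_of_sq_lt (by linarith)
  -- Bumps equal to `1` at `R²` whose supports shrink to that point.
  let f : ℕ → ContDiffBump (R ^ 2) := fun n =>
    ⟨ρ / (n + 2), ρ / (n + 1), by positivity, by gcongr; linarith⟩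
  have hfR : ∀ n, f n (R ^ 2) = 1 := fun n =>
    (f n).one_of_mem_closedBall (by simp [(f n).rIn_pos.le])
  have hout : ∀ n, (f n).rOut = ρ / (n + 1) := fun n => rfl
  have hf0 : ∀ (n : ℕ) (s : ℝ), ρ / (n + 1) ≤ |s - R ^ 2| → f n s = 0 := by
    intro n s hs
    apply (f n).zero_of_le_dist
    rwa [Real.dist_eq, hout]
  have hq : ∀ n, IsRadialBump r₁ r₂ (f n) := fun n =>
    ⟨hr₁0, hr₁.trans hRr₂, (f n).contDiff, fun s hs => hf0 n s (by
      by_contra h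
      rw [not_le] at h
      have h2 : ρ / ((n : ℝ) + 1) ≤ ρ := div_le_self hρ0.le (by linarith [n.cast_nonneg (α := ℝ)])
      have h3 := abs_lt.1 (h.trans_le h2)
      exact hs ⟨by linarith [h3.1], by rw [hr₂sq]; linarith [h3.2]⟩)⟩
  -- On the support of the divergence, `φ - 1` is `-1` inside the circle and `0` outside. The
  -- pairing is therefore the flux through the circle, `2π R² f_n(R²)`, the same for every `n`.
  have hval : ∀ n, ∑ k, ∫ x, G k x * ((radialField (f n) k x : ℝ) : ℂ) =
      ((2 * Real.pi * R ^ 2 : ℝ) : ℂ) := by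
    intro n
    have h1 := (hq n).sum_integral_mul hφ.1.1 hG (subset_univ _)
    simp only [Measure.restrict_univ] at h1
    rw [h1, ← integral_neg]
    have e : ∫ x : Plane, -((φ x - 1) * ((radialDiv (f n) ‖x‖ : ℝ) : ℂ)) =
        ∫ x : Plane, (((Iio R).indicator (radialDiv (f n)) ‖x‖ : ℝ) : ℂ) := by
      refine integral_congr_ae ?_
      filter_upwards [h0, hφ.2] with x hx hx'
      by_cases hxR : ‖x‖ < R
      · rw [indicator_of_mem (mem_Iio.2 hxR)]
        by_cases hx1 : r₁ ≤ ‖x‖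
        · rw [hx (h₁.trans_le hx1) hxR]; ring
        · rw [(hq n).radialDiv_eq_zero (norm_nonneg x) fun h => hx1 h.1]; simp
      · rw [indicator_of_notMem (by simpa using hxR), hx' (not_lt.1 hxR)]; simp
    rw [e, integral_complex_ofReal, integral_plane_radial]
    congr 1
    rw [mul_assoc, mul_assoc]
    congr 2
    have e2 : ∫ r in Ioi 0, r * (Iio R).indicator (radialDiv (f n)) r =
        ∫ r in (0 : ℝ)..R, r * radialDiv (f n) r := by
      rw [intervalIntegral.integral_of_le hR0.le, integral_Ioc_eq_integral_Ioo,
        ← integral_indicator measurableSet_Ioi, ← integral_indicator measurableSet_Ioo]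
      congr 1; ext r
      by_cases h : 0 < r <;> by_cases h' : r < R <;> simp [indicator_apply, h, h']
    rw [e2, intervalIntegral.integral_eq_sub_of_hasDerivAt
      (fun r _ => hasDerivAt_sq_mul (f n).contDiff r)
      (Continuous.intervalIntegrable (by
        have := continuous_radialDiv (f n).contDiff
        fun_prop) _ _), hfR]
    simp
  -- The test fields are bounded and tend to zero off the circle, a null set, so the same pairings
  -- tend to zero by dominated convergence: a contradiction.
  have hlim : ∀ k, Filter.Tendsto (fun n => ∫ x, G k x * ((radialField (f n) k x : ℝ) : ℂ))
      Filter.atTop (nhds 0) := by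
    intro k
    have hGk : MemLp (G k) 2 volume := by simpa using (hG k).1
    rw [← integral_zero (α := Plane) (G := ℂ) (μ := volume)]
    refine tendsto_integral_of_dominated_convergence
      ((Metric.closedBall (0 : Plane) r₂).indicator fun x => ‖G k x‖ * r₂) ?_ ?_ ?_ ?_
    · intro n
      exact hGk.1.mul (by
        have := (contDiff_radialField (f n).contDiff k).continuous
        exact (Complex.continuous_ofReal.comp this).aestronglyMeasurable)
    · rw [integrable_indicator_iff Metric.isClosed_closedBall.measurableSet]
      have : IsFiniteMeasure (volume.restrict (Metric.closedBall (0 : Plane) r₂)) :=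
        ⟨by rw [Measure.restrict_apply_univ]; exact measure_closedBall_lt_top⟩
      exact ((hGk.restrict _).integrable (by norm_num)).norm.mul_const r₂
    · intro n
      refine Filter.Eventually.of_forall fun x => ?_
      by_cases hx : x ∈ Metric.closedBall (0 : Plane) r₂
      · rw [indicator_of_mem hx, norm_mul, Complex.norm_real, radialField, norm_mul]
        gcongr
        rw [← one_mul r₂]
        gcongr
        · rw [Real.norm_of_nonneg (f n).nonneg]; exact (f n).le_one
        · exact (PiLp.norm_apply_le x k).trans (mem_closedBall_zero_iff.1 hx)
      · rw [indicator_of_notMem hx, radialField, (hq n).apply_eq_zero (norm_nonneg x) fun h =>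
          hx (mem_closedBall_zero_iff.2 h.2.le)]
        simp
    · have hs : ∀ᵐ x : Plane, x ∉ Metric.sphere (0 : Plane) R :=
        measure_eq_zero_iff_ae_notMem.1 (Measure.addHaar_sphere _ _ _)
      filter_upwards [hs] with x hx
      have hne : 0 < |‖x‖ ^ 2 - R ^ 2| := by
        rw [abs_pos, sub_ne_zero]
        intro h
        exact hx (mem_sphere_zero_iff_norm.2
          ((pow_left_inj₀ (norm_nonneg x) hR0.le two_ne_zero).1 h))
      refine tendsto_const_nhds.congr' ?_
      have ht : Filter.Tendsto (fun n : ℕ => ρ / ((n : ℝ) + 1)) Filter.atTop (nhds 0) := by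
        have := (tendsto_one_div_add_atTop_nhds_zero_nat (𝕜 := ℝ)).const_mul ρ
        simpa [div_eq_mul_inv] using this
      filter_upwards [ht.eventually (gt_mem_nhds hne)] with n hn
      simp [radialField, hf0 n _ hn.le]
  have hlim2 := tendsto_finsetSum Finset.univ fun k _ => hlim k
  simp only [hval, Finset.sum_const_zero] at hlim2
  have := tendsto_nhds_unique hlim2 tendsto_const_nhds
  have h3 : (2 * Real.pi * R ^ 2 : ℝ) = 0 := by exact_mod_cast this.symm
  have : 0 < 2 * Real.pi * R ^ 2 := by have := Real.pi_pos; positivity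
  linarith

lemma setIntegral_Ioo_inv {b R : ℝ} (hb : 0 < b) (hbR : b ≤ R) (κ : ℂ) :
    ∫ s in Ioo b R, κ * ((s⁻¹ : ℝ) : ℂ) = κ * ((Real.log (R / b) : ℝ) : ℂ) := by
  rw [integral_const_mul, integral_complex_ofReal, ← integral_Ioc_eq_integral_Ioo,
    ← intervalIntegral.integral_of_le hbR, integral_inv_of_pos hb (hb.trans_le hbR)]

lemma setLIntegral_Ioo_inv {b R : ℝ} (hb : 0 < b) (hbR : b ≤ R) :
    ∫⁻ s in Ioo b R, ENNReal.ofReal s⁻¹ = ENNReal.ofReal (Real.log (R / b)) := by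
  rw [← integral_inv_of_pos hb (hb.trans_le hbR), intervalIntegral.integral_of_le hbR,
    integral_Ioc_eq_integral_Ioo, ofReal_integral_eq_lintegral_ofReal]
  · have : ContinuousOn (fun s : ℝ => s⁻¹) (Icc b R) :=
      continuousOn_id.inv₀ fun s hs => (hb.trans_le hs.1).ne'
    exact (this.integrableOn_compact isCompact_Icc).mono_set Ioo_subset_Icc_self
  · filter_upwards [ae_restrict_mem measurableSet_Ioo] with s hs
    exact inv_nonneg.2 (hb.trans hs.1).le

lemma setLIntegral_Ioo_enorm_inv_sq {b R : ℝ} (hb : 0 < b) (hbR : b ≤ R) (κ : ℂ) :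
    ∫⁻ s in Ioo b R, ‖κ * ((s⁻¹ : ℝ) : ℂ)‖ₑ ^ 2 * ENNReal.ofReal s =
      ‖κ‖ₑ ^ 2 * ENNReal.ofReal (Real.log (R / b)) := by
  rw [← setLIntegral_Ioo_inv hb hbR, ← lintegral_const_mul _ (by fun_prop)]
  refine setLIntegral_congr_fun measurableSet_Ioo fun s hs => ?_
  have hs0 : 0 < s := hb.trans hs.1
  rw [enorm_mul, mul_pow, mul_assoc, enorm_complex_ofReal, Real.enorm_of_nonneg (by positivity),
    ← ENNReal.ofReal_pow (by positivity), ← ENNReal.ofReal_mul (by positivity)]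
  congr 2
  field_simp

/-- A slope `p` on `(0, b)` continued by `κ / s` on `(b, R)`. -/
def extendSlope (b R : ℝ) (κ : ℂ) (p : ℝ → ℂ) (s : ℝ) : ℂ :=
  p s + (Ioo b R).indicator (fun s => κ * ((s⁻¹ : ℝ) : ℂ)) s

lemma IsRadialSlope.zero (R : ℝ) : IsRadialSlope R fun _ => 0 :=
  ⟨measurable_const, fun _ _ => rfl, by simp⟩

section Extend

variable {b R : ℝ} {κ : ℂ} {p : ℝ → ℂ}

lemma extendSlope_of_le {s : ℝ} (hs : s ≤ b) :
    extendSlope b R κ p s = p s := by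
  rw [extendSlope, indicator_of_notMem (fun h => hs.not_gt h.1), add_zero]

lemma IsRadialSlope.extendSlope_of_mem (hp : IsRadialSlope b p) {s : ℝ} (hs : s ∈ Ioo b R) :
    extendSlope b R κ p s = κ * ((s⁻¹ : ℝ) : ℂ) := by
  rw [extendSlope, indicator_of_mem hs, hp.supp s fun h => h.2.not_gt hs.1, zero_add]

lemma IsRadialSlope.integrableOn_Ioi (hp : IsRadialSlope b p) {r : ℝ} (hr : 0 < r) :
    IntegrableOn p (Ioi r) := by
  refine ⟨hp.meas.aestronglyMeasurable, ?_⟩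
  rw [hasFiniteIntegral_iff_enorm]
  refine ((ENNReal.pow_lt_top_iff (n := 2)).1 ?_).resolve_right two_ne_zero
  exact (hp.sq_lintegral_Ioi_le hr).trans_lt (ENNReal.mul_lt_top hp.energy
    (ENNReal.mul_lt_top ENNReal.ofReal_lt_top ENNReal.ofReal_lt_top))

lemma IsRadialSlope.lintegral_extendSlope (hb : 0 < b) (hbR : b ≤ R) (hp : IsRadialSlope b p)
    (F : ℝ → ℂ → ℝ≥0∞) :
    ∫⁻ s in Ioo 0 R, F s (extendSlope b R κ p s) =
      (∫⁻ s in Ioo 0 b, F s (p s)) + ∫⁻ s in Ioo b R, F s (κ * ((s⁻¹ : ℝ) : ℂ)) := by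
  have h1 : ∫⁻ s in Ioo 0 R, F s (extendSlope b R κ p s) =
      (∫⁻ s in Ioo 0 b, F s (extendSlope b R κ p s)) +
        ∫⁻ s in Ioo b R, F s (extendSlope b R κ p s) := by
    rw [setLIntegral_congr (Ioo_ae_eq_Ioc (a := 0) (b := R)),
      setLIntegral_congr (Ioo_ae_eq_Ioc (a := 0) (b := b)),
      setLIntegral_congr (Ioo_ae_eq_Ioc (a := b) (b := R)),
      ← lintegral_union measurableSet_Ioc (Ioc_disjoint_Ioc_of_le le_rfl),
      Ioc_union_Ioc_eq_Ioc hb.le hbR]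
  rw [h1]
  congr 1
  · exact setLIntegral_congr_fun measurableSet_Ioo fun s hs => by
      simp only [extendSlope_of_le hs.2.le]
  · exact setLIntegral_congr_fun measurableSet_Ioo fun s hs => by
      simp only [hp.extendSlope_of_mem hs]

lemma IsRadialSlope.extend (hb : 0 < b) (hbR : b ≤ R) (hp : IsRadialSlope b p) :
    IsRadialSlope R (extendSlope b R κ p) := by
  have hm : Measurable (extendSlope b R κ p) :=
    hp.meas.add ((by fun_prop : Measurable fun s : ℝ => κ * ((s⁻¹ : ℝ) : ℂ)).indicator
      measurableSet_Ioo)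
  have hsupp : ∀ s, s ∉ Ioo 0 R → extendSlope b R κ p s = 0 := by
    intro s hs
    rw [extendSlope, hp.supp s (fun h => hs ⟨h.1, h.2.trans_le hbR⟩),
      indicator_of_notMem (fun h => hs ⟨hb.trans h.1, h.2⟩), add_zero]
  refine ⟨hm, hsupp, ?_⟩
  rw [setLIntegral_Ioi_eq_Ioo (R := R) fun s hs => by simp [hsupp s hs],
    hp.lintegral_extendSlope hb hbR fun s z => ‖z‖ₑ ^ 2 * ENNReal.ofReal s,
    setLIntegral_Ioo_enorm_inv_sq hb hbR]
  refine ENNReal.add_lt_top.2 ⟨?_, ENNReal.mul_lt_top (by simp) ENNReal.ofReal_lt_top⟩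
  exact (lintegral_mono_set fun s hs => hs.1).trans_lt hp.energy

lemma IsRadialSlope.integral_extendSlope (hb : 0 < b) (hbR : b ≤ R) (hp : IsRadialSlope b p) {r : ℝ}
    (hr : 0 < r) (hrb : r ≤ b) :
    ∫ s in Ioi r, extendSlope b R κ p s =
      (∫ s in Ioi r, p s) + κ * ((Real.log (R / b) : ℝ) : ℂ) := by
  have h_int : IntegrableOn (fun s : ℝ => κ * ((s⁻¹ : ℝ) : ℂ)) (Ioo b R) := by
    have : ContinuousOn (fun s : ℝ => κ * ((s⁻¹ : ℝ) : ℂ)) (Icc b R) := by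
      have : ContinuousOn (fun s : ℝ => s⁻¹) (Icc b R) :=
        continuousOn_id.inv₀ fun s hs => (hb.trans_le hs.1).ne'
      exact continuousOn_const.mul (Complex.continuous_ofReal.comp_continuousOn this)
    exact (this.integrableOn_compact isCompact_Icc).mono_set Ioo_subset_Icc_self
  simp only [extendSlope]
  rw [integral_add (hp.integrableOn_Ioi hr)
    ((integrable_indicator_iff measurableSet_Ioo).2 h_int).integrableOn,
    setIntegral_indicator measurableSet_Ioo, inter_eq_right.2 (show Ioo b R ⊆ Ioi r from fun s hs => hrb.trans_lt hs.1),
    setIntegral_Ioo_inv hb hbR]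

end Extend

/-- A positive scattering length does not exceed the range of the potential. -/
theorem IsScatteringMinimizer.le_range {μ a R R₀ : ℝ} (hμ : 0 < μ) (hR₀ : 0 ≤ R₀) (hR : R₀ < R)
    {v : ℝ → ℝ≥0∞} (hv_meas : Measurable v) (hv : ∀ r, R₀ < r → v r = 0) (ha : 0 < a)
    {φ : Plane → ℂ} (hφ : IsScatteringMinimizer μ v R φ)
    (hprof : ∀ᵐ x : Plane, R₀ < ‖x‖ → ‖x‖ < R → φ x = ((asympProfile a R ‖x‖ : ℝ) : ℂ)) :
    a ≤ R₀ := by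
  have hR0 : 0 < R := hR₀.trans_lt hR
  obtain ⟨hfin, hE⟩ := hφ.energy_eq hμ hR₀ hR hv ha hprof
  -- For `a = R` the denominator is `ln 1 = 0`, and division by zero makes the profile vanish: `φ`
  -- would jump from `0` to `1` across the circle.
  have haR : a ≠ R := by
    rintro rfl
    refine hφ.1.not_ae_eq_zero hR₀ hR ?_
    filter_upwards [hprof] with x hx h1 h2
    rw [hx h1 h2, asympProfile, if_neg ha.ne', div_self ha.ne']
    simp
  have hlog0 : Real.log (R / a) ≠ 0 := by
    refine Real.log_ne_zero_of_pos_of_ne_one (by positivity) ?_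
    rw [Ne, div_eq_one_iff_eq ha.ne']
    exact haR.symm
  -- A negative logarithm would make the minimal energy negative.
  have hlog : 0 < Real.log (R / a) := by
    refine lt_of_le_of_ne ?_ hlog0.symm
    by_contra h
    rw [not_le] at h
    have h1 : μ * (2 * Real.pi / Real.log (R / a)) < 0 :=
      mul_neg_of_pos_of_neg hμ (div_neg_of_pos_of_neg (by positivity) h)
    rw [← hE] at h1
    exact absurd ENNReal.toReal_nonneg (not_le.2 h1)
  have haR' : a < R := by
    rw [Real.log_pos_iff (by positivity), one_lt_div ha] at hlog
    exact hlog
  by_contra hcon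
  rw [not_le] at hcon
  -- The trial function equal to `ln(r/b) / ln(R/b)` for `r > b` and to `0` for `r ≤ b` has no
  -- potential energy, because `b > R₀`. Its energy `2πμ / ln(R/b)` lies below the minimum `2πμ /
  -- ln(R/a)`, because `b < a`.
  obtain ⟨b, hb, hba⟩ := exists_between hcon
  have hb0 : 0 < b := hR₀.trans_lt hb
  have hbR : b < R := hba.trans haR'
  have hlb : 0 < Real.log (R / b) := Real.log_pos ((one_lt_div hb0).2 hbR)
  set κ : ℂ := ((Real.log (R / b) : ℝ) : ℂ)⁻¹ with hκ
  have hz := IsRadialSlope.zero b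
  have hp : IsRadialSlope R (extendSlope b R κ fun _ => 0) := hz.extend hb0 hbR.le
  have h1 := (hφ.2 _ hp.isTrial).trans (hp.scatteringEnergy_le hv_meas)
  have h2 : ∫⁻ r in Ioo 0 R, (ENNReal.ofReal μ * ‖extendSlope b R κ (fun _ => 0) r‖ₑ ^ 2 +
        2⁻¹ * v r * ‖1 - ∫ s in Ioi r, extendSlope b R κ (fun _ => 0) s‖ₑ ^ 2) * ENNReal.ofReal r =
      ENNReal.ofReal μ * (‖κ‖ₑ ^ 2 * ENNReal.ofReal (Real.log (R / b))) := by
    have e : ∀ r ∈ Ioo 0 R, (ENNReal.ofReal μ * ‖extendSlope b R κ (fun _ => 0) r‖ₑ ^ 2 +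
        2⁻¹ * v r * ‖1 - ∫ s in Ioi r, extendSlope b R κ (fun _ => 0) s‖ₑ ^ 2) * ENNReal.ofReal r =
        ENNReal.ofReal μ * ‖extendSlope b R κ (fun _ => 0) r‖ₑ ^ 2 * ENNReal.ofReal r := by
      intro r hr
      congr 1
      by_cases hrb : r ≤ b
      · rw [hz.integral_extendSlope hb0 hbR.le hr.1 hrb, hκ,
          inv_mul_cancel₀ (by exact_mod_cast hlb.ne')]
        simp
      · rw [hv r (hb.trans (not_le.1 hrb))]; simp
    rw [setLIntegral_congr_fun measurableSet_Ioo e,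
      hz.lintegral_extendSlope hb0 hbR.le fun s z => ENNReal.ofReal μ * ‖z‖ₑ ^ 2 * ENNReal.ofReal s,
      ← setLIntegral_Ioo_enorm_inv_sq hb0 hbR.le κ, ← lintegral_const_mul _ (by fun_prop)]
    simp [mul_assoc]
  have hκn : ‖κ‖ₑ ^ 2 = ENNReal.ofReal ((Real.log (R / b))⁻¹ ^ 2) := by
    rw [hκ, ← Complex.ofReal_inv, enorm_complex_ofReal, Real.enorm_of_nonneg (by positivity),
      ENNReal.ofReal_pow (by positivity)]
  rw [h2, hκn, ← ENNReal.ofReal_mul (by positivity), ← ENNReal.ofReal_mul hμ.le,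
    ← ENNReal.ofReal_mul (by positivity)] at h1
  have h3 := ENNReal.toReal_mono ENNReal.ofReal_ne_top h1
  rw [hE, ENNReal.toReal_ofReal (by positivity)] at h3
  have h4 : 2 * Real.pi * (μ * ((Real.log (R / b))⁻¹ ^ 2 * Real.log (R / b))) =
      μ * (2 * Real.pi / Real.log (R / b)) := by field_simp
  rw [h4] at h3
  have h5 : Real.log (R / a) < Real.log (R / b) := by
    apply Real.log_lt_log (by positivity)
    gcongr
  have h6 : 2 * Real.pi / Real.log (R / b) < 2 * Real.pi / Real.log (R / a) := by gcongr
  nlinarith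

end

noncomputable section

/-! ### The radial lower bound -/

/-- The energy on `(0, R)` of the radial function with slope `p` and value `γ` at `R`. -/
def radialEnergy (μ : ℝ) (v : ℝ → ℝ≥0∞) (R : ℝ) (γ : ℂ) (p : ℝ → ℂ) : ℝ≥0∞ :=
  ∫⁻ r in Ioo 0 R, (ENNReal.ofReal μ * ‖p r‖ₑ ^ 2 +
    2⁻¹ * v r * ‖γ - ∫ s in Ioi r, p s‖ₑ ^ 2) * ENNReal.ofReal r

lemma radialEnergy_const_mul (μ : ℝ) (v : ℝ → ℝ≥0∞) (R : ℝ) (γ c : ℂ) (p : ℝ → ℂ) :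
    radialEnergy μ v R (c * γ) (fun s => c * p s) = ‖c‖ₑ ^ 2 * radialEnergy μ v R γ p := by
  unfold radialEnergy
  rw [← lintegral_const_mul' _ _ (by simp)]
  congr 1; ext r
  rw [integral_const_mul, ← mul_sub, enorm_mul, enorm_mul]
  ring

lemma IsRadialSlope.const_mul {R : ℝ} {p : ℝ → ℂ} (hp : IsRadialSlope R p) (c : ℂ) :
    IsRadialSlope R fun s => c * p s := by
  have hm := hp.meas
  refine ⟨by fun_prop, fun s hs => by rw [hp.supp s hs, mul_zero], ?_⟩
  simp only [enorm_mul, mul_pow, mul_assoc]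
  rw [lintegral_const_mul _ (by fun_prop)]
  exact ENNReal.mul_lt_top (by simp) hp.energy

/-- Dividing by `γ ≠ 0` turns the radial function into an admissible trial function. Its planar
energy is at most `2π` times the radial one and at least `2πμ / ln(R/a)`. -/
lemma IsScatteringMinimizer.le_radialEnergy {μ a R R₀ : ℝ} (hμ : 0 < μ) (hR₀ : 0 ≤ R₀) (hR : R₀ < R)
    {v : ℝ → ℝ≥0∞} (hv_meas : Measurable v) (hv : ∀ r, R₀ < r → v r = 0) (ha : 0 < a)
    {φ : Plane → ℂ} (hφ : IsScatteringMinimizer μ v R φ)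
    (hprof : ∀ᵐ x : Plane, R₀ < ‖x‖ → ‖x‖ < R → φ x = ((asympProfile a R ‖x‖ : ℝ) : ℂ))
    {p : ℝ → ℂ} (hp : IsRadialSlope R p) (γ : ℂ) :
    ENNReal.ofReal μ * ‖γ‖ₑ ^ 2 ≤ ENNReal.ofReal (Real.log (R / a)) * radialEnergy μ v R γ p := by
  rcases eq_or_ne γ 0 with rfl | hγ
  · simp
  have haR : a < R := (hφ.le_range hμ hR₀ hR hv_meas hv ha hprof).trans_lt hR
  have hlog : 0 < Real.log (R / a) := Real.log_pos ((one_lt_div ha).2 haR)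
  obtain ⟨hfin, hE⟩ := hφ.energy_eq hμ hR₀ hR hv ha hprof
  have hp' := hp.const_mul γ⁻¹
  have h1 : scatteringEnergy μ v R φ ≤ ENNReal.ofReal (2 * Real.pi) *
      radialEnergy μ v R 1 (fun s => γ⁻¹ * p s) :=
    (hφ.2 _ hp'.isTrial).trans (hp'.scatteringEnergy_le hv_meas)
  rw [← ENNReal.ofReal_toReal hfin, hE] at h1
  have h2 : ENNReal.ofReal (μ * (2 * Real.pi / Real.log (R / a))) * ENNReal.ofReal (Real.log (R / a)) =
      ENNReal.ofReal (2 * Real.pi) * ENNReal.ofReal μ := by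
    rw [← ENNReal.ofReal_mul (by positivity), ← ENNReal.ofReal_mul (by positivity)]
    congr 1
    field_simp
  have h3 : ENNReal.ofReal (2 * Real.pi) * ENNReal.ofReal μ ≤ ENNReal.ofReal (2 * Real.pi) *
      (ENNReal.ofReal (Real.log (R / a)) * radialEnergy μ v R 1 (fun s => γ⁻¹ * p s)) := by
    calc _ = ENNReal.ofReal (μ * (2 * Real.pi / Real.log (R / a))) *
          ENNReal.ofReal (Real.log (R / a)) := h2.symm
      _ ≤ (ENNReal.ofReal (2 * Real.pi) * radialEnergy μ v R 1 (fun s => γ⁻¹ * p s)) *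
          ENNReal.ofReal (Real.log (R / a)) := by gcongr
      _ = _ := by ring
  have h4 : ENNReal.ofReal μ ≤
      ENNReal.ofReal (Real.log (R / a)) * radialEnergy μ v R 1 (fun s => γ⁻¹ * p s) :=
    (ENNReal.mul_le_mul_iff_right (by simp [Real.pi_pos]) ENNReal.ofReal_ne_top).1 h3
  have h5 := radialEnergy_const_mul μ v R 1 γ fun s => γ⁻¹ * p s
  simp only [mul_one, mul_inv_cancel_left₀ hγ] at h5
  rw [h5]
  calc _ ≤ (ENNReal.ofReal (Real.log (R / a)) * radialEnergy μ v R 1 (fun s => γ⁻¹ * p s)) *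
        ‖γ‖ₑ ^ 2 := by gcongr
    _ = _ := by ring

/-- The slope cut off at `R`. -/
lemma IsRadialSlope.cutoff {R R' : ℝ} {p : ℝ → ℂ} (hp : IsRadialSlope R' p) :
    IsRadialSlope R ((Ioo 0 R).indicator p) := by
  refine ⟨hp.meas.indicator measurableSet_Ioo, fun s hs => indicator_of_notMem hs _, ?_⟩
  refine (lintegral_mono fun s => ?_).trans_lt hp.energy
  gcongr
  exact enorm_indicator_le_enorm_self _ _

/-- The lower bound for the radial energy at one radius `R > R₀` implies it at every radius. -/
lemma le_radialEnergy_of_le_radialEnergy {μ a R R' R₀ : ℝ} (hμ : 0 < μ) (hR₀ : 0 ≤ R₀)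
    (hR : R₀ < R) (hR' : R₀ < R') (ha : 0 < a) (haR : a ≤ R₀)
    {v : ℝ → ℝ≥0∞} (hv : ∀ r, R₀ < r → v r = 0)
    (h : ∀ p γ, IsRadialSlope R p → ENNReal.ofReal μ * ‖γ‖ₑ ^ 2 ≤
      ENNReal.ofReal (Real.log (R / a)) * radialEnergy μ v R γ p)
    {p : ℝ → ℂ} (hp : IsRadialSlope R' p) (γ : ℂ) :
    ENNReal.ofReal μ * ‖γ‖ₑ ^ 2 ≤ ENNReal.ofReal (Real.log (R' / a)) * radialEnergy μ v R' γ p := by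
  have hR'0 : 0 < R' := hR₀.trans_lt hR'
  have hR0 : 0 < R := hR₀.trans_lt hR
  have hl' : 0 < Real.log (R' / a) := Real.log_pos ((one_lt_div ha).2 (haR.trans_lt hR'))
  have hl : 0 < Real.log (R / a) := Real.log_pos ((one_lt_div ha).2 (haR.trans_lt hR))
  rcases eq_or_ne (radialEnergy μ v R' γ p) ⊤ with hE | hE
  · rw [hE, ENNReal.mul_top (by simpa using hl')]; exact le_top
  have hpm := hp.meas
  have hpm' := measurable_setIntegral_Ioi hp.meas
  have hnorm : ∀ z : ℂ, ENNReal.ofReal μ * ‖z‖ₑ ^ 2 = ENNReal.ofReal (μ * ‖z‖ ^ 2) := fun z => by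
    rw [ENNReal.ofReal_mul hμ.le, ENNReal.ofReal_pow (norm_nonneg _), ofReal_norm]
  obtain ⟨e', he'0, he'⟩ : ∃ e' : ℝ, 0 ≤ e' ∧ radialEnergy μ v R' γ p = ENNReal.ofReal e' :=
    ⟨_, ENNReal.toReal_nonneg, (ENNReal.ofReal_toReal hE).symm⟩
  rcases le_total R' R with hle | hle
  · set l := Real.log (R' / a) with hldef
    set m := Real.log (R / R') with hm
    have hlm : Real.log (R / a) = l + m := by
      rw [hldef, hm, ← Real.log_mul (by positivity) (by positivity)]
      congr 1; field_simp
    have hm0 : 0 ≤ m := Real.log_nonneg ((one_le_div hR'0).2 hle)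
    -- This slope continues the function by the logarithm that vanishes at `a` and equals `γ` at
    -- `R'`. With this choice the bound at `R` reduces exactly to the bound at `R'`.
    set κ : ℂ := γ / (l : ℂ) with hκ
    have hlc : (l : ℂ) ≠ 0 := by exact_mod_cast hl'.ne'
    have h1 := h (extendSlope R' R κ p) (γ + κ * m) (hp.extend hR'0 hle)
    have h2 : radialEnergy μ v R (γ + κ * m) (extendSlope R' R κ p) =
        radialEnergy μ v R' γ p + ENNReal.ofReal μ * ‖κ‖ₑ ^ 2 * ENNReal.ofReal m := by
      have e : ∀ r ∈ Ioo 0 R, (ENNReal.ofReal μ * ‖extendSlope R' R κ p r‖ₑ ^ 2 +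
          2⁻¹ * v r * ‖γ + κ * m - ∫ s in Ioi r, extendSlope R' R κ p s‖ₑ ^ 2) * ENNReal.ofReal r =
          (ENNReal.ofReal μ * ‖extendSlope R' R κ p r‖ₑ ^ 2 +
          2⁻¹ * v r * ‖γ - ∫ s in Ioi r, p s‖ₑ ^ 2) * ENNReal.ofReal r := by
        intro r hr
        by_cases hrb : r ≤ R'
        · rw [hp.integral_extendSlope hR'0 hle hr.1 hrb, add_sub_add_right_eq_sub]
        · rw [hv r (hR'.trans (not_le.1 hrb))]; simp
      unfold radialEnergy
      rw [setLIntegral_congr_fun measurableSet_Ioo e,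
        hp.lintegral_extendSlope hR'0 hle fun r z => (ENNReal.ofReal μ * ‖z‖ₑ ^ 2 +
          2⁻¹ * v r * ‖γ - ∫ s in Ioi r, p s‖ₑ ^ 2) * ENNReal.ofReal r]
      congr 1
      rw [mul_assoc, ← setLIntegral_Ioo_enorm_inv_sq hR'0 hle κ, ← lintegral_const_mul _ (by fun_prop)]
      refine setLIntegral_congr_fun measurableSet_Ioo fun r hr => ?_
      simp [hv r (hR'.trans hr.1), mul_assoc]
    rw [h2, he', hlm, hnorm, hnorm, ← ENNReal.ofReal_mul (by positivity),
      ← ENNReal.ofReal_add he'0 (by positivity), ← ENNReal.ofReal_mul (by positivity),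
      ENNReal.ofReal_le_ofReal_iff (by positivity)] at h1
    rw [he', hnorm, ← ENNReal.ofReal_mul hl'.le]
    apply ENNReal.ofReal_le_ofReal
    have h3 : γ + κ * m = (((l + m) / l : ℝ) : ℂ) * γ := by
      rw [hκ]; push_cast; field_simp
    have hk : ‖κ‖ = ‖γ‖ / l := by
      rw [hκ, norm_div, Complex.norm_real, Real.norm_of_nonneg hl'.le]
    rw [h3, norm_mul, Complex.norm_real, Real.norm_of_nonneg (by positivity), hk] at h1
    have h4 : (l + m) * (μ * ‖γ‖ ^ 2 * (l + m)) ≤ (l + m) * (l ^ 2 * e' + μ * ‖γ‖ ^ 2 * m) := by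
      have := mul_le_mul_of_nonneg_left h1 (sq_nonneg l)
      have e1 : l ^ 2 * (μ * ((l + m) / l * ‖γ‖) ^ 2) = (l + m) * (μ * ‖γ‖ ^ 2 * (l + m)) := by
        field_simp
      have e2 : l ^ 2 * ((l + m) * (e' + μ * (‖γ‖ / l) ^ 2 * m)) =
          (l + m) * (l ^ 2 * e' + μ * ‖γ‖ ^ 2 * m) := by field_simp
      rwa [e1, e2] at this
    have h5 := le_of_mul_le_mul_left h4 (by positivity)
    have h6 : l * (μ * ‖γ‖ ^ 2) ≤ l * (l * e') := by nlinarith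
    exact le_of_mul_le_mul_left h6 hl'
  · set l := Real.log (R / a) with hldef
    set m := Real.log (R' / R) with hm
    have hlm : Real.log (R' / a) = l + m := by
      rw [hldef, hm, ← Real.log_mul (by positivity) (by positivity)]
      congr 1; field_simp
    have hm0 : 0 ≤ m := Real.log_nonneg ((one_le_div hR0).2 hle)
    -- The value at `R` is `γ - δ`. The known bound controls `|γ - δ|²` by the inner energy, and
    -- Cauchy–Schwarz controls the increment `|δ|²` by the outer energy times `ln(R'/R)`.
    set δ := ∫ s in Ioi R, p s with hδ
    have hsplit : ∀ r, 0 < r → r < R →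
        ∫ s in Ioi r, p s = (∫ s in Ioi r, (Ioo 0 R).indicator p s) + δ := by
      intro r hr hrR
      have hi := hp.integrableOn_Ioi hr
      rw [setIntegral_indicator measurableSet_Ioo]
      have e1 : Ioi r ∩ Ioo 0 R = Ioo r R := by
        ext s; simp only [mem_inter_iff, mem_Ioi, mem_Ioo]
        constructor
        · rintro ⟨h1, h2, h3⟩; exact ⟨h1, h3⟩
        · rintro ⟨h1, h2⟩; exact ⟨h1, hr.trans h1, h2⟩
      rw [e1, ← integral_Ioc_eq_integral_Ioo, hδ,
        ← setIntegral_union (Ioc_disjoint_Ioi le_rfl) measurableSet_Ioi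
          (hi.mono_set Ioc_subset_Ioi_self) (hi.mono_set (Ioi_subset_Ioi hrR.le)),
        Ioc_union_Ioi_eq_Ioi hrR.le]
    have h1 := h _ (γ - δ) (hp.cutoff (R := R))
    have hEsplit : radialEnergy μ v R (γ - δ) ((Ioo 0 R).indicator p) +
        ENNReal.ofReal μ * (∫⁻ s in Ioo R R', ‖p s‖ₑ ^ 2 * ENNReal.ofReal s) ≤
        radialEnergy μ v R' γ p := by
      unfold radialEnergy
      have hsub : Ioo 0 R ∪ Ioo R R' ⊆ Ioo 0 R' := by
        rintro s (hs | hs)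
        · exact ⟨hs.1, hs.2.trans_le hle⟩
        · exact ⟨hR0.trans hs.1, hs.2⟩
      refine le_trans ?_ (lintegral_mono_set hsub)
      rw [lintegral_union measurableSet_Ioo (by
        rw [Set.disjoint_left]; exact fun s hs hs' => hs.2.not_gt hs'.1)]
      gcongr ?_ + ?_
      · refine le_of_eq (setLIntegral_congr_fun measurableSet_Ioo fun r hr => ?_)
        simp only [hsplit r hr.1 hr.2, indicator_of_mem hr]
        rw [sub_sub, add_comm δ]
      · rw [← lintegral_const_mul _ (by fun_prop)]
        refine lintegral_mono fun s => ?_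
        simp only [add_mul, mul_assoc]
        exact le_self_add
    have hCS : ‖δ‖ₑ ^ 2 ≤ (∫⁻ s in Ioo R R', ‖p s‖ₑ ^ 2 * ENNReal.ofReal s) * ENNReal.ofReal m := by
      have e0 : δ = ∫ s in Ioo R R', p s := by
        rw [hδ, ← integral_indicator measurableSet_Ioi, ← integral_indicator measurableSet_Ioo]
        congr 1; ext s
        by_cases hs : R < s <;> by_cases hs' : s < R'
        · simp [hs, hs']
        · simp [hs, hs', hp.supp s fun h => hs' h.2]
        · simp [hs]
        · simp [hs]
      have e1 : ∫⁻ s in Ioo R R', ‖p s‖ₑ = ∫⁻ s in Ioo R R', (‖p s‖ₑ * ENNReal.ofReal (√s)) *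
          ENNReal.ofReal (√s)⁻¹ := by
        refine setLIntegral_congr_fun measurableSet_Ioo fun s hs => ?_
        have : 0 < √s := Real.sqrt_pos.2 (hR0.trans hs.1)
        rw [mul_assoc, ← ENNReal.ofReal_mul this.le, mul_inv_cancel₀ this.ne']
        simp
      calc ‖δ‖ₑ ^ 2 ≤ (∫⁻ s in Ioo R R', ‖p s‖ₑ) ^ 2 := by
            rw [e0]; gcongr; exact enorm_integral_le_lintegral_enorm _
        _ ≤ (∫⁻ s in Ioo R R', (‖p s‖ₑ * ENNReal.ofReal (√s)) ^ 2) *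
            ∫⁻ s in Ioo R R', (ENNReal.ofReal (√s)⁻¹) ^ 2 := by
            rw [e1]; exact lintegral_mul_sq_le _ (by fun_prop) (by fun_prop)
        _ = _ := by
            rw [hm, ← setLIntegral_Ioo_inv hR0 hle]
            congr 1
            · refine setLIntegral_congr_fun measurableSet_Ioo fun s hs => ?_
              rw [mul_pow, ← ENNReal.ofReal_pow (Real.sqrt_nonneg _),
                Real.sq_sqrt (hR0.trans hs.1).le]
            · refine setLIntegral_congr_fun measurableSet_Ioo fun s hs => ?_
              rw [← ENNReal.ofReal_pow (by positivity), inv_pow, Real.sq_sqrt (hR0.trans hs.1).le]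
    set E₁ := radialEnergy μ v R (γ - δ) ((Ioo 0 R).indicator p) with hE₁
    set E₂ := ∫⁻ s in Ioo R R', ‖p s‖ₑ ^ 2 * ENNReal.ofReal s with hE₂
    have hE₁fin : E₁ ≠ ⊤ := fun h' => hE (top_le_iff.1 (by rw [← top_add, ← h']; exact hEsplit))
    have hE₂fin : E₂ ≠ ⊤ := ((lintegral_mono_set fun s hs => hR0.trans hs.1).trans_lt hp.energy).ne
    obtain ⟨e₁, he₁0, he₁⟩ : ∃ e : ℝ, 0 ≤ e ∧ E₁ = ENNReal.ofReal e :=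
      ⟨_, ENNReal.toReal_nonneg, (ENNReal.ofReal_toReal hE₁fin).symm⟩
    obtain ⟨e₂, he₂0, he₂⟩ : ∃ e : ℝ, 0 ≤ e ∧ E₂ = ENNReal.ofReal e :=
      ⟨_, ENNReal.toReal_nonneg, (ENNReal.ofReal_toReal hE₂fin).symm⟩
    rw [he₁, he₂, he', ← ENNReal.ofReal_mul hμ.le, ← ENNReal.ofReal_add he₁0 (by positivity),
      ENNReal.ofReal_le_ofReal_iff he'0] at hEsplit
    rw [he₁, hnorm, ← ENNReal.ofReal_mul hl.le, ENNReal.ofReal_le_ofReal_iff (by positivity)] at h1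
    rw [he₂, ← ofReal_norm, ← ENNReal.ofReal_pow (norm_nonneg _), ← ENNReal.ofReal_mul he₂0,
      ENNReal.ofReal_le_ofReal_iff (by positivity)] at hCS
    rw [he', hlm, hnorm, ← ENNReal.ofReal_mul (by positivity)]
    apply ENNReal.ofReal_le_ofReal
    set x := ‖γ - δ‖ with hx
    set y := ‖δ‖ with hy
    have hx0 : 0 ≤ x := norm_nonneg _
    have hy0 : 0 ≤ y := norm_nonneg _
    have htri : ‖γ‖ ≤ x + y := by
      have := norm_add_le (γ - δ) δ
      simpa using this
    have hsq : ‖γ‖ ^ 2 ≤ (x + y) ^ 2 := by gcongr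
    -- The arithmetic–geometric mean inequality for `m e₁` and `l μ e₂`, whose product bounds `(μ x
    -- y)²`. With it the two bounds combine into the factor `l + m = ln(R'/a)`.
    have hcross : μ * (2 * (x * y)) ≤ m * e₁ + l * (μ * e₂) := by
      have h3 : (μ * (2 * (x * y))) ^ 2 ≤ (m * e₁ + l * (μ * e₂)) ^ 2 := by
        have h4 : (μ * x ^ 2) * (μ * y ^ 2) ≤ (l * e₁) * (μ * (e₂ * m)) := by gcongr
        nlinarith [sq_nonneg (m * e₁ - l * (μ * e₂))]
      exact le_of_sq_le_sq h3 (by positivity)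
    calc μ * ‖γ‖ ^ 2 ≤ μ * (x + y) ^ 2 := by gcongr
      _ = μ * x ^ 2 + μ * y ^ 2 + μ * (2 * (x * y)) := by ring
      _ ≤ l * e₁ + μ * (e₂ * m) + (m * e₁ + l * (μ * e₂)) := by gcongr
      _ = (l + m) * (e₁ + μ * e₂) := by ring
      _ ≤ (l + m) * e' := by gcongr

/-- The radial energy up to a radius `R > R₀` is at least `μ |γ|² / ln(R/a)`, where `γ` is the value
at `R`. -/
theorem IsScatteringLength.le_radialEnergy {μ a R₀ : ℝ} (hμ : 0 < μ) (hR₀ : 0 ≤ R₀)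
    {v : ℝ → ℝ≥0∞} (hv_meas : Measurable v) (hv : ∀ r, R₀ < r → v r = 0)
    (h : IsScatteringLength μ v R₀ a) (ha : a ≠ 0) {R : ℝ} (hR : R₀ < R)
    {p : ℝ → ℂ} (hp : IsRadialSlope R p) (γ : ℂ) :
    ENNReal.ofReal μ * ‖γ‖ₑ ^ 2 ≤ logRatio R a * radialEnergy μ v R γ p := by
  obtain ⟨ha0, R₁, hR₁, φ, hφ, hprof⟩ := h
  have ha' : 0 < a := lt_of_le_of_ne ha0 ha.symm
  rw [logRatio, if_neg ha]
  exact le_radialEnergy_of_le_radialEnergy hμ hR₀ hR₁ hR ha'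
    (hφ.le_range hμ hR₀ hR₁ hv_meas hv ha' hprof) hv
    (fun p γ hp => hφ.le_radialEnergy hμ hR₀ hR₁ hv_meas hv ha' hprof hp γ) hp γ

end

noncomputable section

/-! ### Moving one particle radially with respect to another -/

variable {N : ℕ}

/-- The vector of the configuration space with `x_i - x_j` in the place of particle `i`. -/
def relVec (i j : Fin N) : Config N →L[ℝ] Config N :=
  (ContinuousLinearMap.single ℝ (fun _ : Fin N => Plane) i).comp
    (ContinuousLinearMap.proj (R := ℝ) (φ := fun _ : Fin N => Plane) i -
      ContinuousLinearMap.proj (R := ℝ) (φ := fun _ : Fin N => Plane) j)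

lemma relVec_apply (i j : Fin N) (x : Config N) : relVec i j x = Pi.single i (x i - x j) := by
  simp [relVec, Pi.single_sub]

/-- The dilation by `s` of the position of particle `i` about that of particle `j`. -/
def dilate (i j : Fin N) (s : ℝ) (x : Config N) : Config N := x + (s - 1) • relVec i j x

variable {i j : Fin N}

lemma dilate_one (x : Config N) : dilate i j 1 x = x := by simp [dilate]

lemma dilate_apply_self (s : ℝ) (x : Config N) : dilate i j s x i = x j + s • (x i - x j) := by
  simp only [dilate, relVec_apply, Pi.add_apply, Pi.smul_apply, Pi.single_eq_same]
  rw [sub_smul, one_smul]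
  abel

lemma dilate_apply_of_ne (s : ℝ) (x : Config N) {k : Fin N} (hk : k ≠ i) :
    dilate i j s x k = x k := by
  simp [dilate, relVec_apply, hk]

lemma relVec_relVec (hij : j ≠ i) (x : Config N) : relVec i j (relVec i j x) = relVec i j x := by
  simp [relVec_apply, hij]

lemma relVec_dilate (hij : j ≠ i) (s : ℝ) (x : Config N) :
    relVec i j (dilate i j s x) = s • relVec i j x := by
  rw [dilate, map_add, map_smul, relVec_relVec hij, sub_smul, one_smul]
  abel

lemma dilate_dilate (hij : j ≠ i) (s t : ℝ) (x : Config N) :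
    dilate i j s (dilate i j t x) = dilate i j (s * t) x := by
  rw [dilate, relVec_dilate hij, dilate, dilate, smul_smul, add_assoc, ← add_smul]
  congr 2; ring

lemma dilate_sub (hij : j ≠ i) (s : ℝ) (x : Config N) :
    dilate i j s x i - dilate i j s x j = s • (x i - x j) := by
  rw [dilate_apply_self, dilate_apply_of_ne s x hij]
  abel

lemma dist_dilate (hij : j ≠ i) {s : ℝ} (hs : 0 ≤ s) (x : Config N) :
    dist (dilate i j s x i) (dilate i j s x j) = s * dist (x i) (x j) := by
  rw [dist_eq_norm, dilate_sub hij, norm_smul, Real.norm_of_nonneg hs, dist_eq_norm]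

lemma continuous_dilate : Continuous fun z : ℝ × Config N => dilate i j z.1 z.2 := by
  unfold dilate; fun_prop

lemma contDiff_dilate (s : ℝ) : ContDiff ℝ ∞ (dilate i j s) := by
  unfold dilate; fun_prop

lemma measurable_dilate : Measurable fun z : ℝ × Config N => dilate i j z.1 z.2 :=
  continuous_dilate.measurable

lemma continuous_dilate_right (s : ℝ) : Continuous (dilate i j s) :=
  continuous_dilate.comp (Continuous.prodMk_right s)

/-- The dilation as a homeomorphism. -/
def dilateHomeomorph (hij : j ≠ i) {s : ℝ} (hs : s ≠ 0) : Config N ≃ₜ Config N where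
  toFun := dilate i j s
  invFun := dilate i j s⁻¹
  left_inv x := by rw [dilate_dilate hij, inv_mul_cancel₀ hs, dilate_one]
  right_inv x := by rw [dilate_dilate hij, mul_inv_cancel₀ hs, dilate_one]
  continuous_toFun := continuous_dilate_right s
  continuous_invFun := continuous_dilate_right s⁻¹

lemma lintegral_plane_dilate {s : ℝ} (hs : 0 < s) (c : Plane) {f : Plane → ℝ≥0∞}
    (hf : Measurable f) :
    ∫⁻ t, f (c + s • (t - c)) = ENNReal.ofReal (s ^ 2)⁻¹ * ∫⁻ t, f t := by
  have hm : Measurable fun t : Plane => f (c + t) := by fun_prop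
  rw [lintegral_sub_right_eq_self (fun t => f (c + s • t)) c,
    ← lintegral_map (f := fun t => f (c + t)) hm (measurable_const_smul s),
    Measure.map_addHaar_smul _ hs.ne', lintegral_smul_measure,
    lintegral_add_left_eq_self (μ := (volume : Measure Plane)) f c]
  simp [abs_of_pos hs]

/-- Only `x_i` moves, within a plane and with `x_j` fixed; Fubini leaves a planar dilation with
Jacobian `s²`. -/
lemma lintegral_dilate (hij : j ≠ i) {s : ℝ} (hs : 0 < s) {f : Config N → ℝ≥0∞}
    (hf : Measurable f) :
    ∫⁻ x, f (dilate i j s x) = ENNReal.ofReal (s ^ 2)⁻¹ * ∫⁻ x, f x := by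
  have hd := (continuous_dilate_right (i := i) (j := j) s).measurable
  rw [← lintegral_const_mul _ hf]
  refine lintegral_eq_of_lmarginal_eq (μ := fun _ : Fin N => (volume : Measure Plane)) {i}
    (hf.comp hd) (by fun_prop) ?_
  ext x
  rw [lmarginal_singleton, lmarginal_singleton]
  have e : ∀ t, dilate i j s (Function.update x i t) = Function.update x i (x j + s • (t - x j)) := by
    intro t
    ext1 k
    by_cases hk : k = i
    · subst hk
      rw [dilate_apply_self]
      simp [Function.update_of_ne hij]
    · rw [dilate_apply_of_ne _ _ hk, Function.update_of_ne hk, Function.update_of_ne hk]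
  have hu : Measurable fun t => f (Function.update x i t) := hf.comp (measurable_update x)
  simp only [e]
  rw [lintegral_plane_dilate hs (x j) hu, lintegral_const_mul _ hu]

lemma map_dilate (hij : j ≠ i) {s : ℝ} (hs : 0 < s) :
    Measure.map (dilate i j s) (volume : Measure (Config N)) =
      ENNReal.ofReal (s ^ 2)⁻¹ • volume := by
  have hd := (continuous_dilate_right (i := i) (j := j) s).measurable
  ext A hA
  rw [← lintegral_indicator_one hA, lintegral_map (measurable_one.indicator hA) hd,
    lintegral_dilate hij hs (measurable_one.indicator hA), lintegral_indicator_one hA]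
  simp

lemma integral_dilate (hij : j ≠ i) {s : ℝ} (hs : 0 < s) (f : Config N → ℂ) :
    ∫ x, f (dilate i j s x) = ((s ^ 2)⁻¹ : ℝ) • ∫ x, f x := by
  have he : MeasurableEmbedding (dilate i j s) :=
    (dilateHomeomorph hij hs.ne').measurableEmbedding
  rw [← he.integral_map, map_dilate hij hs, integral_smul_measure,
    ENNReal.toReal_ofReal (by positivity)]

/-- Square integrability of a dilated function in the dilation parameter and the position. -/
lemma memLp_dilate_prod (hij : j ≠ i) {ν : Measure ℝ} [IsFiniteMeasure ν] {σ : ℝ → ℝ}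
    (hσ : Measurable σ) {c : ℝ} (hc : 0 < c) (hσc : ∀ᵐ s ∂ν, c ≤ σ s) {f : Config N → ℂ}
    (hfm : Measurable f) (hf : MemLp f 2 volume) :
    MemLp (fun z : ℝ × Config N => f (dilate i j (σ z.1) z.2)) 2 (ν.prod volume) := by
  have hm : Measurable fun z : ℝ × Config N => f (dilate i j (σ z.1) z.2) :=
    hfm.comp (measurable_dilate.comp ((hσ.comp measurable_fst).prodMk measurable_snd))
  rw [memLp_two_iff]
  refine ⟨hm.aestronglyMeasurable, ?_⟩
  rw [lintegral_prod _ (hm.enorm.pow_const 2).aemeasurable]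
  have hb : ∀ᵐ s ∂ν, ∫⁻ x, ‖f (dilate i j (σ s) x)‖ₑ ^ 2 ≤
      ENNReal.ofReal (c ^ 2)⁻¹ * ∫⁻ x, ‖f x‖ₑ ^ 2 := by
    filter_upwards [hσc] with s hs
    rw [lintegral_dilate hij (hc.trans_le hs) (f := fun x => ‖f x‖ₑ ^ 2) (by fun_prop)]
    gcongr
  refine (lintegral_mono_ae hb).trans_lt ?_
  rw [lintegral_const]
  exact ENNReal.mul_lt_top (ENNReal.mul_lt_top ENNReal.ofReal_lt_top (memLp_two_iff.1 hf).2)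
    (measure_lt_top _ _)

lemma memLp_snd_prod {α β : Type*} [MeasurableSpace α] [MeasurableSpace β] {ν : Measure α}
    [IsFiniteMeasure ν] {ρ : Measure β} [SFinite ρ] {f : β → ℂ} (hf : MemLp f 2 ρ) :
    MemLp (fun z : α × β => f z.2) 2 (ν.prod ρ) := hf.comp_snd ν

/-- The moved particle stays on the segment from `x_j` to `x_i`, which lies in `Λ` by convexity. -/
lemma dilate_mem_configIn {Λ : Set Plane} (hΛ : Convex ℝ Λ) {x : Config N} (hx : x ∈ configIn N Λ)
    {s : ℝ} (hs : 0 ≤ s) (hs1 : s ≤ 1) : dilate i j s x ∈ configIn N Λ := by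
  intro k
  by_cases hk : k = i
  · subst hk
    rw [dilate_apply_self]
    have := hΛ (hx j) (hx k) (sub_nonneg.2 hs1) hs (by ring)
    convert this using 1
    simp only [smul_sub, sub_smul, one_smul]
    abel
  · rw [dilate_apply_of_ne _ _ hk]; exact hx k

lemma isOpen_configIn {Λ : Set Plane} (hΛ : IsOpen Λ) : IsOpen (configIn N Λ) := by
  have : configIn N Λ = ⋂ k, (fun x : Config N => x k) ⁻¹' Λ := by ext x; simp [configIn]
  rw [this]
  exact isOpen_iInter_of_finite fun k => hΛ.preimage (continuous_apply k)

end

/-! ### The generator of the dilations and its test fields. -/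

noncomputable section

variable {N : ℕ} {i j : Fin N}

lemma relVec_eq_sum (i j : Fin N) (x : Config N) :
    relVec i j x = ∑ k, (x i - x j) k • configDir (i, k) := by
  rw [relVec_apply]
  ext l m
  by_cases h : l = i
  · subst h
    fin_cases m <;> simp [configDir, planeDir]
  · simp [configDir, h]

/-- The generator of the dilations about particle `j`, in divergence form. -/
def dilationDiv (i j : Fin N) (ξ : Config N → ℝ) (z : Config N) : ℝ :=
  2 * ξ z + fderiv ℝ ξ z (relVec i j z)

lemma continuous_dilationDiv {ξ : Config N → ℝ} (hξ : ContDiff ℝ ∞ ξ) :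
    Continuous (dilationDiv i j ξ) := by
  have h1 := hξ.continuous
  have h2 : Continuous fun z => fderiv ℝ ξ z (relVec i j z) :=
    (hξ.continuous_fderiv (by simp)).clm_apply (relVec i j).continuous
  unfold dilationDiv
  fun_prop

lemma hasCompactSupport_dilationDiv {ξ : Config N → ℝ} (hc : HasCompactSupport ξ) :
    HasCompactSupport (dilationDiv i j ξ) := by
  refine HasCompactSupport.intro (K := tsupport ξ) hc fun z hz => ?_
  have h1 : ξ z = 0 := image_eq_zero_of_notMem_tsupport hz
  have h2 : fderiv ℝ ξ z = 0 :=
    Function.notMem_support.1 fun h => hz (support_fderiv_subset ℝ h)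
  simp [dilationDiv, h1, h2]

/-- `s⁻² ξ(dilate s⁻¹ x)` is the adjoint dilation applied to `ξ`. Its derivative replaces that of `s
↦ Ψ(dilate s x)`, which is not available for a Sobolev function. -/
lemma hasDerivAt_dilate_inv (hij : j ≠ i) {ξ : Config N → ℝ} (hξ : ContDiff ℝ ∞ ξ) (x : Config N)
    {s : ℝ} (hs : s ≠ 0) :
    HasDerivAt (fun s => (s ^ 2)⁻¹ * ξ (dilate i j s⁻¹ x))
      (-((s ^ 3)⁻¹ * dilationDiv i j ξ (dilate i j s⁻¹ x))) s := by
  have h1 : HasDerivAt (fun s : ℝ => dilate i j s⁻¹ x) (-(s ^ 2)⁻¹ • relVec i j x) s := by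
    unfold dilate
    exact (((hasDerivAt_inv hs).sub_const 1).smul_const _).const_add x
  have h2 := ((hξ.differentiable (by simp)) (dilate i j s⁻¹ x)).hasFDerivAt.comp_hasDerivAt s h1
  have h3 : HasDerivAt (fun s : ℝ => (s ^ 2)⁻¹) (-(2 * s) / (s ^ 2) ^ 2) s := by
    have := (hasDerivAt_pow 2 s).inv (pow_ne_zero 2 hs)
    simpa using! this
  have h4 := h3.mul h2
  convert! h4 using 1
  have h5 : relVec i j x = s • relVec i j (dilate i j s⁻¹ x) := by
    rw [relVec_dilate hij, smul_smul, mul_inv_cancel₀ hs, one_smul]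
  rw [h5, smul_smul, map_smul, dilationDiv, smul_eq_mul]
  simp only [Function.comp]
  field_simp
  ring

/-- The components of the test field generating the dilations. -/
def dilationField (i j : Fin N) (ξ : Config N → ℝ) (s : ℝ) (k : Fin 2) (x : Config N) : ℝ :=
  (x i - x j) k * ξ (dilate i j s⁻¹ x)

lemma contDiff_dilationField {ξ : Config N → ℝ} (hξ : ContDiff ℝ ∞ ξ) (s : ℝ) (k : Fin 2) :
    ContDiff ℝ ∞ (dilationField i j ξ s k) := by
  unfold dilationField
  refine ContDiff.mul ?_ (hξ.comp (contDiff_dilate s⁻¹))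
  simp only [PiLp.sub_apply]
  fun_prop

lemma tsupport_dilationField (hij : j ≠ i) {ξ : Config N → ℝ} {s : ℝ} (hs : s ≠ 0) (k : Fin 2) :
    tsupport (dilationField i j ξ s k) ⊆ dilate i j s '' tsupport ξ := by
  refine closure_minimal (fun x hx => ?_)
    ((dilateHomeomorph hij hs).isClosedMap _ (isClosed_tsupport ξ))
  refine ⟨dilate i j s⁻¹ x, subset_tsupport _ fun h => hx ?_, ?_⟩
  · simp [dilationField, h]
  · rw [dilate_dilate hij, mul_inv_cancel₀ hs, dilate_one]

lemma hasCompactSupport_dilationField (hij : j ≠ i) {ξ : Config N → ℝ} (hc : HasCompactSupport ξ)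
    {s : ℝ} (hs : s ≠ 0) (k : Fin 2) : HasCompactSupport (dilationField i j ξ s k) :=
  (IsCompact.image hc (continuous_dilate_right s)).of_isClosed_subset (isClosed_tsupport _)
    (tsupport_dilationField hij hs k)

/-- The divergence of `x_i - x_j` in `x_i` is `2`, and the chain-rule factor `s⁻¹` is absorbed since
`relVec` at the dilated point is `s⁻¹` times `relVec` at `x`. Hence the derivative in
`hasDerivAt_dilate_inv` is a divergence, on which the weak gradient of `Ψ` can act. -/
lemma sum_fderiv_dilationField (hij : j ≠ i) {ξ : Config N → ℝ} (hξ : ContDiff ℝ ∞ ξ) (s : ℝ)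
    (x : Config N) :
    ∑ k, fderiv ℝ (dilationField i j ξ s k) x (configDir (i, k)) =
      dilationDiv i j ξ (dilate i j s⁻¹ x) := by
  have h1 : ∀ k, fderiv ℝ (dilationField i j ξ s k) x (configDir (i, k)) =
      ξ (dilate i j s⁻¹ x) + (x i - x j) k *
        (s⁻¹ * fderiv ℝ ξ (dilate i j s⁻¹ x) (configDir (i, k))) := by
    intro k
    have ha : HasDerivAt (fun t : ℝ => x + t • configDir (i, k)) (configDir (i, k)) 0 := by
      simpa using ((hasDerivAt_id (0 : ℝ)).smul_const (configDir (i, k))).const_add x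
    have hdir : ∀ t : ℝ, ((x + t • configDir (i, k)) i - (x + t • configDir (i, k)) j) k =
        (x i - x j) k + t := by
      intro t
      simp [configDir, planeDir, hij]
      ring
    have hrel : relVec i j (configDir (i, k)) = configDir (i, k) := by
      rw [relVec_apply]; simp [configDir, hij]
    have hdil : ∀ t : ℝ, dilate i j s⁻¹ (x + t • configDir (i, k)) =
        dilate i j s⁻¹ x + t • (s⁻¹ • configDir (i, k)) := by
      intro t
      simp only [dilate, map_add, map_smul, hrel]
      module
    have hb : HasDerivAt (fun t : ℝ => dilate i j s⁻¹ x + t • (s⁻¹ • configDir (i, k)))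
        (s⁻¹ • configDir (i, k)) 0 := by
      simpa using ((hasDerivAt_id (0 : ℝ)).smul_const (s⁻¹ • configDir (i, k))).const_add
        (dilate i j s⁻¹ x)
    have hf : HasFDerivAt (dilationField i j ξ s k) (fderiv ℝ (dilationField i j ξ s k) x)
        (x + (0 : ℝ) • configDir (i, k)) := by
      rw [zero_smul, add_zero]
      exact ((contDiff_dilationField hξ s k).differentiable (by simp) x).hasFDerivAt
    have hg : HasFDerivAt ξ (fderiv ℝ ξ (dilate i j s⁻¹ x))
        (dilate i j s⁻¹ x + (0 : ℝ) • (s⁻¹ • configDir (i, k))) := by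
      rw [zero_smul, add_zero]
      exact (hξ.differentiable (by simp) _).hasFDerivAt
    have hc1 := hf.comp_hasDerivAt (0 : ℝ) ha
    have hc2 := ((hasDerivAt_id (0 : ℝ)).const_add ((x i - x j) k)).mul (hg.comp_hasDerivAt (0 : ℝ) hb)
    have he : (dilationField i j ξ s k ∘ fun t : ℝ => x + t • configDir (i, k)) =
        (fun t : ℝ => (x i - x j) k + id t) *
          (ξ ∘ fun t : ℝ => dilate i j s⁻¹ x + t • (s⁻¹ • configDir (i, k))) := by
      ext t
      simp only [Function.comp, dilationField, Pi.mul_apply, hdir, hdil, id]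
    rw [he] at hc1
    rw [hc1.unique hc2]
    simp
  simp only [h1, Finset.sum_add_distrib]
  have h2 : relVec i j (dilate i j s⁻¹ x) = s⁻¹ • relVec i j x := relVec_dilate hij _ _
  rw [dilationDiv, h2, relVec_eq_sum i j x, map_smul, map_sum]
  simp only [map_smul, smul_eq_mul, Finset.mul_sum]
  simp only [Finset.sum_const, Finset.card_univ, Fintype.card_fin, nsmul_eq_mul, Nat.cast_ofNat]
  congr 1
  exact Finset.sum_congr rfl fun k _ => by ring

/-- The derivative of `s ↦ Ψ(dilate s x)` in terms of the weak gradient of `Ψ`. -/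
def rayDeriv (i j : Fin N) (G : Fin N × Fin 2 → Config N → ℂ) (x : Config N) (s : ℝ) : ℂ :=
  ∑ k, (((x i - x j) k : ℝ) : ℂ) * G (i, k) (dilate i j s x)

end

/-! ### The fundamental theorem of calculus along almost every ray. -/

noncomputable section

variable {N : ℕ} {i j : Fin N}

lemma memLp_ofReal_of_hasCompactSupport {E : Type*} [NormedAddCommGroup E] [MeasureSpace E]
    [BorelSpace E] [IsLocallyFiniteMeasure (volume : Measure E)] {η : E → ℝ} (hη : Continuous η)
    (hc : HasCompactSupport η) : MemLp (fun x => ((η x : ℝ) : ℂ)) 2 volume :=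
  Continuous.memLp_of_hasCompactSupport (by fun_prop)
    (hc.comp_left (g := fun t : ℝ => (t : ℂ)) (by simp))

lemma memLp_dilate (hij : j ≠ i) {s : ℝ} (hs : 0 < s) {f : Config N → ℂ} (hfm : Measurable f)
    (hf : MemLp f 2 volume) : MemLp (fun x => f (dilate i j s x)) 2 volume := by
  rw [memLp_two_iff]
  refine ⟨(hfm.comp (continuous_dilate_right s).measurable).aestronglyMeasurable, ?_⟩
  rw [lintegral_dilate hij hs (f := fun x => ‖f x‖ₑ ^ 2) (by fun_prop)]
  exact ENNReal.mul_lt_top ENNReal.ofReal_lt_top (memLp_two_iff.1 hf).2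

lemma measurable_rayDeriv {G : Fin N × Fin 2 → Config N → ℂ} (hGm : ∀ k, Measurable (G (i, k))) :
    Measurable fun z : Config N × ℝ => rayDeriv i j G z.1 z.2 := by
  unfold rayDeriv
  refine Finset.measurable_sum _ fun k _ => Measurable.mul ?_ ?_
  · have : Measurable fun z : Config N × ℝ => z.1 i - z.1 j := by fun_prop
    have h2 : Measurable fun y : Plane => ((y k : ℝ) : ℂ) := by fun_prop
    exact h2.comp this
  · exact (hGm k).comp (measurable_dilate.comp measurable_swap)

lemma integrable_rayDeriv_mul (hij : j ≠ i) {G : Fin N × Fin 2 → Config N → ℂ}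
    (hGm : ∀ k, Measurable (G (i, k))) (hG : ∀ k, MemLp (G (i, k)) 2 volume) {τ : ℝ} (hτ : 0 < τ)
    {w : Config N → ℝ} (hw : Continuous w) (hwc : HasCompactSupport w) :
    Integrable (fun z : ℝ × Config N => rayDeriv i j G z.2 z.1 * ((w z.2 : ℝ) : ℂ))
      ((volume.restrict (Ioc τ 1)).prod volume) := by
  have h1 : ∀ k, Integrable (fun z : ℝ × Config N => G (i, k) (dilate i j z.1 z.2) *
      ((((z.2 i - z.2 j) k * w z.2 : ℝ)) : ℂ)) ((volume.restrict (Ioc τ 1)).prod volume) := by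
    intro k
    have hd := memLp_dilate_prod hij (ν := volume.restrict (Ioc τ 1)) measurable_id hτ
      (by filter_upwards [ae_restrict_mem measurableSet_Ioc] with s hs using hs.1.le) (hGm k) (hG k)
    have hy : Continuous fun x : Config N => (x i - x j) k * w x := by
      simp only [PiLp.sub_apply]
      fun_prop
    have hyc : HasCompactSupport fun x : Config N => (x i - x j) k * w x := hwc.mul_left
    exact hd.integrable_mul (memLp_snd_prod (memLp_ofReal_of_hasCompactSupport hy hyc))
  refine (integrable_finsetSum Finset.univ fun k _ => h1 k).congr
    (Filter.Eventually.of_forall fun z => ?_)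
  simp only [rayDeriv, Finset.sum_mul]
  refine Finset.sum_congr rfl fun k _ => ?_
  push_cast
  ring

/-- Along almost every ray starting at particle `j`, a function with a square integrable weak gradient
is the integral of its radial derivative. -/
theorem ae_sub_dilate_eq {Λ : Set Plane} (hΛo : IsOpen Λ) (hΛc : Convex ℝ Λ) (hij : j ≠ i)
    {Ψ : Config N → ℂ} (hΨm : Measurable Ψ) (hΨ : MemLp Ψ 2 volume)
    (hΨ0 : ∀ x, x ∉ configIn N Λ → Ψ x = 0) {G : Fin N × Fin 2 → Config N → ℂ}
    (hGm : ∀ k, Measurable (G (i, k))) (hG : ∀ k, MemLp (G (i, k)) 2 volume)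
    (hG0 : ∀ k x, x ∉ configIn N Λ → G (i, k) x = 0)
    (hw : ∀ k, HasWeakDeriv (configIn N Λ) (configDir (i, k)) Ψ (G (i, k)))
    {τ : ℝ} (hτ : 0 < τ) (hτ1 : τ < 1) :
    ∀ᵐ x, x ∈ configIn N Λ →
      Ψ x - Ψ (dilate i j τ x) - ∫ s in Ioc τ 1, rayDeriv i j G x s = 0 := by
  set ν := volume.restrict (Ioc τ 1) with hν
  -- Integrability is available only after multiplication by a compactly supported weight; a bump
  -- equal to `1` near the point gives the local statement.
  have hloc : LocallyIntegrable fun x => ∫ s in Ioc τ 1, rayDeriv i j G x s := by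
    intro x
    let w : ContDiffBump x := default
    have hi := (integrable_rayDeriv_mul hij hGm hG hτ w.continuous w.hasCompactSupport).integral_prod_right
    refine ⟨Metric.closedBall x w.rIn, Metric.closedBall_mem_nhds x w.rIn_pos, ?_⟩
    refine (hi.integrableOn (s := Metric.closedBall x w.rIn)).congr_fun (fun y hy => ?_)
      Metric.isClosed_closedBall.measurableSet
    simp [w.one_of_mem_closedBall hy]
  have hΨτ := memLp_dilate hij hτ hΨm hΨ
  have hloc' : LocallyIntegrable fun x =>
      Ψ x - Ψ (dilate i j τ x) - ∫ s in Ioc τ 1, rayDeriv i j G x s :=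
    ((hΨ.locallyIntegrable (by norm_num)).sub (hΨτ.locallyIntegrable (by norm_num))).sub hloc
  refine (isOpen_configIn hΛo).ae_eq_zero_of_integral_contDiff_smul_eq_zero
    (hloc'.locallyIntegrableOn _) fun ξ hξ hξc hξs => ?_
  have hξL := memLp_ofReal_of_hasCompactSupport hξ.continuous hξc
  have hset : ∀ (F f : Config N → ℂ), (∀ x, x ∉ configIn N Λ → F x = 0) →
      ∫ x in configIn N Λ, F x * f x = ∫ x, F x * f x := fun F f hF =>
    setIntegral_eq_integral_of_forall_compl_eq_zero fun x hx => by rw [hF x hx, zero_mul]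
  -- the weak formulation, transported by the dilation
  have hweak : ∀ s ∈ Ioc τ 1, ∫ x, Ψ x * ((dilationDiv i j ξ (dilate i j s⁻¹ x) : ℝ) : ℂ) =
      -((s ^ 3 : ℝ) : ℂ) * ∫ x, rayDeriv i j G x s * ((ξ x : ℝ) : ℂ) := by
    intro s hs
    have hs0 : 0 < s := hτ.trans hs.1
    -- The test field is supported in the `s`-dilate of the support of `ξ`, which stays in `Λ^N`
    -- because `s ≤ 1` and `Λ` is convex.
    have hsub : ∀ k, tsupport (dilationField i j ξ s k) ⊆ configIn N Λ := fun k x hx => by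
      obtain ⟨y, hy, rfl⟩ := tsupport_dilationField hij hs0.ne' k hx
      exact dilate_mem_configIn hΛc (hξs hy) hs0.le hs.2
    have h1 : ∀ k, ∫ x, Ψ x * ((fderiv ℝ (dilationField i j ξ s k) x (configDir (i, k)) : ℝ) : ℂ) =
        -∫ x, G (i, k) x * ((dilationField i j ξ s k x : ℝ) : ℂ) := by
      intro k
      have := hw k _ (contDiff_dilationField hξ s k)
        (hasCompactSupport_dilationField hij hξc hs0.ne' k) (hsub k)
      rwa [hset Ψ _ hΨ0, hset (G (i, k)) _ (hG0 k)] at this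
    -- The power `s³` is the Jacobian `s²` times the factor `s` by which `x_i - x_j` scales.
    have h2 : ∀ k, ∫ x, G (i, k) x * ((dilationField i j ξ s k x : ℝ) : ℂ) =
        ((s ^ 3 : ℝ) : ℂ) * ∫ x, (((x i - x j) k : ℝ) : ℂ) * G (i, k) (dilate i j s x) *
          ((ξ x : ℝ) : ℂ) := by
      intro k
      have h3 := integral_dilate hij hs0 fun x => G (i, k) x * ((dilationField i j ξ s k x : ℝ) : ℂ)
      have h4 : ∀ x, G (i, k) (dilate i j s x) *
          ((dilationField i j ξ s k (dilate i j s x) : ℝ) : ℂ) = (s : ℂ) *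
          ((((x i - x j) k : ℝ) : ℂ) * G (i, k) (dilate i j s x) * ((ξ x : ℝ) : ℂ)) := by
        intro x
        rw [dilationField, dilate_sub hij, dilate_dilate hij, inv_mul_cancel₀ hs0.ne', dilate_one]
        simp only [PiLp.smul_apply, smul_eq_mul]
        push_cast; ring
      simp only [h4] at h3
      rw [integral_const_mul, Complex.real_smul] at h3
      have hsc : (s : ℂ) ≠ 0 := by exact_mod_cast hs0.ne'
      push_cast at h3 ⊢
      field_simp at h3
      rw [← h3]
    have h_int : ∀ k, Integrable fun x => (((x i - x j) k : ℝ) : ℂ) * G (i, k) (dilate i j s x) *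
          ((ξ x : ℝ) : ℂ) := by
      intro k
      have hy : Continuous fun x : Config N => (x i - x j) k * ξ x := by
        have := hξ.continuous
        simp only [PiLp.sub_apply]
        fun_prop
      have hyc : HasCompactSupport fun x : Config N => (x i - x j) k * ξ x := hξc.mul_left
      refine ((memLp_dilate hij hs0 (hGm k) (hG k)).integrable_mul
        (memLp_ofReal_of_hasCompactSupport hy hyc)).congr (Filter.Eventually.of_forall fun x => ?_)
      simp only [Pi.mul_apply]
      push_cast; ring
    have h5 : ∀ x, rayDeriv i j G x s * ((ξ x : ℝ) : ℂ) = ∑ k, (((x i - x j) k : ℝ) : ℂ) *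
        G (i, k) (dilate i j s x) * ((ξ x : ℝ) : ℂ) := fun x => by rw [rayDeriv, Finset.sum_mul]
    simp only [h5]
    rw [integral_finsetSum _ fun k _ => h_int k, Finset.mul_sum]
    simp only [neg_mul, ← h2, ← h1]
    rw [← integral_finsetSum _ fun k _ => ?_]
    · simp only [← Finset.mul_sum, ← Complex.ofReal_sum, sum_fderiv_dilationField hij hξ]
    · have := integrableOn_mul_of_hasCompactSupport (Ω := univ) (f := Ψ) (by simpa using hΨ)
        (continuous_fderiv_apply (contDiff_dilationField hξ s k) (configDir (i, k)))
        (hasCompactSupport_fderiv_apply (hasCompactSupport_dilationField hij hξc hs0.ne' k) _)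
      rwa [integrableOn_univ] at this
  -- the fundamental theorem of calculus for the transported test function
  have hftc : ∀ x, ξ x - (τ ^ 2)⁻¹ * ξ (dilate i j τ⁻¹ x) =
      ∫ s in Ioc τ 1, -((s ^ 3)⁻¹ * dilationDiv i j ξ (dilate i j s⁻¹ x)) := by
    intro x
    have hne : ∀ s ∈ uIcc τ 1, s ≠ 0 := by
      intro s hs
      rw [uIcc_of_le hτ1.le] at hs
      exact (hτ.trans_le hs.1).ne'
    rw [← intervalIntegral.integral_of_le hτ1.le, intervalIntegral.integral_eq_sub_of_hasDerivAt
      (fun s hs => hasDerivAt_dilate_inv hij hξ x (hne s hs))]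
    · simp [dilate_one]
    · refine ContinuousOn.intervalIntegrable ?_
      have h1 : ContinuousOn (fun s : ℝ => (s ^ 3)⁻¹) (uIcc τ 1) :=
        (continuousOn_id.pow 3).inv₀ fun s hs => pow_ne_zero 3 (hne s hs)
      have h2 : ContinuousOn (fun s : ℝ => dilate i j s⁻¹ x) (uIcc τ 1) :=
        (continuous_dilate.comp (Continuous.prodMk_left x)).comp_continuousOn
          (continuousOn_id.inv₀ hne)
      exact (h1.mul ((continuous_dilationDiv hξ).comp_continuousOn h2)).neg
  have hleft : (∫ x, Ψ x * ((ξ x : ℝ) : ℂ)) - (∫ x, Ψ (dilate i j τ x) * ((ξ x : ℝ) : ℂ)) =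
      ∫ x, Ψ x * ∫ s in Ioc τ 1, ((-((s ^ 3)⁻¹ * dilationDiv i j ξ (dilate i j s⁻¹ x)) : ℝ) : ℂ) := by
    have h1 := integral_dilate hij hτ fun x => Ψ x * ((ξ (dilate i j τ⁻¹ x) : ℝ) : ℂ)
    simp only [dilate_dilate hij, inv_mul_cancel₀ hτ.ne', dilate_one] at h1
    have hξτ : MemLp (fun x => ((ξ (dilate i j τ⁻¹ x) : ℝ) : ℂ)) 2 volume :=
      memLp_dilate hij (inv_pos.2 hτ) (f := fun x => ((ξ x : ℝ) : ℂ))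
        (by have := hξ.continuous.measurable; fun_prop) hξL
    have hj1 : Integrable fun x => Ψ x * ((ξ x : ℝ) : ℂ) := hΨ.integrable_mul hξL
    have hj2 : Integrable fun x => Ψ x * ((ξ (dilate i j τ⁻¹ x) : ℝ) : ℂ) := hΨ.integrable_mul hξτ
    rw [h1, Complex.real_smul, ← integral_const_mul, ← integral_sub hj1 (hj2.const_mul _)]
    congr 1; ext x
    rw [integral_complex_ofReal, ← hftc x]
    push_cast
    ring
  -- Fubini is justified by `s⁻³ ≤ τ⁻³` on `(τ, 1]`; this is where staying away from the particle
  -- `j` matters.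
  have hswap : ∫ x, Ψ x * ∫ s in Ioc τ 1,
      ((-((s ^ 3)⁻¹ * dilationDiv i j ξ (dilate i j s⁻¹ x)) : ℝ) : ℂ) =
      ∫ s in Ioc τ 1, ∫ x, rayDeriv i j G x s * ((ξ x : ℝ) : ℂ) := by
    have hd : MemLp (fun z : ℝ × Config N =>
        ((dilationDiv i j ξ (dilate i j z.1⁻¹ z.2) : ℝ) : ℂ)) 2 (ν.prod volume) := by
      refine memLp_dilate_prod hij (σ := fun s => s⁻¹) (f := fun x => ((dilationDiv i j ξ x : ℝ) : ℂ))
        measurable_inv one_pos ?_ ?_ ?_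
      · filter_upwards [ae_restrict_mem measurableSet_Ioc] with s hs
        exact (one_le_inv₀ (hτ.trans hs.1)).2 hs.2
      · have := (continuous_dilationDiv (i := i) (j := j) hξ).measurable
        fun_prop
      · exact memLp_ofReal_of_hasCompactSupport (continuous_dilationDiv hξ)
          (hasCompactSupport_dilationDiv hξc)
    have hΨp : MemLp (fun z : ℝ × Config N => Ψ z.2) 2 (ν.prod volume) := memLp_snd_prod hΨ
    have hi1 := hΨp.integrable_mul hd
    have hi2 : Integrable (fun z : ℝ × Config N => Ψ z.2 *
        ((-((z.1 ^ 3)⁻¹ * dilationDiv i j ξ (dilate i j z.1⁻¹ z.2)) : ℝ) : ℂ)) (ν.prod volume) := by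
      refine (hi1.bdd_mul (c := (τ ^ 3)⁻¹) (f := fun z : ℝ × Config N => ((-(z.1 ^ 3)⁻¹ : ℝ) : ℂ))
        ?_ ?_).congr (Filter.Eventually.of_forall fun z => ?_)
      · exact Measurable.aestronglyMeasurable (by fun_prop)
      · have hae : ∀ᵐ z : ℝ × Config N ∂(ν.prod volume), z.1 ∈ Ioc τ 1 :=
          Measure.quasiMeasurePreserving_fst.ae (ae_restrict_mem measurableSet_Ioc)
        filter_upwards [hae] with z hz
        have : 0 < z.1 := hτ.trans hz.1
        rw [Complex.norm_real, norm_neg, Real.norm_of_nonneg (by positivity)]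
        gcongr
        exact hz.1.le
      · simp only [Pi.mul_apply]
        push_cast; ring
    simp only [← integral_const_mul]
    rw [← integral_integral_swap (f := fun s x => Ψ x *
        ((-((s ^ 3)⁻¹ * dilationDiv i j ξ (dilate i j s⁻¹ x)) : ℝ) : ℂ)) hi2]
    refine setIntegral_congr_fun measurableSet_Ioc fun s hs => ?_
    have hs0 : (s : ℂ) ≠ 0 := by exact_mod_cast (hτ.trans hs.1).ne'
    have e : ∀ x, Ψ x * ((-((s ^ 3)⁻¹ * dilationDiv i j ξ (dilate i j s⁻¹ x)) : ℝ) : ℂ) =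
        (-((s ^ 3)⁻¹ : ℝ) : ℂ) * (Ψ x * ((dilationDiv i j ξ (dilate i j s⁻¹ x) : ℝ) : ℂ)) := by
      intro x; push_cast; ring
    simp only [e]
    rw [integral_const_mul, hweak s hs]
    push_cast
    field_simp
  have hright : ∫ s in Ioc τ 1, ∫ x, rayDeriv i j G x s * ((ξ x : ℝ) : ℂ) =
      ∫ x, (∫ s in Ioc τ 1, rayDeriv i j G x s) * ((ξ x : ℝ) : ℂ) := by
    rw [integral_integral_swap (integrable_rayDeriv_mul hij hGm hG hτ hξ.continuous hξc)]
    simp only [integral_mul_const]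
  have hi3 : Integrable fun x => (∫ s in Ioc τ 1, rayDeriv i j G x s) * ((ξ x : ℝ) : ℂ) := by
    have := (integrable_rayDeriv_mul hij hGm hG hτ hξ.continuous hξc).integral_prod_right
    simpa only [integral_mul_const] using this
  have hi1 : Integrable fun x => Ψ x * ((ξ x : ℝ) : ℂ) := hΨ.integrable_mul hξL
  have hi2 : Integrable fun x => Ψ (dilate i j τ x) * ((ξ x : ℝ) : ℂ) := hΨτ.integrable_mul hξL
  have hfinal : (∫ x, Ψ x * ((ξ x : ℝ) : ℂ)) - (∫ x, Ψ (dilate i j τ x) * ((ξ x : ℝ) : ℂ)) -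
      ∫ x, (∫ s in Ioc τ 1, rayDeriv i j G x s) * ((ξ x : ℝ) : ℂ) = 0 := by
    rw [hleft, hswap, hright, sub_self]
  have hi12 : Integrable fun x => Ψ x * ((ξ x : ℝ) : ℂ) - Ψ (dilate i j τ x) * ((ξ x : ℝ) : ℂ) :=
    hi1.sub hi2
  rw [← hfinal, ← integral_sub hi1 hi2, ← integral_sub hi12 hi3]
  congr 1; ext x
  rw [Complex.real_smul]
  ring

end

noncomputable section

variable {N : ℕ} {i j : Fin N}

/-! ### Changes of variables on the half-line -/

lemma setLIntegral_Ioo_scale {ρ : ℝ} (hρ : 0 < ρ) (f : ℝ → ℝ≥0∞) :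
    ∫⁻ r in Ioo 0 ρ, f r = ∫⁻ s in Ioo (0 : ℝ) 1, ENNReal.ofReal ρ * f (ρ * s) := by
  have himg : (fun s => ρ * s) '' Ioo (0 : ℝ) 1 = Ioo 0 ρ := by
    rw [image_mul_left_Ioo hρ]; simp
  have hd : ∀ s ∈ Ioo (0 : ℝ) 1, HasDerivWithinAt (fun s => ρ * s) ρ (Ioo 0 1) s := fun s _ => by
    simpa using ((hasDerivAt_id s).const_mul ρ).hasDerivWithinAt
  have h := lintegral_image_eq_lintegral_abs_deriv_mul measurableSet_Ioo hd
    (fun s _ t _ hst => mul_left_cancel₀ hρ.ne' hst) f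
  rw [himg, abs_of_pos hρ] at h
  exact h

/-- The substitution `r = ρ / s` maps `(0, 1)` onto `(ρ, ∞)` and turns `s⁻³ ρ² ds` into `r dr`; the
range is then enlarged to the half-line. -/
lemma setLIntegral_Ioo_inversion_le {ρ : ℝ} (hρ : 0 ≤ ρ) (K : ℝ → ℝ≥0∞) :
    ∫⁻ s in Ioo (0 : ℝ) 1, ENNReal.ofReal ((s ^ 3)⁻¹ * ρ ^ 2) * K (ρ / s) ≤
      ∫⁻ r in Ioi (0 : ℝ), K r * ENNReal.ofReal r := by
  rcases hρ.eq_or_lt with rfl | hρ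
  · simp
  have himg : (fun r => ρ / r) '' Ioi ρ = Ioo (0 : ℝ) 1 := by
    ext s
    constructor
    · rintro ⟨r, hr, rfl⟩
      have hr0 : 0 < r := hρ.trans hr
      exact ⟨by positivity, (div_lt_one hr0).2 hr⟩
    · intro hs
      refine ⟨ρ / s, ?_, ?_⟩
      · rw [mem_Ioi, lt_div_iff₀ hs.1]
        exact mul_lt_of_lt_one_right hρ hs.2
      · have := hs.1.ne'
        field_simp
  have hd : ∀ r ∈ Ioi ρ, HasDerivWithinAt (fun r => ρ / r) (-ρ / r ^ 2) (Ioi ρ) r := by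
    intro r hr
    have hr0 : r ≠ 0 := (hρ.trans hr).ne'
    have := ((hasDerivAt_inv hr0).const_mul ρ).hasDerivWithinAt (s := Ioi ρ)
    simpa [div_eq_mul_inv] using this
  have hinj : InjOn (fun r => ρ / r) (Ioi ρ) := by
    intro r hr t ht h
    have hr0 : r ≠ 0 := (hρ.trans hr).ne'
    have ht0 : t ≠ 0 := (hρ.trans ht).ne'
    simp only at h
    field_simp at h
    exact h.symm
  rw [← himg, lintegral_image_eq_lintegral_abs_deriv_mul measurableSet_Ioi hd hinj]
  refine le_trans (le_of_eq ?_) (lintegral_mono_set (Ioi_subset_Ioi hρ.le))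
  refine setLIntegral_congr_fun measurableSet_Ioi fun r hr => ?_
  have hr0 : 0 < r := hρ.trans hr
  rw [← mul_assoc, ← ENNReal.ofReal_mul (abs_nonneg _), mul_comm]
  have e1 : ρ / (ρ / r) = r := by field_simp
  have e2 : |-ρ / r ^ 2| * (((ρ / r) ^ 3)⁻¹ * ρ ^ 2) = r := by
    rw [abs_div, abs_neg, abs_of_pos hρ, abs_of_pos (by positivity)]
    field_simp
  rw [e1, e2]

/-! ### The distance of two particles -/

lemma measurable_dist_pair (i j : Fin N) : Measurable fun x : Config N => dist (x i) (x j) := by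
  fun_prop

/-- Null sets of distances give null sets of configurations. -/
lemma ae_dist_pair (hij : j ≠ i) {P : ℝ → Prop} (h : ∀ᵐ r, P r) :
    ∀ᵐ x : Config N, P (dist (x i) (x j)) := by
  -- The exceptional set need not be measurable, so a measurable null set containing it is used.
  set T := toMeasurable volume {r | ¬ P r} with hT
  have hTm : MeasurableSet T := measurableSet_toMeasurable _ _
  have hT0 : volume T = 0 := by rw [hT, measure_toMeasurable]; exact h
  have hm : Measurable (T.indicator (1 : ℝ → ℝ≥0∞)) := measurable_one.indicator hTm
  have h0 : ∫⁻ x : Config N, T.indicator 1 (dist (x i) (x j)) = 0 := by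
    rw [← lintegral_zero (μ := (volume : Measure (Config N)))]
    refine lintegral_eq_of_lmarginal_eq (μ := fun _ : Fin N => (volume : Measure Plane)) {i}
      (hm.comp (measurable_dist_pair i j)) measurable_zero ?_
    ext x
    rw [lmarginal_singleton, lmarginal_singleton]
    simp only [Function.update_self, Function.update_of_ne hij, lintegral_zero]
    have e : ∀ t : Plane, T.indicator (1 : ℝ → ℝ≥0∞) (dist t (x j)) =
        T.indicator (1 : ℝ → ℝ≥0∞) ‖t - x j‖ := fun t => by rw [dist_eq_norm]
    simp only [e]
    rw [lintegral_sub_right_eq_self (fun t : Plane => T.indicator (1 : ℝ → ℝ≥0∞) ‖t‖) (x j),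
      lintegral_plane_radial hm]
    have : ∫⁻ r in Ioi (0 : ℝ), T.indicator 1 r * ENNReal.ofReal r = 0 := by
      rw [lintegral_eq_zero_iff (by fun_prop)]
      refine ae_restrict_of_ae ?_
      filter_upwards [measure_eq_zero_iff_ae_notMem.1 hT0] with r hr
      simp [indicator_of_notMem hr]
    rw [this, mul_zero]
  filter_upwards [(lintegral_eq_zero_iff (hm.comp (measurable_dist_pair i j))).1 h0] with x hx
  by_contra hn
  have : dist (x i) (x j) ∈ T := subset_toMeasurable _ _ hn
  simp [indicator_of_mem this] at hx

/-! ### The pointwise bound along rays -/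

/-- The energy density attributed to particle `i` from its interaction with particle `j`. -/
def pairDensity (μ : ℝ) (v : ℝ → ℝ≥0∞) (Ψ : Config N → ℂ) (G : Fin N × Fin 2 → Config N → ℂ)
    (i j : Fin N) (x : Config N) : ℝ≥0∞ :=
  ENNReal.ofReal μ * ∑ k, ‖G (i, k) x‖ₑ ^ 2 + 2⁻¹ * v (dist (x i) (x j)) * ‖Ψ x‖ₑ ^ 2

lemma measurable_pairDensity {μ : ℝ} {v : ℝ → ℝ≥0∞} (hv : Measurable v) {Ψ : Config N → ℂ}
    (hΨ : Measurable Ψ) {G : Fin N × Fin 2 → Config N → ℂ} (hG : ∀ k, Measurable (G (i, k))) :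
    Measurable (pairDensity μ v Ψ G i j) := by
  have h := hv.comp (measurable_dist_pair i j)
  have h2 : Measurable fun x => ∑ k, ‖G (i, k) x‖ₑ ^ 2 :=
    Finset.measurable_sum _ fun k _ => ((hG k).enorm).pow_const 2
  exact (h2.const_mul _).add ((h.const_mul _).mul (hΨ.enorm.pow_const 2))

lemma norm_rayDeriv_sq_le (G : Fin N × Fin 2 → Config N → ℂ) (x : Config N) (s : ℝ) :
    ‖rayDeriv i j G x s‖ₑ ^ 2 ≤
      ENNReal.ofReal (dist (x i) (x j) ^ 2) * ∑ k, ‖G (i, k) (dilate i j s x)‖ₑ ^ 2 := by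
  have h : ‖rayDeriv i j G x s‖ ^ 2 ≤
      dist (x i) (x j) ^ 2 * ∑ k, ‖G (i, k) (dilate i j s x)‖ ^ 2 := by
    rw [dist_eq_norm, EuclideanSpace.norm_sq_eq]
    refine le_trans ?_ (Finset.sum_mul_sq_le_sq_mul_sq _ _ _)
    gcongr
    refine (norm_sum_le _ _).trans (le_of_eq (Finset.sum_congr rfl fun k _ => ?_))
    rw [norm_mul, Complex.norm_real]
  have h' := ENNReal.ofReal_le_ofReal h
  rw [ENNReal.ofReal_mul (by positivity), ENNReal.ofReal_sum_of_nonneg (fun _ _ => by positivity)] at h'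
  simpa only [ENNReal.ofReal_pow (norm_nonneg _), ofReal_norm] using h'

/-- Along one ray, `Ψ` is read as the radial function with slope `p(r) = ρ⁻¹ rayDeriv(r/ρ)` and
value `Ψ x` at `ρ`. The radial inequality applies ray by ray, without angular averaging, and `r = ρ
s` gives the weight `ρ² s ds`. -/
lemma le_of_radial_bound {μ a R₀ : ℝ} (hμ : 0 < μ) (hR₀ : 0 ≤ R₀) {v : ℝ → ℝ≥0∞}
    (hv_meas : Measurable v) (hv : ∀ r, R₀ < r → v r = 0) (hsc : IsScatteringLength μ v R₀ a)
    (ha : a ≠ 0) (haR : a ≤ R₀) (hij : j ≠ i) {Ψ : Config N → ℂ} {G : Fin N × Fin 2 → Config N → ℂ}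
    (hGm : ∀ k, Measurable (G (i, k))) {x : Config N} (hx : R₀ < dist (x i) (x j))
    (hray : ∀ᵐ τ ∂(volume.restrict (Ioo (0 : ℝ) 1)),
      Ψ x - Ψ (dilate i j τ x) - ∫ s in Ioc τ 1, rayDeriv i j G x s = 0) :
    ENNReal.ofReal μ * ‖Ψ x‖ₑ ^ 2 ≤ logRatio (dist (x i) (x j)) a *
      ∫⁻ s in Ioo (0 : ℝ) 1, pairDensity μ v Ψ G i j (dilate i j s x) *
        ENNReal.ofReal (dist (x i) (x j) ^ 2 * s) := by
  set ρ := dist (x i) (x j) with hρ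
  have hρ0 : 0 < ρ := hR₀.trans_lt hx
  set I := ∫⁻ s in Ioo (0 : ℝ) 1, pairDensity μ v Ψ G i j (dilate i j s x) *
        ENNReal.ofReal (ρ ^ 2 * s) with hI
  -- Infinite energy on the ray makes the right side infinite, since `ln(ρ/a) > 0`; otherwise the
  -- slope has finite energy.
  rcases eq_or_ne I ⊤ with htop | htop
  · rw [htop, ENNReal.mul_top]
    · exact le_top
    · have ha0 : 0 < a := lt_of_le_of_ne hsc.1 ha.symm
      rw [logRatio, if_neg ha]
      simpa using Real.log_pos ((one_lt_div ha0).2 (haR.trans_lt hx))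
  let p : ℝ → ℂ := (Ioo 0 ρ).indicator fun r => ((ρ⁻¹ : ℝ) : ℂ) * rayDeriv i j G x (ρ⁻¹ * r)
  have hrm : Measurable (rayDeriv i j G x) :=
    Measurable.comp (g := fun z : Config N × ℝ => rayDeriv i j G z.1 z.2) (f := fun s => (x, s))
      (measurable_rayDeriv hGm) measurable_prodMk_left
  have hpm : Measurable p := Measurable.indicator (by fun_prop) measurableSet_Ioo
  have hps : ∀ s ∈ Ioo (0 : ℝ) 1, p (ρ * s) = ((ρ⁻¹ : ℝ) : ℂ) * rayDeriv i j G x s := by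
    intro s hs
    have : ρ * s ∈ Ioo 0 ρ := ⟨by have := hs.1; positivity, mul_lt_of_lt_one_right hρ0 hs.2⟩
    simp only [p, indicator_of_mem this]
    rw [← mul_assoc, inv_mul_cancel₀ hρ0.ne', one_mul]
  have hpsq : ∀ s ∈ Ioo (0 : ℝ) 1, ‖p (ρ * s)‖ₑ ^ 2 ≤ ∑ k, ‖G (i, k) (dilate i j s x)‖ₑ ^ 2 := by
    intro s hs
    rw [hps s hs, enorm_mul, mul_pow, enorm_complex_ofReal, Real.enorm_of_nonneg (by positivity),
      ← ENNReal.ofReal_pow (by positivity)]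
    calc _ ≤ ENNReal.ofReal (ρ⁻¹ ^ 2) * (ENNReal.ofReal (ρ ^ 2) *
          ∑ k, ‖G (i, k) (dilate i j s x)‖ₑ ^ 2) := by gcongr; exact norm_rayDeriv_sq_le G x s
      _ = _ := by
          rw [← mul_assoc, ← ENNReal.ofReal_mul (by positivity), ← mul_pow,
            inv_mul_cancel₀ hρ0.ne']
          simp
  have hweight : ∀ s : ℝ, ENNReal.ofReal ρ * ENNReal.ofReal (ρ * s) = ENNReal.ofReal (ρ ^ 2 * s) := by
    intro s
    rw [← ENNReal.ofReal_mul hρ0.le]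
    congr 1; ring
  have hp : IsRadialSlope ρ p := by
    refine ⟨hpm, fun s hs => indicator_of_notMem hs _, ?_⟩
    rw [setLIntegral_Ioi_eq_Ioo (R := ρ) (fun s hs => by simp [p, indicator_of_notMem hs]),
      setLIntegral_Ioo_scale hρ0]
    have hle : ENNReal.ofReal μ * ∫⁻ s in Ioo (0 : ℝ) 1, ENNReal.ofReal ρ *
        (‖p (ρ * s)‖ₑ ^ 2 * ENNReal.ofReal (ρ * s)) ≤ I := by
      rw [hI, ← lintegral_const_mul' _ _ ENNReal.ofReal_ne_top]
      refine setLIntegral_mono' measurableSet_Ioo fun s hs => ?_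
      rw [mul_left_comm (ENNReal.ofReal ρ), hweight, ← mul_assoc, pairDensity]
      gcongr
      refine le_trans ?_ le_self_add
      gcongr
      exact hpsq s hs
    by_contra hcon
    rw [not_lt, top_le_iff] at hcon
    rw [hcon, ENNReal.mul_top (by simpa using hμ)] at hle
    exact htop (top_le_iff.1 hle)
  refine (hsc.le_radialEnergy hμ hR₀ hv_meas hv ha hx hp (Ψ x)).trans ?_
  gcongr
  rw [radialEnergy, setLIntegral_Ioo_scale hρ0, hI]
  refine lintegral_mono_ae ?_
  filter_upwards [hray, ae_restrict_mem measurableSet_Ioo] with s hs hsm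
  have h_int : ∫ r in Ioi (ρ * s), p r = ∫ t in Ioc s 1, rayDeriv i j G x t := by
    have h1 := integral_comp_mul_left_Ioi p s hρ0
    have h2 : ∫ t in Ioi s, p (ρ * t) =
        ∫ t in Ioc s 1, ((ρ⁻¹ : ℝ) : ℂ) * rayDeriv i j G x t := by
      rw [integral_Ioc_eq_integral_Ioo, ← integral_indicator measurableSet_Ioi,
        ← integral_indicator measurableSet_Ioo]
      congr 1; ext t
      by_cases ht : s < t
      · by_cases ht1 : t < 1
        · rw [indicator_of_mem (mem_Ioi.2 ht), indicator_of_mem (show t ∈ Ioo s 1 from ⟨ht, ht1⟩),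
            hps t ⟨hsm.1.trans ht, ht1⟩]
        · rw [indicator_of_mem (mem_Ioi.2 ht), indicator_of_notMem (fun h => ht1 h.2)]
          refine indicator_of_notMem (fun h => ht1 ?_) _
          exact (mul_lt_iff_lt_one_right hρ0).1 h.2
      · rw [indicator_of_notMem (by simpa using ht), indicator_of_notMem (fun h => ht h.1)]
    rw [h2, integral_const_mul, Complex.real_smul] at h1
    have hρc : (((ρ⁻¹ : ℝ)) : ℂ) ≠ 0 := by exact_mod_cast (inv_pos.2 hρ0).ne'
    exact (mul_left_cancel₀ hρc h1).symm
  have hval : Ψ x - ∫ r in Ioi (ρ * s), p r = Ψ (dilate i j s x) := by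
    rw [h_int]
    linear_combination hs
  rw [hval, mul_left_comm (ENNReal.ofReal ρ), hweight, pairDensity, dist_dilate hij hsm.1.le, ← hρ,
    mul_comm s ρ]
  gcongr
  exact hpsq s hsm

end

noncomputable section

variable {N : ℕ} {i j : Fin N}

/-! ### The bound for a pair of particles -/

lemma measurable_logRatio (a : ℝ) : Measurable fun r => logRatio r a := by
  unfold logRatio
  split_ifs
  · exact measurable_const
  · fun_prop

lemma measurable_setIntegral_rayDeriv {G : Fin N × Fin 2 → Config N → ℂ}
    (hGm : ∀ k, Measurable (G (i, k))) :
    Measurable fun z : ℝ × Config N => ∫ s in Ioc z.1 1, rayDeriv i j G z.2 s := by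
  have hm := measurable_rayDeriv (j := j) hGm
  let A : Set ((ℝ × Config N) × ℝ) := {z | z.1.1 < z.2 ∧ z.2 ≤ 1}
  have hA : MeasurableSet A :=
    (measurableSet_lt (f := fun z : (ℝ × Config N) × ℝ => z.1.1) (g := fun z => z.2)
      (by fun_prop) (by fun_prop)).inter
    (measurableSet_le (f := fun z : (ℝ × Config N) × ℝ => z.2) (g := fun _ => (1 : ℝ))
      (by fun_prop) (by fun_prop))
  have e : (fun z : ℝ × Config N => ∫ s in Ioc z.1 1, rayDeriv i j G z.2 s) =
      fun z => ∫ s, A.indicator (fun w => rayDeriv i j G w.1.2 w.2) (z, s) := by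
    ext z
    rw [← integral_indicator measurableSet_Ioc]
    rfl
  rw [e]
  refine StronglyMeasurable.measurable (StronglyMeasurable.integral_prod_right'
    (f := A.indicator fun w => rayDeriv i j G w.1.2 w.2) ?_)
  refine (Measurable.indicator ?_ hA).stronglyMeasurable
  exact Measurable.comp (g := fun z : Config N × ℝ => rayDeriv i j G z.1 z.2)
    (f := fun w : (ℝ × Config N) × ℝ => (w.1.2, w.2)) hm (by fun_prop)

/-- Almost every configuration lies on a ray along which `Ψ` is the integral of its radial
derivative. -/
lemma ae_ae_sub_dilate_eq {Λ : Set Plane} (hΛo : IsOpen Λ) (hΛc : Convex ℝ Λ) (hij : j ≠ i)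
    {Ψ : Config N → ℂ} (hΨm : Measurable Ψ) (hΨ : MemLp Ψ 2 volume)
    (hΨ0 : ∀ x, x ∉ configIn N Λ → Ψ x = 0) {G : Fin N × Fin 2 → Config N → ℂ}
    (hGm : ∀ k, Measurable (G (i, k))) (hG : ∀ k, MemLp (G (i, k)) 2 volume)
    (hG0 : ∀ k x, x ∉ configIn N Λ → G (i, k) x = 0)
    (hw : ∀ k, HasWeakDeriv (configIn N Λ) (configDir (i, k)) Ψ (G (i, k))) :
    ∀ᵐ x, x ∈ configIn N Λ → ∀ᵐ τ ∂(volume.restrict (Ioo (0 : ℝ) 1)),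
      Ψ x - Ψ (dilate i j τ x) - ∫ s in Ioc τ 1, rayDeriv i j G x s = 0 := by
  have hF : Measurable fun z : ℝ × Config N =>
      Ψ z.2 - Ψ (dilate i j z.1 z.2) - ∫ s in Ioc z.1 1, rayDeriv i j G z.2 s :=
    ((hΨm.comp measurable_snd).sub (hΨm.comp measurable_dilate)).sub
      (measurable_setIntegral_rayDeriv hGm)
  have hms : MeasurableSet {z : ℝ × Config N | z.2 ∈ configIn N Λ →
      Ψ z.2 - Ψ (dilate i j z.1 z.2) - ∫ s in Ioc z.1 1, rayDeriv i j G z.2 s = 0} := by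
    have h1 : MeasurableSet {z : ℝ × Config N | z.2 ∈ configIn N Λ} :=
      measurable_snd (isOpen_configIn hΛo).measurableSet
    have h2 := hF (measurableSet_singleton 0)
    simp only [imp_iff_not_or]
    exact h1.compl.union h2
  -- For each `τ` the exceptional set depends on `τ`; joint measurability and Fubini exchange the
  -- quantifiers to "almost every `x`, almost every `τ`".
  have h := (Measure.ae_ae_comm (μ := volume.restrict (Ioo (0 : ℝ) 1))
    (ν := (volume : Measure (Config N)))
    (p := fun τ x => x ∈ configIn N Λ →
      Ψ x - Ψ (dilate i j τ x) - ∫ s in Ioc τ 1, rayDeriv i j G x s = 0) hms).1 (by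
      filter_upwards [ae_restrict_mem measurableSet_Ioo] with τ hτ
      exact ae_sub_dilate_eq hΛo hΛc hij hΨm hΨ hΨ0 hGm hG hG0 hw hτ.1 hτ.2)
  filter_upwards [h] with x hx hxΛ
  filter_upwards [hx] with τ hτ using hτ hxΛ

/-- The energy at a point is charged by all points farther out on its ray. For fixed `s`, substitute
`y = dilate i j s x`; the integral over `s` then becomes `∫ K(r) r dr` over `r > |y_i - y_j|`, so
the total charge at `y` is at most `1`. -/
lemma lintegral_dilate_weight_le (hij : j ≠ i) {K : ℝ → ℝ≥0∞} (hK : Measurable K)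
    (hK1 : ∫⁻ r in Ioi (0 : ℝ), K r * ENNReal.ofReal r ≤ 1) {e : Config N → ℝ≥0∞}
    (he : Measurable e) :
    ∫⁻ x, ∫⁻ s in Ioo (0 : ℝ) 1, K (dist (x i) (x j)) * (e (dilate i j s x) *
      ENNReal.ofReal (dist (x i) (x j) ^ 2 * s)) ≤ ∫⁻ x, e x := by
  have hd := measurable_dist_pair i j
  have hdil := measurable_dilate (i := i) (j := j)
  have hm1 : Measurable fun z : Config N × ℝ => K (dist (z.1 i) (z.1 j)) *
      (e (dilate i j z.2 z.1) * ENNReal.ofReal (dist (z.1 i) (z.1 j) ^ 2 * z.2)) := by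
    have h1 : Measurable fun z : Config N × ℝ => dist (z.1 i) (z.1 j) := hd.comp measurable_fst
    have h2 : Measurable fun z : Config N × ℝ => e (dilate i j z.2 z.1) :=
      he.comp (hdil.comp measurable_swap)
    fun_prop
  have hm2 : Measurable fun z : Config N × ℝ => ENNReal.ofReal ((z.2 ^ 3)⁻¹ * dist (z.1 i) (z.1 j) ^ 2) *
      K (dist (z.1 i) (z.1 j) / z.2) := by
    have h1 : Measurable fun z : Config N × ℝ => dist (z.1 i) (z.1 j) := hd.comp measurable_fst
    fun_prop
  rw [lintegral_lintegral_swap hm1.aemeasurable]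
  calc ∫⁻ s in Ioo (0 : ℝ) 1, ∫⁻ x, K (dist (x i) (x j)) * (e (dilate i j s x) *
        ENNReal.ofReal (dist (x i) (x j) ^ 2 * s))
      = ∫⁻ s in Ioo (0 : ℝ) 1, ∫⁻ x, e x * (ENNReal.ofReal ((s ^ 3)⁻¹ * dist (x i) (x j) ^ 2) *
          K (dist (x i) (x j) / s)) := by
        refine setLIntegral_congr_fun measurableSet_Ioo fun s hs => ?_
        have hs0 := hs.1
        have hf : Measurable fun x : Config N => K (dist (x i) (x j) / s) * (e x *
            ENNReal.ofReal ((dist (x i) (x j) / s) ^ 2 * s)) := by fun_prop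
        have h := lintegral_dilate hij hs0 hf
        simp only [dist_dilate hij hs0.le, mul_div_cancel_left₀ _ hs0.ne'] at h
        beta_reduce
        rw [h, ← lintegral_const_mul _ hf]
        congr 1; ext x
        have e1 : ENNReal.ofReal ((s ^ 3)⁻¹ * dist (x i) (x j) ^ 2) =
            ENNReal.ofReal (s ^ 2)⁻¹ * ENNReal.ofReal ((dist (x i) (x j) / s) ^ 2 * s) := by
          rw [← ENNReal.ofReal_mul (by positivity)]
          congr 1
          field_simp
        rw [e1]; ring
    _ = ∫⁻ x, ∫⁻ s in Ioo (0 : ℝ) 1, e x * (ENNReal.ofReal ((s ^ 3)⁻¹ * dist (x i) (x j) ^ 2) *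
          K (dist (x i) (x j) / s)) :=
        (lintegral_lintegral_swap ((he.comp measurable_fst).mul hm2).aemeasurable).symm
    _ ≤ ∫⁻ x, e x := by
        refine lintegral_mono fun x => ?_
        have hm3 : Measurable fun s : ℝ => ENNReal.ofReal ((s ^ 3)⁻¹ * dist (x i) (x j) ^ 2) *
          K (dist (x i) (x j) / s) := by fun_prop
        rw [lintegral_const_mul _ hm3]
        refine mul_le_of_le_one_right (by simp) ?_
        exact (setLIntegral_Ioo_inversion_le dist_nonneg K).trans hK1

/-- The energy in a region that is star-shaped with respect to particle `j` bounds the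
potential `U` of the distance to particle `j`. -/
theorem pair_bound {μ a R₀ : ℝ} (hμ : 0 < μ) (hR₀ : 0 ≤ R₀) {v : ℝ → ℝ≥0∞}
    (hv_meas : Measurable v) (hv : ∀ r, R₀ < r → v r = 0) (hsc : IsScatteringLength μ v R₀ a)
    {U : ℝ → ℝ≥0∞} (hU_meas : Measurable U)
    (hU_int : ∫⁻ r in Ioi (0 : ℝ), U r * logRatio r a * ENNReal.ofReal r ≤ 1)
    (hU_zero : ∀ r, r < R₀ → U r = 0)
    {Λ : Set Plane} (hΛo : IsOpen Λ) (hΛc : Convex ℝ Λ) (hij : j ≠ i)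
    {Ψ : Config N → ℂ} (hΨm : Measurable Ψ) (hΨ : MemLp Ψ 2 volume)
    (hΨ0 : ∀ x, x ∉ configIn N Λ → Ψ x = 0) {G : Fin N × Fin 2 → Config N → ℂ}
    (hGm : ∀ k, Measurable (G (i, k))) (hG : ∀ k, MemLp (G (i, k)) 2 volume)
    (hG0 : ∀ k x, x ∉ configIn N Λ → G (i, k) x = 0)
    (hw : ∀ k, HasWeakDeriv (configIn N Λ) (configDir (i, k)) Ψ (G (i, k)))
    {S : Set (Config N)} (hS : MeasurableSet S) (hSΛ : S ⊆ configIn N Λ)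
    (hstar : ∀ x ∈ S, ∀ s : ℝ, 0 < s → s ≤ 1 → dilate i j s x ∈ S) :
    ENNReal.ofReal μ * ∫⁻ x in S, U (dist (x i) (x j)) * ‖Ψ x‖ₑ ^ 2 ≤
      ∫⁻ x in S, pairDensity μ v Ψ G i j x := by
  have hd := measurable_dist_pair i j
  have hUd : Measurable fun x : Config N => U (dist (x i) (x j)) := hU_meas.comp hd
  -- For `a = 0` the weight `logRatio` is infinite, so a finite integral forces `U = 0` almost
  -- everywhere on `(0, ∞)` and the left side vanishes.
  rcases eq_or_ne a 0 with rfl | ha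
  · have hU0 : ∀ᵐ r : ℝ, 0 < r → U r = 0 := by
      have hm : Measurable fun r => U r * logRatio r 0 * ENNReal.ofReal r :=
        (hU_meas.mul (measurable_logRatio 0)).mul (by fun_prop)
      have h1 := ae_lt_top hm (hU_int.trans_lt ENNReal.one_lt_top).ne
      rw [ae_restrict_iff' measurableSet_Ioi] at h1
      filter_upwards [h1] with r hr hr0
      have h2 := hr hr0
      by_contra hne
      simp only [logRatio, if_true] at h2
      rw [ENNReal.mul_top hne, ENNReal.top_mul (by simpa using hr0)] at h2
      exact lt_irrefl _ h2
    have hz : ∀ᵐ x : Config N, U (dist (x i) (x j)) = 0 := by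
      filter_upwards [ae_dist_pair hij hU0, ae_dist_pair hij (Measure.ae_ne volume (0 : ℝ))] with x h1 h2
      exact h1 (lt_of_le_of_ne dist_nonneg h2.symm)
    have : ∫⁻ x in S, U (dist (x i) (x j)) * ‖Ψ x‖ₑ ^ 2 = 0 := by
      rw [lintegral_eq_zero_iff (by fun_prop)]
      refine ae_restrict_of_ae ?_
      filter_upwards [hz] with x hx
      simp [hx]
    rw [this, mul_zero]
    exact bot_le
  have haR : a ≤ R₀ := by
    obtain ⟨ha0, R, hR, φ, hφ, hprof⟩ := hsc
    exact hφ.le_range hμ hR₀ hR hv_meas hv (lt_of_le_of_ne ha0 ha.symm) hprof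
  have hem := measurable_pairDensity (i := i) (j := j) (μ := μ) hv_meas hΨm hGm
  have hK : Measurable fun r => U r * logRatio r a := hU_meas.mul (measurable_logRatio a)
  rw [← lintegral_const_mul _ (by fun_prop)]
  calc ∫⁻ x in S, ENNReal.ofReal μ * (U (dist (x i) (x j)) * ‖Ψ x‖ₑ ^ 2)
      ≤ ∫⁻ x in S, ∫⁻ s in Ioo (0 : ℝ) 1, U (dist (x i) (x j)) * logRatio (dist (x i) (x j)) a *
          (S.indicator (pairDensity μ v Ψ G i j) (dilate i j s x) *
            ENNReal.ofReal (dist (x i) (x j) ^ 2 * s)) := by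
        refine lintegral_mono_ae ?_
        refine (ae_restrict_iff' hS).2 ?_
        filter_upwards [ae_ae_sub_dilate_eq hΛo hΛc hij hΨm hΨ hΨ0 hGm hG hG0 hw,
          ae_dist_pair hij (Measure.ae_ne volume R₀)] with x hray hne hxS
        -- Below `R₀` the potential `U` vanishes; the distance `R₀` itself, where `U` may be
        -- nonzero, was discarded as a null set.
        rcases lt_or_gt_of_ne hne with hlt | hgt
        · simp [hU_zero _ hlt]
        · have h1 := le_of_radial_bound hμ hR₀ hv_meas hv hsc ha haR hij hGm hgt (hray (hSΛ hxS))
          have hm : Measurable fun s : ℝ => S.indicator (pairDensity μ v Ψ G i j) (dilate i j s x) *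
              ENNReal.ofReal (dist (x i) (x j) ^ 2 * s) := by
            have h2 : Measurable fun s : ℝ => dilate i j s x :=
              (continuous_dilate.comp (Continuous.prodMk_left x)).measurable
            exact ((hem.indicator hS).comp h2).mul (by fun_prop)
          rw [lintegral_const_mul _ hm, mul_left_comm, mul_assoc (U _)]
          refine mul_le_mul' le_rfl (h1.trans (le_of_eq ?_))
          congr 1
          -- Star-shapedness keeps the whole inner ray in `S`, so only energy located in `S` is
          -- charged.
          refine setLIntegral_congr_fun measurableSet_Ioo fun s hs => ?_
          simp only [indicator_of_mem (hstar x hxS s hs.1 hs.2.le)]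
    _ ≤ ∫⁻ x, ∫⁻ s in Ioo (0 : ℝ) 1, U (dist (x i) (x j)) * logRatio (dist (x i) (x j)) a *
          (S.indicator (pairDensity μ v Ψ G i j) (dilate i j s x) *
            ENNReal.ofReal (dist (x i) (x j) ^ 2 * s)) := setLIntegral_le_lintegral _ _
    _ ≤ ∫⁻ x, S.indicator (pairDensity μ v Ψ G i j) x :=
        lintegral_dilate_weight_le hij hK hU_int (hem.indicator hS)
    _ = ∫⁻ x in S, pairDensity μ v Ψ G i j x := lintegral_indicator hS _

end

noncomputable section

variable {N : ℕ} {i j : Fin N}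

/-! ### Decomposition according to the nearest neighbour -/

/-- The configurations in `Λ` for which `j` is the nearest neighbour of `i`; ties are broken in
favour of the smallest index. -/
def nearestCell (Λ : Set Plane) (i j : Fin N) : Set (Config N) :=
  {x | x ∈ configIn N Λ ∧ ∀ k, k ≠ i → dist (x i) (x j) ≤ dist (x i) (x k) ∧
    (k < j → dist (x i) (x j) < dist (x i) (x k))}

lemma nearestCell_subset {Λ : Set Plane} : nearestCell Λ i j ⊆ configIn N Λ := fun _ hx => hx.1

lemma measurableSet_nearestCell {Λ : Set Plane} (hΛ : IsOpen Λ) :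
    MeasurableSet (nearestCell Λ i j) := by
  have e : nearestCell Λ i j = configIn N Λ ∩ ⋂ k, ⋂ (_ : k ≠ i),
      ({x : Config N | dist (x i) (x j) ≤ dist (x i) (x k)} ∩
        ⋂ (_ : k < j), {x : Config N | dist (x i) (x j) < dist (x i) (x k)}) := by
    ext x
    simp [nearestCell]
  rw [e]
  refine (isOpen_configIn hΛ).measurableSet.inter ?_
  refine MeasurableSet.iInter fun k => MeasurableSet.iInter fun _ => ?_
  exact (measurableSet_le (measurable_dist_pair i j) (measurable_dist_pair i k)).inter
    (MeasurableSet.iInter fun _ =>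
      measurableSet_lt (measurable_dist_pair i j) (measurable_dist_pair i k))

lemma disjoint_nearestCell {Λ : Set Plane} {k : Fin N} (hj : j ≠ i) (hk : k ≠ i) (hjk : j ≠ k) :
    Disjoint (nearestCell Λ i j) (nearestCell Λ i k) := by
  rw [Set.disjoint_left]
  intro x hx hx2
  rcases lt_or_gt_of_ne hjk with h | h
  · exact absurd ((hx2.2 j hj).2 h) (not_lt.2 (hx.2 k hk).1)
  · exact absurd ((hx.2 k hk).2 h) (not_lt.2 (hx2.2 j hj).1)

lemma iUnion_nearestCell (hN : 2 ≤ N) (Λ : Set Plane) (i : Fin N) :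
    ⋃ j ∈ ({i}ᶜ : Finset (Fin N)), nearestCell Λ i j = configIn N Λ := by
  refine Subset.antisymm (iUnion₂_subset fun _ _ => nearestCell_subset) fun x hx => ?_
  have hne : ({i}ᶜ : Finset (Fin N)).Nonempty := by
    rw [← Finset.card_pos, Finset.card_compl, Fintype.card_fin, Finset.card_singleton]
    omega
  -- Minimising the pair (distance, index) lexicographically implements the tie-breaking rule.
  obtain ⟨j, hj, hmin⟩ := Finset.exists_min_image _ (fun k => toLex (dist (x i) (x k), k)) hne
  refine mem_iUnion₂.2 ⟨j, hj, hx, fun k hk => ?_⟩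
  have h := hmin k (by simpa using hk)
  rw [Prod.Lex.toLex_le_toLex] at h
  rcases h with h | ⟨h1, h2⟩
  · exact ⟨h.le, fun _ => h⟩
  · exact ⟨h1.le, fun hkj => absurd hkj (not_lt.2 h2)⟩

lemma nearestDist_eq_of_mem_nearestCell {Λ : Set Plane} (hij : j ≠ i) {x : Config N}
    (hx : x ∈ nearestCell Λ i j) : nearestDist x i = dist (x i) (x j) := by
  have : Nonempty {k : Fin N // k ≠ i} := ⟨⟨j, hij⟩⟩
  refine le_antisymm ?_ (le_ciInf fun k => (hx.2 k.1 k.2).1)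
  exact ciInf_le (f := fun k : {k : Fin N // k ≠ i} => dist (x i) (x k))
    (Set.finite_range _).bddBelow ⟨j, hij⟩

/-- Moving `i` towards `j` by a length `d` lowers its distance to `j` by exactly `d`, and to any
other particle by at most `d`. Both the weak and the strict comparisons therefore survive. -/
lemma dilate_mem_nearestCell {Λ : Set Plane} (hΛ : Convex ℝ Λ) (hij : j ≠ i) {x : Config N}
    (hx : x ∈ nearestCell Λ i j) {s : ℝ} (hs : 0 < s) (hs1 : s ≤ 1) :
    dilate i j s x ∈ nearestCell Λ i j := by
  have hmove : dist (x i) (dilate i j s x i) = (1 - s) * dist (x i) (x j) := by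
    rw [dilate_apply_self, dist_eq_norm, dist_eq_norm, ← abs_of_nonneg (sub_nonneg.2 hs1),
      ← Real.norm_eq_abs, ← norm_smul]
    congr 1
    module
  have key : ∀ k, k ≠ i → dist (x i) (x k) - (1 - s) * dist (x i) (x j) ≤
      dist (dilate i j s x i) (dilate i j s x k) := fun k hk => by
    rw [dilate_apply_of_ne _ _ hk, ← hmove, sub_le_iff_le_add']
    exact dist_triangle _ _ _
  refine ⟨dilate_mem_configIn hΛ hx.1 hs.le hs1, fun k hk => ?_⟩
  rw [dist_dilate hij hs.le]
  have h1 := hx.2 k hk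
  refine ⟨by linarith [key k hk, h1.1], fun hkj => by linarith [key k hk, h1.2 hkj]⟩

/-- An integral over all configurations is the sum of the integrals over the cells. -/
lemma sum_setLIntegral_nearestCell (hN : 2 ≤ N) {Λ : Set Plane} (hΛ : IsOpen Λ) (i : Fin N)
    (f : Config N → ℝ≥0∞) :
    ∑ j ∈ ({i}ᶜ : Finset (Fin N)), ∫⁻ x in nearestCell Λ i j, f x =
      ∫⁻ x in configIn N Λ, f x := by
  rw [← iUnion_nearestCell hN Λ i, lintegral_biUnion_finset]
  · intro j hj k hk hjk
    exact disjoint_nearestCell (by simpa using hj) (by simpa using hk) hjk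
  · exact fun _ _ => measurableSet_nearestCell hΛ

/-- Each pair occurs in two orders, so the halves of `v` charged to its two particles add up to the
full interaction. -/
lemma two_inv_sum_off_diag (v : ℝ → ℝ≥0∞) (x : Config N) :
    ∑ i, ∑ j ∈ ({i}ᶜ : Finset (Fin N)), 2⁻¹ * v (dist (x i) (x j)) = pairPotential v x := by
  have h := Finset.sum_sum_Ioi_add_eq_sum_sum_off_diag
    (fun i j : Fin N => 2⁻¹ * v (dist (x j) (x i)))
  rw [← h, pairPotential]
  refine Finset.sum_congr rfl fun i _ => Finset.sum_congr rfl fun j _ => ?_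
  rw [dist_comm (x j) (x i), ← add_mul, ENNReal.inv_two_add_inv_two, one_mul]

/-- Every square integrable function with a weak gradient has measurable representatives of both
that vanish outside the domain. -/
lemma IsWeakGradient.exists_measurable {E ι : Type*} [NormedAddCommGroup E] [NormedSpace ℝ E]
    [MeasureSpace E] {b : ι → E} {Ω : Set E} (hΩ : MeasurableSet Ω) {f : E → ℂ} {G : ι → E → ℂ}
    (hf : MemLp f 2 (volume.restrict Ω)) (hG : IsWeakGradient b Ω f G) :
    ∃ (f₁ : E → ℂ) (G₁ : ι → E → ℂ), f₁ =ᵐ[volume.restrict Ω] f ∧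
      (∀ k, G₁ k =ᵐ[volume.restrict Ω] G k) ∧
      Measurable f₁ ∧ MemLp f₁ 2 volume ∧ (∀ x, x ∉ Ω → f₁ x = 0) ∧
      ∀ k, Measurable (G₁ k) ∧ MemLp (G₁ k) 2 volume ∧ (∀ x, x ∉ Ω → G₁ k x = 0) ∧
        HasWeakDeriv Ω (b k) f₁ (G₁ k) := by
  have rep : ∀ h : E → ℂ, MemLp h 2 (volume.restrict Ω) → ∃ h₁ : E → ℂ,
      h₁ =ᵐ[volume.restrict Ω] h ∧ Measurable h₁ ∧ MemLp h₁ 2 volume ∧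
        ∀ x, x ∉ Ω → h₁ x = 0 := by
    intro h hh
    have hae : Ω.indicator (hh.1.mk h) =ᵐ[volume.restrict Ω] h := by
      filter_upwards [hh.1.ae_eq_mk, ae_restrict_mem hΩ] with x hx hxΩ
      rw [indicator_of_mem hxΩ, hx]
    refine ⟨Ω.indicator (hh.1.mk h), hae, hh.1.stronglyMeasurable_mk.measurable.indicator hΩ, ?_,
      fun x hx => indicator_of_notMem hx _⟩
    exact (memLp_indicator_iff_restrict hΩ).2 ((memLp_congr_ae hh.1.ae_eq_mk).1 hh)
  obtain ⟨f₁, hf1, hf2, hf3, hf4⟩ := rep f hf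
  choose G₁ hG1 hG2 hG3 hG4 using fun k => rep (G k) (hG k).1
  refine ⟨f₁, G₁, hf1, hG1, hf2, hf3, hf4, fun k => ⟨hG2 k, hG3 k, hG4 k, ?_⟩⟩
  intro η h1 h2 h3
  have e1 : ∫ x in Ω, f₁ x * ((fderiv ℝ η x (b k) : ℝ) : ℂ) =
      ∫ x in Ω, f x * ((fderiv ℝ η x (b k) : ℝ) : ℂ) :=
    integral_congr_ae (by filter_upwards [hf1] with x hx; rw [hx])
  have e2 : ∫ x in Ω, G₁ k x * ((η x : ℝ) : ℂ) = ∫ x in Ω, G k x * ((η x : ℝ) : ℂ) :=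
    integral_congr_ae (by filter_upwards [hG1 k] with x hx; rw [hx])
  rw [e1, e2]
  exact (hG k).2 η h1 h2 h3

lemma potentialForm_congr {Λ : Set Plane} {F : Config N → ℝ≥0∞} {Ψ Φ : Config N → ℂ}
    (h : Φ =ᵐ[volume.restrict (configIn N Λ)] Ψ) :
    potentialForm N Λ F Φ = potentialForm N Λ F Ψ :=
  lintegral_congr_ae (by filter_upwards [h] with x hx; rw [hx])

/-- The lower bound for measurable wave functions that vanish outside `Λ^N`. -/
lemma nearestNeighbour_le_of_measurable (hN : 2 ≤ N) {μ a R₀ : ℝ} (hμ : 0 < μ) (hR₀ : 0 ≤ R₀)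
    {v : ℝ → ℝ≥0∞} (hv_meas : Measurable v) (hv : ∀ r, R₀ < r → v r = 0)
    (hsc : IsScatteringLength μ v R₀ a) {U : ℝ → ℝ≥0∞} (hU_meas : Measurable U)
    (hU_int : ∫⁻ r in Ioi (0 : ℝ), U r * logRatio r a * ENNReal.ofReal r ≤ 1)
    (hU_zero : ∀ r, r < R₀ → U r = 0)
    {Λ : Set Plane} (hΛo : IsOpen Λ) (hΛc : Convex ℝ Λ)
    {Ψ : Config N → ℂ} (hΨm : Measurable Ψ) (hΨ : MemLp Ψ 2 volume)
    (hΨ0 : ∀ x, x ∉ configIn N Λ → Ψ x = 0) {G : Fin N × Fin 2 → Config N → ℂ}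
    (hG : ∀ p, Measurable (G p) ∧ MemLp (G p) 2 volume ∧
      (∀ x, x ∉ configIn N Λ → G p x = 0) ∧ HasWeakDeriv (configIn N Λ) (configDir p) Ψ (G p)) :
    ENNReal.ofReal μ * potentialForm N Λ (nearestNeighbour U) Ψ ≤
      ENNReal.ofReal μ * (∫⁻ x in configIn N Λ, ∑ p, ‖G p x‖ₑ ^ 2) +
        potentialForm N Λ (pairPotential v) Ψ := by
  have hGm : ∀ p, Measurable (G p) := fun p => (hG p).1
  have hvd : ∀ i j, Measurable fun x : Config N => 2⁻¹ * v (dist (x i) (x j)) * ‖Ψ x‖ₑ ^ 2 :=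
    fun i j => ((hv_meas.comp (measurable_dist_pair i j)).const_mul _).mul
      (hΨm.enorm.pow_const 2)
  have hUn : ∀ i, ∫⁻ x in configIn N Λ, U (nearestDist x i) * ‖Ψ x‖ₑ ^ 2 =
      ∑ j ∈ ({i}ᶜ : Finset (Fin N)),
        ∫⁻ x in nearestCell Λ i j, U (dist (x i) (x j)) * ‖Ψ x‖ₑ ^ 2 := fun i => by
    rw [← sum_setLIntegral_nearestCell hN hΛo i]
    refine Finset.sum_congr rfl fun j hj => ?_
    refine setLIntegral_congr_fun (measurableSet_nearestCell hΛo) fun x hx => ?_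
    simp only [nearestDist_eq_of_mem_nearestCell (by simpa using hj) hx]
  have hnd : ∀ i : Fin N, Measurable fun x : Config N => nearestDist x i := fun i =>
    Measurable.iInf fun j => measurable_dist_pair i j
  have hpair : ∀ i, ∀ j ∈ ({i}ᶜ : Finset (Fin N)),
      ENNReal.ofReal μ * ∫⁻ x in nearestCell Λ i j, U (dist (x i) (x j)) * ‖Ψ x‖ₑ ^ 2 ≤
      (∫⁻ x in nearestCell Λ i j, ENNReal.ofReal μ * ∑ k, ‖G (i, k) x‖ₑ ^ 2) +
        ∫⁻ x in configIn N Λ, 2⁻¹ * v (dist (x i) (x j)) * ‖Ψ x‖ₑ ^ 2 := fun i j hj => by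
    have hij : j ≠ i := by simpa using hj
    refine (pair_bound hμ hR₀ hv_meas hv hsc hU_meas hU_int hU_zero hΛo hΛc hij hΨm hΨ hΨ0
      (fun k => (hG (i, k)).1) (fun k => (hG (i, k)).2.1) (fun k => (hG (i, k)).2.2.1)
      (fun k => (hG (i, k)).2.2.2) (measurableSet_nearestCell hΛo) nearestCell_subset
      fun x hx s hs hs1 => dilate_mem_nearestCell hΛc hij hx hs hs1).trans ?_
    -- The kinetic part stays on the cell, since the cells of `i` share one kinetic energy; the
    -- potential part may be enlarged to all of `Λ^N`, since each ordered pair uses its own half of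
    -- `v` once.
    unfold pairDensity
    rw [lintegral_add_right _ (hvd i j)]
    gcongr
    exact nearestCell_subset
  calc ENNReal.ofReal μ * potentialForm N Λ (nearestNeighbour U) Ψ
      = ∑ i, ∑ j ∈ ({i}ᶜ : Finset (Fin N)), ENNReal.ofReal μ *
          ∫⁻ x in nearestCell Λ i j, U (dist (x i) (x j)) * ‖Ψ x‖ₑ ^ 2 := by
        simp only [potentialForm, nearestNeighbour, Finset.sum_mul]
        rw [lintegral_finsetSum _ (by fun_prop), Finset.mul_sum]
        exact Finset.sum_congr rfl fun i _ => by rw [← Finset.mul_sum, ← hUn i]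
    _ ≤ ∑ i, ∑ j ∈ ({i}ᶜ : Finset (Fin N)),
          ((∫⁻ x in nearestCell Λ i j, ENNReal.ofReal μ * ∑ k, ‖G (i, k) x‖ₑ ^ 2) +
            ∫⁻ x in configIn N Λ, 2⁻¹ * v (dist (x i) (x j)) * ‖Ψ x‖ₑ ^ 2) :=
        Finset.sum_le_sum fun i _ => Finset.sum_le_sum fun j hj => hpair i j hj
    _ = (∑ i, ∫⁻ x in configIn N Λ, ENNReal.ofReal μ * ∑ k, ‖G (i, k) x‖ₑ ^ 2) +
          ∫⁻ x in configIn N Λ, ∑ i, ∑ j ∈ ({i}ᶜ : Finset (Fin N)),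
            2⁻¹ * v (dist (x i) (x j)) * ‖Ψ x‖ₑ ^ 2 := by
        simp only [Finset.sum_add_distrib, sum_setLIntegral_nearestCell hN hΛo]
        congr 1
        rw [lintegral_finsetSum _ fun i _ => Finset.measurable_fun_sum _ fun j _ => hvd i j]
        exact Finset.sum_congr rfl fun i _ => (lintegral_finsetSum _ fun j _ => hvd i j).symm
    _ = _ := by
        congr 1
        · rw [← lintegral_const_mul _ (by fun_prop), ← lintegral_finsetSum _ (by fun_prop)]
          simp only [← Finset.mul_sum, Fintype.sum_prod_type]
        · simp only [potentialForm, ← Finset.sum_mul, two_inv_sum_off_diag]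

/-- The nearest neighbour interaction is bounded by the Hamiltonian. -/
theorem nearestNeighbour_le_hamiltonianForm (hN : 2 ≤ N) {μ a R₀ : ℝ} (hμ : 0 < μ) (hR₀ : 0 ≤ R₀)
    {v : ℝ → ℝ≥0∞} (hv_meas : Measurable v) (hv : ∀ r, R₀ < r → v r = 0)
    (hsc : IsScatteringLength μ v R₀ a) {U : ℝ → ℝ≥0∞} (hU_meas : Measurable U)
    (hU_int : ∫⁻ r in Ioi (0 : ℝ), U r * logRatio r a * ENNReal.ofReal r ≤ 1)
    (hU_zero : ∀ r, r < R₀ → U r = 0)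
    {Λ : Set Plane} (hΛo : IsOpen Λ) (hΛc : Convex ℝ Λ)
    {Ψ : Config N → ℂ} (hΨ : MemLp Ψ 2 (volume.restrict (configIn N Λ))) :
    ENNReal.ofReal μ * potentialForm N Λ (nearestNeighbour U) Ψ ≤ hamiltonianForm N μ v Λ Ψ := by
  have hμ0 : ENNReal.ofReal μ ≠ 0 := by simpa using hμ
  unfold hamiltonianForm kineticForm dirichletEnergy
  -- The bound is shown for every weak gradient separately; if there is none, the infimum is `∞` and
  -- nothing is to be shown.
  simp only [ENNReal.mul_iInf_of_ne hμ0 ENNReal.ofReal_ne_top, ENNReal.iInf_add]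
  refine le_iInf₂ fun G hG => ?_
  obtain ⟨Φ, G₁, hΦΨ, hG₁, hΦm, hΦ, hΦ0, hG₁w⟩ :=
    hG.exists_measurable (isOpen_configIn hΛo).measurableSet hΨ
  have h := nearestNeighbour_le_of_measurable hN hμ hR₀ hv_meas hv hsc hU_meas hU_int hU_zero
    hΛo hΛc hΦm hΦ hΦ0 hG₁w
  rw [potentialForm_congr hΦΨ, potentialForm_congr hΦΨ] at h
  refine h.trans (le_of_eq ?_)
  congr 2
  refine lintegral_congr_ae ?_
  filter_upwards [ae_all_iff.2 hG₁] with x hx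
  exact Finset.sum_congr rfl fun p _ => by rw [hx p]

end

end BoseGas

/-! ### The convex combination of the two bounds. -/

theorem corollary3p2 (N : ℕ) (hN : 2 ≤ N) (μ : ℝ) (hμ : 0 < μ)
    (v : ℝ → ℝ≥0∞) (hv_meas : Measurable v)
    (R₀ : ℝ) (hR₀ : 0 ≤ R₀) (hv : ∀ r, R₀ < r → v r = 0)
    (a : ℝ) (ha : BoseGas.IsScatteringLength μ v R₀ a)
    (U : ℝ → ℝ≥0∞) (hU_meas : Measurable U)
    (hU_int : ∫⁻ r in Ioi (0 : ℝ), U r * BoseGas.logRatio r a * ENNReal.ofReal r ≤ 1)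
    (hU_zero : ∀ r, r < R₀ → U r = 0)
    (Λ : Set BoseGas.Plane) (hΛ_open : IsOpen Λ) (hΛ_conv : Convex ℝ Λ)
    (ε : ℝ) (hε₀ : 0 < ε) (hε₁ : ε < 1) :
    ∀ Ψ : BoseGas.Config N → ℂ, BoseGas.IsBosonic N Λ Ψ →
      ENNReal.ofReal ε * BoseGas.kineticForm N μ Λ Ψ +
          ENNReal.ofReal ((1 - ε) * μ) *
            BoseGas.potentialForm N Λ (BoseGas.nearestNeighbour U) Ψ ≤
        BoseGas.hamiltonianForm N μ v Λ Ψ := by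
  intro Ψ hΨ
  have h := BoseGas.nearestNeighbour_le_hamiltonianForm hN hμ hR₀ hv_meas hv ha hU_meas hU_int
    hU_zero hΛ_open hΛ_conv hΨ.1
  have hT : BoseGas.kineticForm N μ Λ Ψ ≤ BoseGas.hamiltonianForm N μ v Λ Ψ := le_self_add
  -- The fraction `ε` of `H` is bounded below by `ε T`, the fraction `1 - ε` by `(1 - ε) μ W`.
  calc _ ≤ ENNReal.ofReal ε * BoseGas.hamiltonianForm N μ v Λ Ψ +
        ENNReal.ofReal (1 - ε) * BoseGas.hamiltonianForm N μ v Λ Ψ := by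
        rw [ENNReal.ofReal_mul (by linarith), mul_assoc]
        gcongr
    _ = BoseGas.hamiltonianForm N μ v Λ Ψ := by
        rw [← add_mul, ← ENNReal.ofReal_add hε₀.le (by linarith), add_sub_cancel,
          ENNReal.ofReal_one, one_mul]
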